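/- Let $\pi\colon E\to B$ be a smooth real vector bundle of rank $m$ over a smooth $n$-dimensional manifold $B$. Suppose $B$ carries a Riemannian metric, and $E$ carries a smooth fibre metric and a smooth connection compatible with it. Let $TE=H\oplus V$ be the induced splitting into horizontal and vertical subbundles. Let $b_1,\dots,b_n$ be the pullback to $E$ of a local orthonormal coframe of $B$. Let $\zeta_1,\dots,\zeta_m$ be the local $1$-forms on $E$ that vanish on $H$ and on $V$ give the components, with respect to a local orthonormal frame of the bundle, of a vertical vector regarded as an element of the fibre. Let $r$ denote the fibre norm on $E$, and let $\frac{\partial}{\partial r}$ be the vertical vector field on $\{r>0\}$ which at $e\in E$ is the vertical vector corresponding to $e/|e|$. Let $h,k,s$ be smooth real functions of $r\in(0,\infty)$ with $h,k>0$, and consider on the complement $\{r>0\}$ of the zero section the Riemannian metric $$ g = h(r)^2\sum_{i=1}^n b_i^2 + k(r)^2\sum_{\alpha=1}^m\zeta_\alpha^2 , $$ with Levi-Civita connection $\nabla$ and Laplacian $\Delta A=g^{pq}\nabla_p\nabla_q A$ on functions and on vector fields. (If $h,k$ are defined on $[0,\infty)$ and $g$ is a smooth metric on all of $E$, the formulas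 below hold in particular for $g$ at all points with $r>0$.) Primes denote derivatives with respect to $r$. Then at every point of $\{r>0\}$: (1) $$\Delta s=\frac1{k^2}s''+\Big(\frac{m-1}{k^2r}+\frac{nh'}{hk^2}+\frac{(m-2)k'}{k^3}\Big)s'.$$ Suppose moreover that $g$ is Ricci-flat on $\{r>0\}$, and let $X=s(r)\frac{\partial}{\partial r}$. Then at every point of $\{r>0\}$: (2) $$\Delta X=\Big[\frac1{k^2}s''+\Big(\frac{m-1}{k^2r}+\frac{nh'}{hk^2}+\frac{mk'}{k^3}\Big)s'+\Big(-\frac{m-1}{k^2r^2}+\frac{nh''}{hk^2}-\frac{n(h')^2}{h^2k^2}+\frac{mk''}{k^3}-\frac{m(k')^2}{k^4}\Big)s\Big]\frac{\partial}{\partial r};$$ (3) $$|\nabla X|^2=-\frac{(m-1)s^2k''}{k}+(s')^2+\frac{2ss'k'}{k}+\frac{(2m-1)s^2(k')^2}{k^2}+\frac{(m-1)s^2k'}{kr}+\frac{ns^2h'k'}{hk}+\frac{(m-1)s^2}{r^2}-\frac{ns^2h''}{h}+\frac{ns^2(h')^2}{h^2}.$$ -/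

import Mathlib

open Bundle Manifold
open scoped Manifold ContDiff Topology

noncomputable section

/-! ### Riemannian geometry on an open subset of a manifold

A metric is given by its values `g x u v` on tangent vectors; the notions below are relative to an
open set `U` on which `g` is a smooth Riemannian metric. -/

namespace RiemGeom

variable {E : Type*} [NormedAddCommGroup E] [NormedSpace ℝ E] [FiniteDimensional ℝ E]
  {H : Type*} [TopologicalSpace H] (I : ModelWithCorners ℝ E H)
  {M : Type*} [TopologicalSpace M] [ChartedSpace H M] [IsManifold I 1 M]

/-- `cov` (with `cov Y x v` standing for `∇_v Y` at `x`) is the Levi-Civita connection of `g` on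
`U`: a covariant derivative on `TM` over `U` that is torsion-free and compatible with `g`. -/
structure IsLeviCivitaOn (g : ∀ x : M, TangentSpace I x → TangentSpace I x → ℝ) (U : Set M)
    (cov : (∀ x : M, TangentSpace I x) → ∀ x : M, TangentSpace I x →L[ℝ] TangentSpace I x) :
    Prop where
  isCovariantDerivativeOn : IsCovariantDerivativeOn E cov U
  torsion_free : ∀ x ∈ U, ∀ X Y : (∀ x : M, TangentSpace I x),
    MDifferentiableAt I I.tangent (fun y ↦ (⟨y, X y⟩ : TangentBundle I M)) x →
    MDifferentiableAt I I.tangent (fun y ↦ (⟨y, Y y⟩ : TangentBundle I M)) x →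
    cov Y x (X x) - cov X x (Y x) = VectorField.mlieBracket I X Y x
  metric : ∀ x ∈ U, ∀ Y Z : (∀ x : M, TangentSpace I x), ∀ v : TangentSpace I x,
    MDifferentiableAt I I.tangent (fun y ↦ (⟨y, Y y⟩ : TangentBundle I M)) x →
    MDifferentiableAt I I.tangent (fun y ↦ (⟨y, Z y⟩ : TangentBundle I M)) x →
    mvfderiv I (fun y ↦ g y (Y y) (Z y)) x v = g x (cov Y x v) (Z x) + g x (Y x) (cov Z x v)

open Classical in
/-- The Levi-Civita connection of `g` on `U` (`leviCivita I g U Y x v` is `∇_v Y` at `x`). -/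
def leviCivita (g : ∀ x : M, TangentSpace I x → TangentSpace I x → ℝ) (U : Set M) :
    (∀ x : M, TangentSpace I x) → ∀ x : M, TangentSpace I x →L[ℝ] TangentSpace I x :=
  if h : ∃ cov, IsLeviCivitaOn I g U cov then h.choose else 0

/-- A basis of the tangent space at `x`. -/
def tangentBasis (x : M) :
    Module.Basis (Fin (Module.finrank ℝ E)) ℝ (TangentSpace I x) :=
  (Module.finBasis ℝ E : Module.Basis (Fin (Module.finrank ℝ E)) ℝ E)

/-- The trace `g^{ab} A(w_a, w_b)` at `x` of a tensor `A`, where `(g^{ab})` is the inverse of the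
matrix `g(w_a, w_b)` and `w` is a basis of the tangent space. -/
def metricTrace (g : ∀ x : M, TangentSpace I x → TangentSpace I x → ℝ) (x : M)
    {W : Type*} [AddCommGroup W] [Module ℝ W] (A : TangentSpace I x → TangentSpace I x → W) : W :=
  ∑ a, ∑ c, (Matrix.of fun i j ↦ g x (tangentBasis I x i) (tangentBasis I x j))⁻¹ a c •
    A (tangentBasis I x a) (tangentBasis I x c)

/-- The Laplacian `Δ f = g^{ab} (w_a (w_b f) - (∇_{w_a} w_b) f)` of a function, with `w` a smooth
frame near `x` extending a basis of the tangent space at `x`. -/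
def laplacian (g : ∀ x : M, TangentSpace I x → TangentSpace I x → ℝ) (U : Set M)
    (f : M → ℝ) (x : M) : ℝ :=
  metricTrace I g x fun u v ↦
    mvfderiv I (fun y ↦ mvfderiv I f y (FiberBundle.extend E v y)) x u
      - mvfderiv I f x (leviCivita I g U (FiberBundle.extend E v) x u)

/-- The Laplacian `Δ X = g^{ab} (∇_{w_a} (∇_{w_b} X) - ∇_{∇_{w_a} w_b} X)` of a vector field, with
`w` a smooth frame near `x` extending a basis of the tangent space at `x`. -/
def vectorLaplacian (g : ∀ x : M, TangentSpace I x → TangentSpace I x → ℝ) (U : Set M)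
    (X : ∀ x : M, TangentSpace I x) (x : M) : TangentSpace I x :=
  metricTrace I g x fun u v ↦
    leviCivita I g U (fun y ↦ leviCivita I g U X y (FiberBundle.extend E v y)) x u
      - leviCivita I g U X x (leviCivita I g U (FiberBundle.extend E v) x u)

/-- The squared norm `|∇X|² = g^{ab} g(∇_{w_a} X, ∇_{w_b} X)`. -/
def normSqNabla (g : ∀ x : M, TangentSpace I x → TangentSpace I x → ℝ) (U : Set M)
    (X : ∀ x : M, TangentSpace I x) (x : M) : ℝ :=
  metricTrace I g x fun u v ↦ g x (leviCivita I g U X x u) (leviCivita I g U X x v)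

/-- The curvature `R(u, v) w = ∇_u ∇_v w - ∇_v ∇_u w - ∇_{[u, v]} w`, computed with smooth local
extensions of the tangent vectors `u`, `v`, `w`. -/
def curvature (g : ∀ x : M, TangentSpace I x → TangentSpace I x → ℝ) (U : Set M)
    (x : M) (u v w : TangentSpace I x) : TangentSpace I x :=
  leviCivita I g U
      (fun y ↦ leviCivita I g U (FiberBundle.extend E w) y (FiberBundle.extend E v y)) x u
    - leviCivita I g U
      (fun y ↦ leviCivita I g U (FiberBundle.extend E w) y (FiberBundle.extend E u y)) x v
    - leviCivita I g U (FiberBundle.extend E w) x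
      (VectorField.mlieBracket I (FiberBundle.extend E u) (FiberBundle.extend E v) x)

/-- The Ricci curvature `Ric(v, w)`, the trace of `u ↦ R(u, v) w`. -/
def ricci (g : ∀ x : M, TangentSpace I x → TangentSpace I x → ℝ) (U : Set M)
    (x : M) (v w : TangentSpace I x) : ℝ :=
  ∑ a, (tangentBasis I x).coord a (curvature I g U x (tangentBasis I x a) v w)

/-- `g` is Ricci-flat on `U`. -/
def IsRicciFlatOn (g : ∀ x : M, TangentSpace I x → TangentSpace I x → ℝ) (U : Set M) : Prop :=
  ∀ x ∈ U, ∀ v w : TangentSpace I x, ricci I g U x v w = 0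

end RiemGeom

/-! ### The total space of a metric vector bundle with connection -/

namespace BundleMetric

variable {EB : Type*} [NormedAddCommGroup EB] [NormedSpace ℝ EB]
  {B : Type*} [TopologicalSpace B] [ChartedSpace EB B] [IsManifold 𝓘(ℝ, EB) ∞ B]
  {F : Type*} [NormedAddCommGroup F] [NormedSpace ℝ F]
  {V : B → Type*} [TopologicalSpace (TotalSpace F V)]
  [∀ b, NormedAddCommGroup (V b)] [∀ b, InnerProductSpace ℝ (V b)]
  [FiberBundle F V] [VectorBundle ℝ F V]

/-- The derivative `dπ` at `e` of the bundle projection. -/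
def dproj (e : TotalSpace F V) :
    TangentSpace (𝓘(ℝ, EB).prod 𝓘(ℝ, F)) e →L[ℝ] TangentSpace 𝓘(ℝ, EB) e.proj :=
  mfderiv (𝓘(ℝ, EB).prod 𝓘(ℝ, F)) 𝓘(ℝ, EB) (TotalSpace.proj : TotalSpace F V → B) e

/-- The canonical isomorphism of the fibre through `e` with the vertical tangent space at `e`: the
derivative at `e` of the inclusion of the fibre. -/
def vertLift (e : TotalSpace F V) :
    V e.proj →L[ℝ] TangentSpace (𝓘(ℝ, EB).prod 𝓘(ℝ, F)) e :=
  (mfderiv 𝓘(ℝ, V e.proj) (𝓘(ℝ, EB).prod 𝓘(ℝ, F))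
    (fun w : V e.proj ↦ (⟨e.proj, w⟩ : TotalSpace F V)) e.2) ∘L
    (NormedSpace.fromTangentSpace (𝕜 := ℝ) e.2).symm.toContinuousLinearMap

/-- The derivative at `e.proj` of a smooth local section `σ` with `σ (e.proj) = e`. -/
def dsection (e : TotalSpace F V) :
    TangentSpace 𝓘(ℝ, EB) e.proj →L[ℝ] TangentSpace (𝓘(ℝ, EB).prod 𝓘(ℝ, F)) e :=
  mfderiv 𝓘(ℝ, EB) (𝓘(ℝ, EB).prod 𝓘(ℝ, F))
    (fun b ↦ (⟨b, FiberBundle.extend F e.2 b⟩ : TotalSpace F V)) e.proj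

/-- The horizontal lift at `e` with respect to the connection `D`: the lift of `u` is
`dσ(u) - (D_u σ)^{vert}` for a smooth local section `σ` through `e`. -/
def horLift (D : CovariantDerivative 𝓘(ℝ, EB) F V) (e : TotalSpace F V) :
    TangentSpace 𝓘(ℝ, EB) e.proj →L[ℝ] TangentSpace (𝓘(ℝ, EB).prod 𝓘(ℝ, F)) e :=
  dsection e - vertLift e ∘L D (FiberBundle.extend F e.2) e.proj

/-- The splitting `H_e ⊕ V_e = T_e`, with `H_e` and `V_e` identified with the tangent space of the
base and with the fibre. -/
def splitting (D : CovariantDerivative 𝓘(ℝ, EB) F V) (e : TotalSpace F V) :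
    (TangentSpace 𝓘(ℝ, EB) e.proj × V e.proj) →L[ℝ]
      TangentSpace (𝓘(ℝ, EB).prod 𝓘(ℝ, F)) e :=
  (horLift D e).coprod (vertLift e)

/-- The vertical component `T_e → V_e` of the splitting, with values in the fibre. Its components in
an orthonormal frame of the bundle are the vertical one-forms `ζ_α`, which vanish on `H`. -/
def vertPart (D : CovariantDerivative 𝓘(ℝ, EB) F V) (e : TotalSpace F V) :
    TangentSpace (𝓘(ℝ, EB).prod 𝓘(ℝ, F)) e →L[ℝ] V e.proj :=
  ContinuousLinearMap.snd ℝ (TangentSpace 𝓘(ℝ, EB) e.proj) (V e.proj) ∘L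
    (splitting D e).inverse

/-- The metric `h(r)² ∑ b_i² + k(r)² ∑ ζ_α²` on the total space, where `r` is the fibre norm,
`∑ b_i²` is the pullback of the base metric and `∑ ζ_α²` is the fibre metric of the vertical part. -/
def bundleMetric (gB : ContMDiffRiemannianMetric 𝓘(ℝ, EB) ∞ EB
      (fun b : B ↦ TangentSpace 𝓘(ℝ, EB) b))
    (D : CovariantDerivative 𝓘(ℝ, EB) F V) (h k : ℝ → ℝ) (e : TotalSpace F V)
    (v w : TangentSpace (𝓘(ℝ, EB).prod 𝓘(ℝ, F)) e) : ℝ :=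
  h ‖e.2‖ ^ 2 * gB.inner e.proj (dproj e v) (dproj e w)
    + k ‖e.2‖ ^ 2 * inner ℝ (vertPart D e v) (vertPart D e w)

/-- The complement of the zero section. -/
def awayFromZero (V : B → Type*) [∀ b, NormedAddCommGroup (V b)] : Set (TotalSpace F V) :=
  {e | e.2 ≠ 0}

/-- The radial vector field `∂/∂r = (x_α / r) ∂/∂x_α` (meaningful off the zero section). -/
def radialField (e : TotalSpace F V) : TangentSpace (𝓘(ℝ, EB).prod 𝓘(ℝ, F)) e :=
  vertLift e (‖e.2‖⁻¹ • e.2)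

end BundleMetric

end

noncomputable section

set_option maxSynthPendingDepth 3
set_option linter.unusedSectionVars false

namespace RiemGeom

section Chart

variable {E : Type*} [NormedAddCommGroup E] [NormedSpace ℝ E]
  {H : Type*} [TopologicalSpace H] (I : ModelWithCorners ℝ E H)
  {M : Type*} [TopologicalSpace M] [ChartedSpace H M] [IsManifold I 1 M]

/-- The coordinates of a tangent vector at `y` in the chart at `x₀`. -/
abbrev tangentCoord (x₀ y : M) : TangentSpace I y →L[ℝ] E :=
  (trivializationAt E (TangentSpace I) x₀).continuousLinearMapAt ℝ y

/-- The tangent vector at `y` with given coordinates in the chart at `x₀`. -/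
abbrev tangentCoordSymm (x₀ y : M) : E →L[ℝ] TangentSpace I y :=
  (trivializationAt E (TangentSpace I) x₀).symmL ℝ y

/-- The local representation of a vector field in the chart at `x₀`. -/
def fieldRep (x₀ : M) (Y : ∀ x : M, TangentSpace I x) (z : E) : E :=
  tangentCoord I x₀ ((extChartAt I x₀).symm z) (Y ((extChartAt I x₀).symm z))

variable {I} {x₀ y : M}

lemma tangentCoord_symm (hy : y ∈ (chartAt H x₀).source) (v : E) :
    tangentCoord I x₀ y (tangentCoordSymm I x₀ y v) = v :=
  (trivializationAt E (TangentSpace I) x₀).continuousLinearMapAt_symmL (R := ℝ) (b := y) hy v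

lemma tangentCoordSymm_coord (hy : y ∈ (chartAt H x₀).source) (v : TangentSpace I y) :
    tangentCoordSymm I x₀ y (tangentCoord I x₀ y v) = v :=
  (trivializationAt E (TangentSpace I) x₀).symmL_continuousLinearMapAt (R := ℝ) (b := y) hy v

lemma tangentCoord_injective (hy : y ∈ (chartAt H x₀).source) :
    Function.Injective (tangentCoord I x₀ y) :=
  Function.LeftInverse.injective (g := tangentCoordSymm I x₀ y) (tangentCoordSymm_coord hy)

lemma tangentCoord_eq_mfderiv (hy : y ∈ (chartAt H x₀).source) :
    tangentCoord I x₀ y = mfderiv I 𝓘(ℝ, E) (extChartAt I x₀) y :=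
  TangentBundle.continuousLinearMapAt_trivializationAt hy

lemma tangentCoord_self (x : M) (v : TangentSpace I x) : tangentCoord I x x v = v := by
  rw [tangentCoord_eq_mfderiv (mem_chart_source H x), mfderiv_extChartAt_self]
  rfl

lemma fieldRep_extChartAt (hy : y ∈ (chartAt H x₀).source) (Y : ∀ x : M, TangentSpace I x) :
    fieldRep I x₀ Y (extChartAt I x₀ y) = tangentCoord I x₀ y (Y y) := by
  have := extChartAt_to_inv (I := I) x₀
  rw [fieldRep, (extChartAt I x₀).left_inv (by rwa [extChartAt_source])]

variable [I.Boundaryless]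

lemma mdifferentiableAt_extChartAt_symm {z : E} (hz : z ∈ (extChartAt I x₀).target) :
    MDifferentiableAt 𝓘(ℝ, E) I (extChartAt I x₀).symm z := by
  have := mdifferentiableWithinAt_extChartAt_symm hz
  rwa [I.range_eq_univ, mdifferentiableWithinAt_univ] at this

lemma tangentCoordSymm_eq_mfderiv (hy : y ∈ (chartAt H x₀).source) :
    tangentCoordSymm I x₀ y
      = mfderiv 𝓘(ℝ, E) I (extChartAt I x₀).symm (extChartAt I x₀ y) := by
  rw [tangentCoordSymm, TangentBundle.symmL_trivializationAt hy, I.range_eq_univ,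
    mfderivWithin_univ]

lemma mdifferentiableAt_iff_comp_symm {F : Type*} [NormedAddCommGroup F] [NormedSpace ℝ F]
    {f : M → F} (hy : y ∈ (chartAt H x₀).source) :
    MDifferentiableAt I 𝓘(ℝ, F) f y ↔
      DifferentiableAt ℝ (f ∘ (extChartAt I x₀).symm) (extChartAt I x₀ y) := by
  have hy' : y ∈ (extChartAt I x₀).source := by rwa [extChartAt_source]
  have hz := (extChartAt I x₀).map_source hy'
  constructor
  · intro h
    rw [← mdifferentiableAt_iff_differentiableAt]
    refine MDifferentiableAt.comp (I' := I) _ ?_ (mdifferentiableAt_extChartAt_symm hz)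
    rwa [(extChartAt I x₀).left_inv hy']
  · intro h
    rw [← mdifferentiableAt_iff_differentiableAt] at h
    have := MDifferentiableAt.comp (I' := 𝓘(ℝ, E)) y h (mdifferentiableAt_extChartAt hy)
    refine this.congr_of_eventuallyEq ?_
    filter_upwards [(isOpen_extChartAt_source (I := I) x₀).mem_nhds hy'] with x hx
    rw [Function.comp_apply, Function.comp_apply, (extChartAt I x₀).left_inv hx]

lemma mvfderiv_eq_fderiv {F : Type*} [NormedAddCommGroup F] [NormedSpace ℝ F]
    {f : M → F} (hf : MDifferentiableAt I 𝓘(ℝ, F) f y) (hy : y ∈ (chartAt H x₀).source)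
    (v : TangentSpace I y) :
    mvfderiv I f y v =
      fderiv ℝ (f ∘ (extChartAt I x₀).symm) (extChartAt I x₀ y) (tangentCoord I x₀ y v) := by
  have hy' : y ∈ (extChartAt I x₀).source := by rwa [extChartAt_source]
  have h := (mdifferentiableAt_iff_comp_symm hy).1 hf
  rw [← mdifferentiableAt_iff_differentiableAt] at h
  have h2 : f =ᶠ[𝓝 y] (f ∘ (extChartAt I x₀).symm) ∘ extChartAt I x₀ := by
    filter_upwards [(isOpen_extChartAt_source (I := I) x₀).mem_nhds hy'] with x hx
    rw [Function.comp_apply, Function.comp_apply, (extChartAt I x₀).left_inv hx]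
  rw [tangentCoord_eq_mfderiv hy]
  simp only [mvfderiv]
  rw [h2.mfderiv_eq, mfderiv_comp y h (mdifferentiableAt_extChartAt hy), mfderiv_eq_fderiv]
  rfl

end Chart

section Field

variable {E : Type*} [NormedAddCommGroup E] [NormedSpace ℝ E]
  {H : Type*} [TopologicalSpace H] {I : ModelWithCorners ℝ E H} [I.Boundaryless]
  {M : Type*} [TopologicalSpace M] [ChartedSpace H M] [IsManifold I ∞ M]
  {x₀ y : M}

lemma mdifferentiableAt_field_iff {Y : ∀ x : M, TangentSpace I x}
    (hy : y ∈ (chartAt H x₀).source) :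
    MDifferentiableAt I I.tangent (fun y ↦ (⟨y, Y y⟩ : TangentBundle I M)) y ↔
      DifferentiableAt ℝ (fieldRep I x₀ Y) (extChartAt I x₀ y) := by
  have h1 := (trivializationAt E (TangentSpace I) x₀).mdifferentiableAt_section_iff I Y hy
  have hy' : y ∈ (extChartAt I x₀).source := by rwa [extChartAt_source]
  refine h1.trans ((mdifferentiableAt_iff_comp_symm hy).trans ?_)
  apply Filter.EventuallyEq.differentiableAt_iff
  filter_upwards [(isOpen_extChartAt_target (I := I) x₀).mem_nhds
    ((extChartAt I x₀).map_source hy')] with z hz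
  have := (extChartAt I x₀).map_target hz
  rw [extChartAt_source] at this
  simp only [Function.comp, fieldRep]
  rw [Trivialization.continuousLinearMapAt_apply_of_mem]
  exact this

lemma mlieBracket_eq_lieBracket (V W : ∀ z : E, TangentSpace 𝓘(ℝ, E) z) (z : E) :
    VectorField.mlieBracket 𝓘(ℝ, E) V W z = VectorField.lieBracket ℝ V W z := by
  rw [← VectorField.mlieBracketWithin_univ, VectorField.mlieBracketWithin_eq_lieBracketWithin]
  exact congrFun (VectorField.lieBracketWithin_univ (𝕜 := ℝ) (V := (V : E → E)) (W := (W : E → E))) z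

lemma tangentCoord_mlieBracket [CompleteSpace E] {X Y : ∀ x : M, TangentSpace I x}
    (hX : MDifferentiableAt I I.tangent (fun y ↦ (⟨y, X y⟩ : TangentBundle I M)) y)
    (hY : MDifferentiableAt I I.tangent (fun y ↦ (⟨y, Y y⟩ : TangentBundle I M)) y)
    (hy : y ∈ (chartAt H x₀).source) :
    tangentCoord I x₀ y (VectorField.mlieBracket I X Y y) =
      fderiv ℝ (fieldRep I x₀ Y) (extChartAt I x₀ y) (tangentCoord I x₀ y (X y))
      - fderiv ℝ (fieldRep I x₀ X) (extChartAt I x₀ y) (tangentCoord I x₀ y (Y y)) := by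
  have hy' : y ∈ (extChartAt I x₀).source := by rwa [extChartAt_source]
  set z := extChartAt I x₀ y with hz
  have hzt : z ∈ (extChartAt I x₀).target := (extChartAt I x₀).map_source hy'
  have hzy : (extChartAt I x₀).symm z = y := (extChartAt I x₀).left_inv hy'
  have key : ∀ (W : ∀ x : M, TangentSpace I x), ∀ z' ∈ (extChartAt I x₀).target,
      VectorField.mpullback 𝓘(ℝ, E) I (extChartAt I x₀).symm W z' = fieldRep I x₀ W z' := by
    intro W z' hz'
    have hs := (extChartAt I x₀).map_target hz'
    rw [extChartAt_source] at hs
    rw [VectorField.mpullback_apply, fieldRep]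
    have h2 := tangentCoordSymm_eq_mfderiv (I := I) hs
    rw [(extChartAt I x₀).right_inv hz'] at h2
    rw [← h2]
    have h3 : (tangentCoordSymm I x₀ ((extChartAt I x₀).symm z')).inverse
        = tangentCoord I x₀ ((extChartAt I x₀).symm z') :=
      ContinuousLinearMap.inverse_eq (by ext v; exact tangentCoordSymm_coord hs v)
        (by ext v; exact tangentCoord_symm hs v)
    exact congrArg (fun A ↦ A (W ((extChartAt I x₀).symm z'))) h3
  have hX' := hX
  have hY' := hY
  rw [← hzy] at hX' hY'
  have : IsManifold I (minSmoothness ℝ 2) M := by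
    rw [minSmoothness_of_isRCLikeNormedField]; infer_instance
  have hsm : ContMDiffAt 𝓘(ℝ, E) I 2 (extChartAt I x₀).symm z := by
    exact (contMDiffOn_extChartAt_symm (n := 2) (I := I) x₀).contMDiffAt
      ((isOpen_extChartAt_target (I := I) x₀).mem_nhds hzt)
  have h := VectorField.mpullback_mlieBracket (I := 𝓘(ℝ, E)) (I' := I) hX' hY' hsm
    (by rw [minSmoothness_of_isRCLikeNormedField])
  rw [key _ z hzt] at h
  have e := (isOpen_extChartAt_target (I := I) x₀).mem_nhds hzt
  have hXe : VectorField.mpullback 𝓘(ℝ, E) I (extChartAt I x₀).symm X =ᶠ[𝓝 z] fieldRep I x₀ X :=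
    Filter.eventuallyEq_of_mem e (key X)
  have hYe : VectorField.mpullback 𝓘(ℝ, E) I (extChartAt I x₀).symm Y =ᶠ[𝓝 z] fieldRep I x₀ Y :=
    Filter.eventuallyEq_of_mem e (key Y)
  rw [hXe.mlieBracket_vectorField_eq hYe] at h
  have h0 : tangentCoord I x₀ y (VectorField.mlieBracket I X Y y) = _ :=
    (fieldRep_extChartAt hy (VectorField.mlieBracket I X Y)).symm
  have h' := h0.trans <| h.trans (mlieBracket_eq_lieBracket (fieldRep I x₀ X) (fieldRep I x₀ Y) z)
  have hX2 := fieldRep_extChartAt hy X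
  have hY2 := fieldRep_extChartAt hy Y
  rw [← hX2, ← hY2]
  exact h'

end Field

end RiemGeom

namespace RiemGeom

section Christoffel

variable {E : Type*} [NormedAddCommGroup E] [NormedSpace ℝ E]

/-- `G` is a smooth Riemannian metric on the open subset `N` of a vector space. -/
structure IsMetricOn (G : E → E →L[ℝ] E →L[ℝ] ℝ) (N : Set E) : Prop where
  isOpen : IsOpen N
  contDiffOn : ContDiffOn ℝ ∞ G N
  symm : ∀ z ∈ N, ∀ v w, G z v w = G z w v
  pos : ∀ z ∈ N, ∀ v, v ≠ 0 → 0 < G z v v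

/-- The Christoffel symbols of the first kind. -/
def christoffelLower (G : E → E →L[ℝ] E →L[ℝ] ℝ) (z : E) : E →L[ℝ] E →L[ℝ] E →L[ℝ] ℝ :=
  (1 / 2 : ℝ) • (fderiv ℝ G z + (fderiv ℝ G z).flip
    - (ContinuousLinearMap.flipₗᵢ ℝ E E ℝ :
        (E →L[ℝ] E →L[ℝ] ℝ) ≃ₗᵢ[ℝ] (E →L[ℝ] E →L[ℝ] ℝ)).toContinuousLinearEquiv.toContinuousLinearMap
        ∘L (fderiv ℝ G z).flip)

/-- The Christoffel symbols of the second kind. -/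
def christoffel (G : E → E →L[ℝ] E →L[ℝ] ℝ) (z : E) : E →L[ℝ] E →L[ℝ] E :=
  (ContinuousLinearMap.compL ℝ E (E →L[ℝ] ℝ) E (G z).inverse) ∘L christoffelLower G z

lemma christoffelLower_apply (G : E → E →L[ℝ] E →L[ℝ] ℝ) (z u v w : E) :
    christoffelLower G z u v w =
      1 / 2 * (fderiv ℝ G z u v w + fderiv ℝ G z v u w - fderiv ℝ G z w u v) := by
  simp [christoffelLower, ContinuousLinearMap.flipₗᵢ]

namespace IsMetricOn

variable {G : E → E →L[ℝ] E →L[ℝ] ℝ} {N : Set E} {z : E}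

lemma differentiableAt (hG : IsMetricOn G N) (hz : z ∈ N) : DifferentiableAt ℝ G z :=
  (hG.contDiffOn.contDiffAt (hG.isOpen.mem_nhds hz)).differentiableAt (by simp)

lemma eq_of_inner (hG : IsMetricOn G N) (hz : z ∈ N) {v v' : E}
    (h : ∀ w, G z v w = G z v' w) : v = v' := by
  by_contra hne
  have := hG.pos z hz (v - v') (sub_ne_zero.2 hne)
  simp [h] at this

lemma fderiv_symm (hG : IsMetricOn G N) (hz : z ∈ N) (u v w : E) :
    fderiv ℝ G z u v w = fderiv ℝ G z u w v := by
  have h1 := hG.differentiableAt hz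
  have h2 : ∀ a b : E, fderiv ℝ (fun z' ↦ G z' a b) z u = fderiv ℝ G z u a b := by
    intro a b
    rw [fderiv_clm_apply (h1.clm_apply (differentiableAt_const a)) (differentiableAt_const b),
      fderiv_clm_apply h1 (differentiableAt_const a)]
    simp
  rw [← h2, ← h2]
  congr 1
  apply Filter.EventuallyEq.fderiv_eq
  filter_upwards [hG.isOpen.mem_nhds hz] with z' hz'
  exact hG.symm z' hz' v w

variable [FiniteDimensional ℝ E]

/-- The metric at a point as an isomorphism onto the dual. -/
def toDual (hG : IsMetricOn G N) (hz : z ∈ N) : E ≃L[ℝ] (E →L[ℝ] ℝ) :=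
  (LinearEquiv.ofInjectiveOfFinrankEq (G z).toLinearMap
    (fun v v' h ↦ hG.eq_of_inner hz fun w ↦ congrArg (fun A : E →L[ℝ] ℝ ↦ A w) h)
    (by
      rw [← (LinearMap.toContinuousLinearMap (𝕜 := ℝ) (E := E) (F' := ℝ)).finrank_eq]
      exact (Subspace.dual_finrank_eq (K := ℝ) (V := E)).symm)).toContinuousLinearEquiv

lemma coe_toDual (hG : IsMetricOn G N) (hz : z ∈ N) :
    (hG.toDual hz : E →L[ℝ] (E →L[ℝ] ℝ)) = G z := by
  ext v w; rfl

lemma inverse_apply (hG : IsMetricOn G N) (hz : z ∈ N) (ℓ : E →L[ℝ] ℝ) :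
    G z ((G z).inverse ℓ) = ℓ := by
  have h := hG.coe_toDual hz
  rw [← h, ContinuousLinearMap.inverse_equiv]
  exact (hG.toDual hz).apply_symm_apply ℓ

lemma inner_christoffel (hG : IsMetricOn G N) (hz : z ∈ N) (u v w : E) :
    G z (christoffel G z u v) w =
      1 / 2 * (fderiv ℝ G z u v w + fderiv ℝ G z v u w - fderiv ℝ G z w u v) := by
  rw [← christoffelLower_apply]
  exact congrArg (fun A : E →L[ℝ] ℝ ↦ A w) (hG.inverse_apply hz _)

lemma christoffel_comm (hG : IsMetricOn G N) (hz : z ∈ N) (u v : E) :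
    christoffel G z u v = christoffel G z v u := by
  refine hG.eq_of_inner hz fun w ↦ ?_
  rw [hG.inner_christoffel hz, hG.inner_christoffel hz, hG.fderiv_symm hz w u v]
  ring

lemma fderiv_eq (hG : IsMetricOn G N) (hz : z ∈ N) (u v w : E) :
    fderiv ℝ G z u v w = G z (christoffel G z u v) w + G z v (christoffel G z u w) := by
  rw [hG.symm z hz v, hG.inner_christoffel hz, hG.inner_christoffel hz, hG.fderiv_symm hz u w v,
    hG.fderiv_symm hz v u w, hG.fderiv_symm hz w u v]
  ring

set_option synthInstance.maxHeartbeats 200000 in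
lemma contDiffOn_christoffel (hG : IsMetricOn G N) : ContDiffOn ℝ ∞ (christoffel G) N := by
  have h1 : ContDiffOn ℝ ∞ (fderiv ℝ G) N :=
    hG.contDiffOn.fderiv_of_isOpen hG.isOpen (by simp)
  have h2 : ContDiffOn ℝ ∞ (fun z ↦ (fderiv ℝ G z).flip) N :=
    (ContinuousLinearMap.flipₗᵢ ℝ E E (E →L[ℝ] ℝ)).toContinuousLinearEquiv.contDiff.comp_contDiffOn
      h1
  have h3 : ContDiffOn ℝ ∞ (christoffelLower G) N :=
    ((h1.add h2).sub (contDiffOn_const.clm_comp h2)).const_smul _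
  have h4 : ContDiffOn ℝ ∞ (fun z ↦ (G z).inverse) N := by
    intro z hz
    have : ContDiffAt ℝ ∞ ContinuousLinearMap.inverse (G z) := by
      rw [← hG.coe_toDual hz]; exact contDiffAt_map_inverse _
    exact this.comp_contDiffWithinAt z (hG.contDiffOn z hz)
  have h5 : ContDiffOn ℝ ∞
      (fun z ↦ ContinuousLinearMap.compL ℝ E (E →L[ℝ] ℝ) E (G z).inverse) N :=
    ContDiff.comp_contDiffOn (g := ContinuousLinearMap.compL ℝ E (E →L[ℝ] ℝ) E)
      (ContinuousLinearMap.contDiff _) h4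
  exact h5.clm_comp h3

end IsMetricOn

end Christoffel

end RiemGeom

namespace RiemGeom

section LeviCivita

variable {E : Type*} [NormedAddCommGroup E] [NormedSpace ℝ E]
  {H : Type*} [TopologicalSpace H] {I : ModelWithCorners ℝ E H}
  {M : Type*} [TopologicalSpace M] [ChartedSpace H M]

/-- `G` represents the metric `g` on the part `N` of the chart at `x₀`. -/
structure IsMetricChart [IsManifold I 1 M] (g : ∀ x : M, TangentSpace I x → TangentSpace I x → ℝ) (x₀ : M)
    (G : E → E →L[ℝ] E →L[ℝ] ℝ) (N : Set E) : Prop extends IsMetricOn G N where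
  subset : N ⊆ (extChartAt I x₀).target
  mem : extChartAt I x₀ x₀ ∈ N
  eq : ∀ y ∈ (chartAt H x₀).source, extChartAt I x₀ y ∈ N → ∀ v w : TangentSpace I y,
    g y v w = G (extChartAt I x₀ y) (tangentCoord I x₀ y v) (tangentCoord I x₀ y w)

/-- The covariant derivative in the chart at `x₀` given by the Christoffel symbols of `G`. -/
def chartCov [IsManifold I 1 M] (G : E → E →L[ℝ] E →L[ℝ] ℝ) (x₀ : M) (Y : ∀ x : M, TangentSpace I x) (y : M) :
    TangentSpace I y →L[ℝ] TangentSpace I y :=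
  tangentCoordSymm I x₀ y ∘L
    (fderiv ℝ (fieldRep I x₀ Y) (extChartAt I x₀ y)
      + (christoffel G (extChartAt I x₀ y)).flip (fieldRep I x₀ Y (extChartAt I x₀ y))) ∘L
    tangentCoord I x₀ y

lemma tangentCoord_chartCov [IsManifold I 1 M] {G : E → E →L[ℝ] E →L[ℝ] ℝ} {x₀ y : M}
    (hy : y ∈ (chartAt H x₀).source) (Y : ∀ x : M, TangentSpace I x) (v : TangentSpace I y) :
    tangentCoord I x₀ y (chartCov G x₀ Y y v) =
      fderiv ℝ (fieldRep I x₀ Y) (extChartAt I x₀ y) (tangentCoord I x₀ y v)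
        + christoffel G (extChartAt I x₀ y) (tangentCoord I x₀ y v)
          (tangentCoord I x₀ y (Y y)) := by
  have h : chartCov G x₀ Y y v = tangentCoordSymm I x₀ y
    ((fderiv ℝ (fieldRep I x₀ Y) (extChartAt I x₀ y)
      + (christoffel G (extChartAt I x₀ y)).flip (fieldRep I x₀ Y (extChartAt I x₀ y)))
      (tangentCoord I x₀ y v)) := rfl
  rw [h, tangentCoord_symm hy, ← fieldRep_extChartAt hy]
  rfl

variable [I.Boundaryless] [IsManifold I ∞ M] [FiniteDimensional ℝ E]
  {g : ∀ x : M, TangentSpace I x → TangentSpace I x → ℝ} {x₀ : M}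
  {G : E → E →L[ℝ] E →L[ℝ] ℝ} {N : Set E}

omit [FiniteDimensional ℝ E] in
lemma chartCov_add {x : M} (hx : x ∈ (chartAt H x₀).source) {Y Z : ∀ x : M, TangentSpace I x}
    (hY : MDifferentiableAt I I.tangent (fun y ↦ (⟨y, Y y⟩ : TangentBundle I M)) x)
    (hZ : MDifferentiableAt I I.tangent (fun y ↦ (⟨y, Z y⟩ : TangentBundle I M)) x) :
    chartCov G x₀ (Y + Z) x = chartCov G x₀ Y x + chartCov G x₀ Z x := by
  have hadd : fieldRep I x₀ (Y + Z) = fieldRep I x₀ Y + fieldRep I x₀ Z := by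
    funext z
    exact map_add (tangentCoord I x₀ _) _ _
  ext v
  apply tangentCoord_injective (x₀ := x₀) hx
  rw [add_apply, map_add, tangentCoord_chartCov hx, tangentCoord_chartCov hx,
    tangentCoord_chartCov hx, hadd, fderiv_add ((mdifferentiableAt_field_iff hx).1 hY)
      ((mdifferentiableAt_field_iff hx).1 hZ), add_apply]
  have : tangentCoord I x₀ x ((Y + Z) x) = tangentCoord I x₀ x (Y x) + tangentCoord I x₀ x (Z x) :=
    map_add (tangentCoord I x₀ x) _ _
  rw [this, map_add]
  abel

omit [FiniteDimensional ℝ E] in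
lemma chartCov_smul {x : M} (hx : x ∈ (chartAt H x₀).source) {Y : ∀ x : M, TangentSpace I x}
    {f : M → ℝ}
    (hY : MDifferentiableAt I I.tangent (fun y ↦ (⟨y, Y y⟩ : TangentBundle I M)) x)
    (hf : MDifferentiableAt I 𝓘(ℝ, ℝ) f x) :
    chartCov G x₀ (f • Y) x = f x • chartCov G x₀ Y x + (mvfderiv I f x).smulRight (Y x) := by
  have hsmul : fieldRep I x₀ (f • Y) = (f ∘ (extChartAt I x₀).symm) • fieldRep I x₀ Y := by
    funext z
    exact map_smul (tangentCoord I x₀ _) (f ((extChartAt I x₀).symm z)) _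
  have hfx : (f ∘ (extChartAt I x₀).symm) (extChartAt I x₀ x) = f x := by
    rw [Function.comp_apply, (extChartAt I x₀).left_inv (by rwa [extChartAt_source])]
  ext v
  apply tangentCoord_injective (x₀ := x₀) hx
  rw [add_apply, map_add, tangentCoord_chartCov hx,
    hsmul, fderiv_smul ((mdifferentiableAt_iff_comp_symm hx).1 hf)
      ((mdifferentiableAt_field_iff hx).1 hY), hfx, fieldRep_extChartAt hx]
  have h1 : tangentCoord I x₀ x ((f • Y) x) = f x • tangentCoord I x₀ x (Y x) :=
    map_smul (tangentCoord I x₀ x) _ _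
  have h2 : tangentCoord I x₀ x ((f x • chartCov G x₀ Y x) v) =
    f x • tangentCoord I x₀ x (chartCov G x₀ Y x v) := map_smul (tangentCoord I x₀ x) _ _
  have h3 : tangentCoord I x₀ x ((mvfderiv I f x).smulRight (Y x) v)
     = mvfderiv I f x v • tangentCoord I x₀ x (Y x) := map_smul (tangentCoord I x₀ x) _ _
  rw [h1, h2, h3, tangentCoord_chartCov hx, mvfderiv_eq_fderiv hf hx, map_smul]
  simp only [add_apply, smul_apply,
    ContinuousLinearMap.smulRight_apply]
  module

lemma chartCov_torsion (hG : IsMetricOn G N) {x : M} (hx : x ∈ (chartAt H x₀).source)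
    (hxN : extChartAt I x₀ x ∈ N) {X Y : ∀ x : M, TangentSpace I x}
    (hX : MDifferentiableAt I I.tangent (fun y ↦ (⟨y, X y⟩ : TangentBundle I M)) x)
    (hY : MDifferentiableAt I I.tangent (fun y ↦ (⟨y, Y y⟩ : TangentBundle I M)) x) :
    chartCov G x₀ Y x (X x) - chartCov G x₀ X x (Y x) = VectorField.mlieBracket I X Y x := by
  apply tangentCoord_injective (x₀ := x₀) hx
  rw [map_sub, tangentCoord_chartCov hx, tangentCoord_chartCov hx,
    tangentCoord_mlieBracket hX hY hx, hG.christoffel_comm hxN]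
  abel

lemma chartCov_metric (hG : IsMetricChart g x₀ G N) {x : M} (hx : x ∈ (chartAt H x₀).source)
    (hxN : extChartAt I x₀ x ∈ N) {Y Z : ∀ x : M, TangentSpace I x} (v : TangentSpace I x)
    (hY : MDifferentiableAt I I.tangent (fun y ↦ (⟨y, Y y⟩ : TangentBundle I M)) x)
    (hZ : MDifferentiableAt I I.tangent (fun y ↦ (⟨y, Z y⟩ : TangentBundle I M)) x) :
    mvfderiv I (fun y ↦ g y (Y y) (Z y)) x v =
      g x (chartCov G x₀ Y x v) (Z x) + g x (Y x) (chartCov G x₀ Z x v) := by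
  have hY' := (mdifferentiableAt_field_iff hx).1 hY
  have hZ' := (mdifferentiableAt_field_iff hx).1 hZ
  have hG' := hG.differentiableAt hxN
  have hrep : (fun y ↦ g y (Y y) (Z y)) ∘ (extChartAt I x₀).symm =ᶠ[𝓝 (extChartAt I x₀ x)]
      fun z ↦ G z (fieldRep I x₀ Y z) (fieldRep I x₀ Z z) := by
    filter_upwards [hG.isOpen.mem_nhds hxN] with z hz
    have hzt := hG.subset hz
    have hs := (extChartAt I x₀).map_target hzt
    rw [extChartAt_source] at hs
    have hr := (extChartAt I x₀).right_inv hzt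
    rw [Function.comp_apply, hG.eq _ hs (by rwa [hr]), hr]
    rfl
  have hd : MDifferentiableAt I 𝓘(ℝ, ℝ) (fun y ↦ g y (Y y) (Z y)) x := by
    rw [mdifferentiableAt_iff_comp_symm hx, hrep.differentiableAt_iff]
    exact (hG'.clm_apply hY').clm_apply hZ'
  rw [mvfderiv_eq_fderiv hd hx, hrep.fderiv_eq,
    fderiv_clm_apply (hG'.clm_apply hY') hZ', fderiv_clm_apply hG' hY', hG.eq x hx hxN,
    hG.eq x hx hxN, tangentCoord_chartCov hx, tangentCoord_chartCov hx]
  simp only [add_apply, ContinuousLinearMap.comp_apply,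
    ContinuousLinearMap.flip_apply, map_add, hG.fderiv_eq hxN, fieldRep_extChartAt hx]
  ring

lemma isLeviCivitaOn_chartCov (hG : IsMetricChart g x₀ G N) :
    IsLeviCivitaOn I g {y | y ∈ (chartAt H x₀).source ∧ extChartAt I x₀ y ∈ N}
      (chartCov G x₀) where
  isCovariantDerivativeOn :=
    { add := fun hσ hσ' hx ↦ chartCov_add hx.1 hσ hσ'
      leibniz := fun hσ hf hx ↦ chartCov_smul hx.1 hσ hf }
  torsion_free := fun _ hx _ _ hX hY ↦ chartCov_torsion hG.toIsMetricOn hx.1 hx.2 hX hY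
  metric := fun _ hx _ _ v hY hZ ↦ chartCov_metric hG hx.1 hx.2 v hY hZ

lemma exists_isLeviCivitaOn {U : Set M} (h : ∀ x ∈ U, ∃ G N, IsMetricChart g x G N) :
    ∃ cov, IsLeviCivitaOn I g U cov := by
  choose! G N hG using h
  have hx : ∀ x ∈ U, IsLeviCivitaOn I g {x} (chartCov (G x) x) := fun x hx ↦
    have h1 := isLeviCivitaOn_chartCov (hG x hx)
    have h2 : ({x} : Set M) ⊆
        {y | y ∈ (chartAt H x).source ∧ extChartAt I x y ∈ N x} := by
      rintro y rfl
      exact ⟨mem_chart_source H y, (hG y hx).mem⟩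
    ⟨h1.1.mono h2, fun y hy ↦ h1.2 y (h2 hy), fun y hy ↦ h1.3 y (h2 hy)⟩
  exact ⟨fun Y x ↦ chartCov (G x) x Y x,
    { add := fun hσ hσ' h ↦ (hx _ h).1.add hσ hσ' rfl
      leibniz := fun hσ hf h ↦ (hx _ h).1.leibniz hσ hf rfl },
    fun x h ↦ (hx x h).2 x rfl, fun x h ↦ (hx x h).3 x rfl⟩

omit [I.Boundaryless] in
lemma IsLeviCivitaOn.eq {U U' : Set M}
    {cov cov' : (∀ x : M, TangentSpace I x) → ∀ x : M, TangentSpace I x →L[ℝ] TangentSpace I x}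
    (h : IsLeviCivitaOn I g U cov) (h' : IsLeviCivitaOn I g U' cov')
    {x : M} (hx : x ∈ U) (hx' : x ∈ U') (B : TangentSpace I x →ₗ[ℝ] TangentSpace I x →ₗ[ℝ] ℝ)
    (hB : ∀ v w, g x v w = B v w) (hsymm : ∀ v w, B v w = B w v)
    (hpos : ∀ v, v ≠ 0 → 0 < B v v) {Y : ∀ x : M, TangentSpace I x}
    (hY : MDifferentiableAt I I.tangent (fun y ↦ (⟨y, Y y⟩ : TangentBundle I M)) x) :
    cov Y x = cov' Y x := by
  have h1 : IsCovariantDerivativeOn E cov {x} :=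
    h.isCovariantDerivativeOn.mono (Set.singleton_subset_iff.2 hx)
  have h2 : IsCovariantDerivativeOn E cov' {x} :=
    h'.isCovariantDerivativeOn.mono (Set.singleton_subset_iff.2 hx')
  set A := h1.difference h2 x with hA
  have hAe : ∀ v, A v = cov (FiberBundle.extend E v) x - cov' (FiberBundle.extend E v) x := by
    intro v
    have := h1.difference_apply h2 (x := x) rfl (FiberBundle.mdifferentiableAt_extend I E v)
    rwa [FiberBundle.extend_apply_self] at this
  have hsym : ∀ v w, A v w = A w v := by
    intro v w
    have hv := FiberBundle.mdifferentiableAt_extend I E v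
    have hw := FiberBundle.mdifferentiableAt_extend I E w
    have e1 := h.torsion_free x hx _ _ hw hv
    have e2 := h'.torsion_free x hx' _ _ hw hv
    rw [FiberBundle.extend_apply_self, FiberBundle.extend_apply_self] at e1 e2
    rw [hAe, hAe, sub_apply, sub_apply]
    rw [← e2] at e1
    rw [sub_eq_sub_iff_add_eq_add] at e1 ⊢
    rw [e1, add_comm]
  have hskew : ∀ u v w, B (A v u) w = - B (A w u) v := by
    intro u v w
    have hv := FiberBundle.mdifferentiableAt_extend I E v
    have hw := FiberBundle.mdifferentiableAt_extend I E w
    have e1 := h.metric x hx _ _ u hv hw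
    have e2 := h'.metric x hx' _ _ u hv hw
    rw [FiberBundle.extend_apply_self, FiberBundle.extend_apply_self] at e1 e2
    rw [e2, hB, hB, hB, hB, hsymm v, hsymm v] at e1
    rw [hAe, hAe, sub_apply, sub_apply, map_sub, map_sub,
      LinearMap.sub_apply, LinearMap.sub_apply]
    linarith
  have hzero : ∀ v u, A v u = 0 := by
    intro v u
    by_contra hne
    have := hpos _ hne
    have key : ∀ w, B (A v u) w = 0 := by
      intro w
      have a1 := hskew u v w
      have a2 := hskew w u v
      have a3 := hskew v w u
      rw [hsym w u] at a1
      rw [hsym v w] at a2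
      rw [hsym u v] at a3
      linarith
    rw [key] at this
    exact lt_irrefl _ this
  have hfin := h1.difference_apply h2 (x := x) rfl hY
  ext u
  have := congrArg (fun L : TangentSpace I x →L[ℝ] TangentSpace I x ↦ L u) hfin
  have h0 : A (Y x) u = 0 := hzero _ _
  have h4 : A (Y x) u = cov Y x u - cov' Y x u := this
  rw [h0] at h4
  exact (sub_eq_zero.1 h4.symm)

end LeviCivita

end RiemGeom

namespace RiemGeom

section EuclideanNabla

variable {E : Type*} [NormedAddCommGroup E] [NormedSpace ℝ E]

/-- The covariant derivative of a vector field `X` on an open subset of a vector space. -/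
def nabla (G : E → E →L[ℝ] E →L[ℝ] ℝ) (X : E → E) (z : E) : E →L[ℝ] E :=
  fderiv ℝ X z + (christoffel G z).flip (X z)

/-- The second covariant derivative of a vector field `X`. -/
def nablaSq (G : E → E →L[ℝ] E →L[ℝ] ℝ) (X : E → E) (z u v : E) : E :=
  fderiv ℝ (nabla G X) z u v + christoffel G z u (nabla G X z v)
    - nabla G X z (christoffel G z u v)

/-- The curvature tensor in terms of the Christoffel symbols. -/
def curv (G : E → E →L[ℝ] E →L[ℝ] ℝ) (z u v w : E) : E :=
  fderiv ℝ (christoffel G) z u v w + christoffel G z u (christoffel G z v w)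
    - (fderiv ℝ (christoffel G) z v u w + christoffel G z v (christoffel G z u w))

lemma nabla_apply (G : E → E →L[ℝ] E →L[ℝ] ℝ) (X : E → E) (z u : E) :
    nabla G X z u = fderiv ℝ X z u + christoffel G z u (X z) := rfl

lemma IsMetricOn.contDiffOn_nabla [FiniteDimensional ℝ E] {G : E → E →L[ℝ] E →L[ℝ] ℝ} {N : Set E}
    (hG : IsMetricOn G N)
    {X : E → E} (hX : ContDiffOn ℝ ∞ X N) : ContDiffOn ℝ ∞ (nabla G X) N := by
  have h1 : ContDiffOn ℝ ∞ (fderiv ℝ X) N := hX.fderiv_of_isOpen hG.isOpen (by simp)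
  have h2 : ContDiffOn ℝ ∞ (fun z ↦ (christoffel G z).flip) N :=
    (ContinuousLinearMap.flipₗᵢ ℝ E E E).toContinuousLinearEquiv.contDiff.comp_contDiffOn
      hG.contDiffOn_christoffel
  exact h1.add (h2.clm_apply hX)

lemma fderiv_apply_const {F F' : Type*} [NormedAddCommGroup F] [NormedSpace ℝ F]
    [NormedAddCommGroup F'] [NormedSpace ℝ F'] {A : E → F →L[ℝ] F'} {z : E}
    (hA : DifferentiableAt ℝ A z) (v : F) (u : E) :
    fderiv ℝ (fun z' ↦ A z' v) z u = fderiv ℝ A z u v := by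
  rw [fderiv_clm_apply hA (differentiableAt_const v)]
  simp

end EuclideanNabla

section Trace

variable {E : Type*} [NormedAddCommGroup E] [NormedSpace ℝ E] [FiniteDimensional ℝ E]
  {H : Type*} [TopologicalSpace H] {I : ModelWithCorners ℝ E H}
  {M : Type*} [TopologicalSpace M] [ChartedSpace H M] [IsManifold I 1 M]
  {g : ∀ x : M, TangentSpace I x → TangentSpace I x → ℝ} {x : M}

omit [IsManifold I 1 M] in
lemma map_metricTrace {W W' : Type*} [AddCommGroup W] [Module ℝ W] [AddCommGroup W'] [Module ℝ W']
    (ℓ : W →ₗ[ℝ] W') (A : TangentSpace I x → TangentSpace I x → W) :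
    ℓ (metricTrace I g x A) = metricTrace I g x fun u v ↦ ℓ (A u v) := by
  simp [metricTrace, map_sum]

/-- The metric trace of `g(L u, v)` is the trace of `L`. -/
lemma metricTrace_eq_trace (B : E →L[ℝ] E →L[ℝ] ℝ)
    (hB : ∀ v w : TangentSpace I x, g x v w = B (tangentCoord I x x v) (tangentCoord I x x w))
    (hsymm : ∀ v w, B v w = B w v)
    (hpos : ∀ v, v ≠ 0 → 0 < B v v) (L : E →ₗ[ℝ] E)
    (A : TangentSpace I x → TangentSpace I x → ℝ)
    (hA : ∀ u v, A u v = B (L (tangentCoord I x x u)) (tangentCoord I x x v)) :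
    metricTrace I g x A = LinearMap.trace ℝ E L := by
  set b : Module.Basis (Fin (Module.finrank ℝ E)) ℝ E := Module.finBasis ℝ E with hb
  set P : Matrix (Fin (Module.finrank ℝ E)) (Fin (Module.finrank ℝ E)) ℝ :=
    Matrix.of fun i j ↦ B (b i) (b j) with hP
  have hdet : IsUnit P := by
    rw [← Matrix.mulVec_injective_iff_isUnit]
    refine (injective_iff_map_eq_zero (Matrix.mulVecLin P)).2 fun c hc ↦ ?_
    have hv : ∀ i, B (b i) (∑ j, c j • b j) = 0 := by
      intro i
      have := congrFun hc i
      simp only [Matrix.mulVecLin_apply, Matrix.mulVec,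
        dotProduct, hP, Matrix.of_apply, Pi.zero_apply] at this
      rw [map_sum, ← this]
      exact Finset.sum_congr rfl fun j _ ↦ by rw [map_smul, smul_eq_mul, mul_comm]
    have h0 : ∑ j, c j • b j = 0 := by
      by_contra hne
      have h1 := hpos _ hne
      have h2 : B (∑ j, c j • b j) (∑ j, c j • b j) = 0 := by
        conv_lhs => rw [map_sum]
        exact Finset.sum_eq_zero fun i _ ↦ by
          rw [map_smul, hsymm, hv, smul_zero]
      exact h1.ne' h2
    funext j
    exact Fintype.linearIndependent_iff.1 b.linearIndependent c h0 j
  have hmat : ∀ a c, B (L (b a)) (b c) = (P * LinearMap.toMatrix b b L) c a := by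
    intro a c
    conv_lhs => rw [← b.sum_repr (L (b a))]
    rw [map_sum, sum_apply, Matrix.mul_apply]
    refine Finset.sum_congr rfl fun j _ ↦ ?_
    rw [map_smul, smul_apply, smul_eq_mul, LinearMap.toMatrix_apply, hsymm]
    simp only [hP, Matrix.of_apply]
    ring
  have hb' : ∀ i, tangentCoord I x x (tangentBasis I x i) = b i := fun i ↦
    tangentCoord_self x (tangentBasis I x i)
  have hg : (Matrix.of fun i j ↦ g x (tangentBasis I x i) (tangentBasis I x j)) = P := by
    ext i j
    rw [Matrix.of_apply, hB, hb', hb']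
    rfl
  have hinv : P⁻¹ * P = 1 := Matrix.nonsing_inv_mul P ((Matrix.isUnit_iff_isUnit_det P).1 hdet)
  rw [LinearMap.trace_eq_matrix_trace ℝ b, ← one_mul (LinearMap.toMatrix b b L), ← hinv, mul_assoc,
    Matrix.trace, metricTrace, hg]
  refine Finset.sum_congr rfl fun a _ ↦ ?_
  rw [Matrix.diag_apply, Matrix.mul_apply]
  refine Finset.sum_congr rfl fun c _ ↦ ?_
  have h1 : A (tangentBasis I x a) (tangentBasis I x c) = B (L (b a)) (b c) := by
    rw [hA, hb', hb']
  rw [h1, hmat, smul_eq_mul]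

end Trace

section Coordinates

variable {E : Type*} [NormedAddCommGroup E] [NormedSpace ℝ E] [FiniteDimensional ℝ E]
  {H : Type*} [TopologicalSpace H] {I : ModelWithCorners ℝ E H} [I.Boundaryless]
  {M : Type*} [TopologicalSpace M] [ChartedSpace H M] [IsManifold I ∞ M]
  {g : ∀ x : M, TangentSpace I x → TangentSpace I x → ℝ} {x₀ : M} {U : Set M}
  {G : E → E →L[ℝ] E →L[ℝ] ℝ} {N : Set E}

lemma leviCivita_eq_chartCov (hU : ∀ x ∈ U, ∃ G N, IsMetricChart g x G N)
    (hG : IsMetricChart g x₀ G N) {y : M} (hy : y ∈ (chartAt H x₀).source)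
    (hyN : extChartAt I x₀ y ∈ N) (hyU : y ∈ U) {Y : ∀ x : M, TangentSpace I x}
    (hY : MDifferentiableAt I I.tangent (fun y ↦ (⟨y, Y y⟩ : TangentBundle I M)) y) :
    leviCivita I g U Y y = chartCov G x₀ Y y := by
  have hex := exists_isLeviCivitaOn hU
  have hlc : IsLeviCivitaOn I g U (leviCivita I g U) := by
    rw [leviCivita, dif_pos hex]
    exact hex.choose_spec
  refine hlc.eq (isLeviCivitaOn_chartCov hG) hyU ⟨hy, hyN⟩
    (((ContinuousLinearMap.coeLM ℝ) ∘ₗ (G (extChartAt I x₀ y)).toLinearMap).compl₁₂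
      (tangentCoord I x₀ y).toLinearMap (tangentCoord I x₀ y).toLinearMap)
    (hG.eq y hy hyN) (fun v w ↦ hG.symm _ hyN _ _) (fun v hv ↦ hG.pos _ hyN _ ?_) hY
  exact fun h ↦ hv (tangentCoord_injective hy (h.trans (map_zero _).symm))

variable (hU : ∀ x ∈ U, ∃ G N, IsMetricChart g x G N) (hG : IsMetricChart g x₀ G N)
  (hN : ∀ z ∈ N, (extChartAt I x₀).symm z ∈ U)

include hG in
omit [FiniteDimensional ℝ E] [I.Boundaryless] in
lemma IsMetricChart.symm_mem {z : E} (hz : z ∈ N) :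
    (extChartAt I x₀).symm z ∈ (chartAt H x₀).source := by
  have := (extChartAt I x₀).map_target (hG.subset hz)
  rwa [extChartAt_source] at this

include hU hG hN in
lemma fieldRep_leviCivita {Y W : ∀ x : M, TangentSpace I x} {z : E} (hz : z ∈ N)
    (hY : DifferentiableAt ℝ (fieldRep I x₀ Y) z) :
    fieldRep I x₀ (fun y ↦ leviCivita I g U Y y (W y)) z =
      nabla G (fieldRep I x₀ Y) z (fieldRep I x₀ W z) := by
  have hs := hG.symm_mem hz
  have hr := (extChartAt I x₀).right_inv (hG.subset hz)
  have h1 := leviCivita_eq_chartCov hU hG hs (by rwa [hr]) (hN z hz) (Y := Y)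
    ((mdifferentiableAt_field_iff hs).2 (by rwa [hr]))
  rw [fieldRep, h1, tangentCoord_chartCov hs, hr]
  rfl

include hU hG hN in
lemma tangentCoord_leviCivita {Y : ∀ x : M, TangentSpace I x}
    (hY : DifferentiableAt ℝ (fieldRep I x₀ Y) (extChartAt I x₀ x₀)) (u : TangentSpace I x₀) :
    tangentCoord I x₀ x₀ (leviCivita I g U Y x₀ u) =
      nabla G (fieldRep I x₀ Y) (extChartAt I x₀ x₀) (tangentCoord I x₀ x₀ u) := by
  have h := fieldRep_leviCivita hU hG hN hG.mem hY (W := FiberBundle.extend E u)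
  rwa [fieldRep_extChartAt (mem_chart_source H x₀), fieldRep_extChartAt (mem_chart_source H x₀),
    FiberBundle.extend_apply_self] at h

omit [FiniteDimensional ℝ E] [I.Boundaryless] in
lemma fieldRep_extend (v : TangentSpace I x₀) {z : E} (hz : z ∈ (extChartAt I x₀).target) :
    fieldRep I x₀ (FiberBundle.extend E v) z = tangentCoord I x₀ x₀ v := by
  have hs := (extChartAt I x₀).map_target hz
  rw [extChartAt_source] at hs
  have h : FiberBundle.extend E v ((extChartAt I x₀).symm z) =
      tangentCoordSymm I x₀ ((extChartAt I x₀).symm z) (tangentCoord I x₀ x₀ v) := by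
    rw [FiberBundle.extend, tangentCoord, Trivialization.continuousLinearMapAt_apply_of_mem,
      tangentCoordSymm, Trivialization.symmL_apply]
    · exact hs
    · exact mem_chart_source H x₀
  rw [fieldRep, h, tangentCoord_symm hs]

include hG in
omit [FiniteDimensional ℝ E] [I.Boundaryless] in
lemma fieldRep_extend_eventuallyEq (v : TangentSpace I x₀) {z : E} (hz : z ∈ N) :
    fieldRep I x₀ (FiberBundle.extend E v) =ᶠ[𝓝 z] fun _ ↦ tangentCoord I x₀ x₀ v := by
  filter_upwards [hG.isOpen.mem_nhds hz] with z' hz'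
  exact fieldRep_extend v (hG.subset hz')

include hU hG hN in
lemma tangentCoord_leviCivita_extend (u v : TangentSpace I x₀) :
    tangentCoord I x₀ x₀ (leviCivita I g U (FiberBundle.extend E v) x₀ u) =
      christoffel G (extChartAt I x₀ x₀) (tangentCoord I x₀ x₀ u) (tangentCoord I x₀ x₀ v) := by
  have he := fieldRep_extend_eventuallyEq hG v hG.mem
  rw [tangentCoord_leviCivita hU hG hN (he.differentiableAt_iff.2 (differentiableAt_const _)),
    nabla_apply, he.fderiv_eq, he.eq_of_nhds, fderiv_fun_const]
  exact zero_add _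

include hU hG hN in
lemma laplacian_eq {f : M → ℝ} (hf : ContDiffOn ℝ ∞ (f ∘ (extChartAt I x₀).symm) N) :
    laplacian I g U f x₀ = metricTrace I g x₀ fun u v ↦
      fderiv ℝ (fderiv ℝ (f ∘ (extChartAt I x₀).symm)) (extChartAt I x₀ x₀)
        (tangentCoord I x₀ x₀ u) (tangentCoord I x₀ x₀ v)
      - fderiv ℝ (f ∘ (extChartAt I x₀).symm) (extChartAt I x₀ x₀)
        (christoffel G (extChartAt I x₀ x₀) (tangentCoord I x₀ x₀ u)
          (tangentCoord I x₀ x₀ v)) := by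
  have hd : ∀ z ∈ N, DifferentiableAt ℝ (f ∘ (extChartAt I x₀).symm) z := fun z hz ↦
    (hf.contDiffAt (hG.isOpen.mem_nhds hz)).differentiableAt (by simp)
  have hd2 : DifferentiableAt ℝ (fderiv ℝ (f ∘ (extChartAt I x₀).symm)) (extChartAt I x₀ x₀) :=
    ((hf.fderiv_of_isOpen (m := ∞) hG.isOpen (by simp)).contDiffAt
      (hG.isOpen.mem_nhds hG.mem)).differentiableAt (by simp)
  rw [laplacian]
  congr 1
  funext u v
  have hrep : (fun y ↦ mvfderiv I f y (FiberBundle.extend E v y)) ∘ (extChartAt I x₀).symm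
      =ᶠ[𝓝 (extChartAt I x₀ x₀)] fun z ↦ fderiv ℝ (f ∘ (extChartAt I x₀).symm) z
        (tangentCoord I x₀ x₀ v) := by
    filter_upwards [hG.isOpen.mem_nhds hG.mem] with z hz
    have hs := hG.symm_mem hz
    have hr := (extChartAt I x₀).right_inv (hG.subset hz)
    have hfd : MDifferentiableAt I 𝓘(ℝ, ℝ) f ((extChartAt I x₀).symm z) :=
      (mdifferentiableAt_iff_comp_symm hs).2 (by rw [hr]; exact hd z hz)
    rw [Function.comp_apply, mvfderiv_eq_fderiv hfd hs, hr]
    exact congrArg _ (fieldRep_extend v (hG.subset hz))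
  have hs₀ := mem_chart_source H x₀
  have hfd : MDifferentiableAt I 𝓘(ℝ, ℝ) f x₀ :=
    (mdifferentiableAt_iff_comp_symm hs₀).2 (hd _ hG.mem)
  have hfd2 : MDifferentiableAt I 𝓘(ℝ, ℝ)
      (fun y ↦ mvfderiv I f y (FiberBundle.extend E v y)) x₀ :=
    (mdifferentiableAt_iff_comp_symm hs₀).2
      (hrep.differentiableAt_iff.2 (hd2.clm_apply (differentiableAt_const _)))
  rw [mvfderiv_eq_fderiv hfd2 hs₀, mvfderiv_eq_fderiv hfd hs₀, hrep.fderiv_eq,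
    fderiv_apply_const hd2, tangentCoord_leviCivita_extend hU hG hN]

include hU hG hN in
lemma leviCivita_leviCivita_extend {X : ∀ x : M, TangentSpace I x}
    (hX : ContDiffOn ℝ ∞ (fieldRep I x₀ X) N) (u v : TangentSpace I x₀) :
    tangentCoord I x₀ x₀
      (leviCivita I g U (fun y ↦ leviCivita I g U X y (FiberBundle.extend E v y)) x₀ u) =
      fderiv ℝ (nabla G (fieldRep I x₀ X)) (extChartAt I x₀ x₀)
        (tangentCoord I x₀ x₀ u) (tangentCoord I x₀ x₀ v)
      + christoffel G (extChartAt I x₀ x₀) (tangentCoord I x₀ x₀ u)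
        (nabla G (fieldRep I x₀ X) (extChartAt I x₀ x₀) (tangentCoord I x₀ x₀ v)) := by
  have hd : ∀ z ∈ N, DifferentiableAt ℝ (fieldRep I x₀ X) z := fun z hz ↦
    (hX.contDiffAt (hG.isOpen.mem_nhds hz)).differentiableAt (by simp)
  have hd2 : DifferentiableAt ℝ (nabla G (fieldRep I x₀ X)) (extChartAt I x₀ x₀) :=
    ((hG.contDiffOn_nabla hX).contDiffAt
      (hG.isOpen.mem_nhds hG.mem)).differentiableAt (by simp)
  have hrep : fieldRep I x₀ (fun y ↦ leviCivita I g U X y (FiberBundle.extend E v y))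
      =ᶠ[𝓝 (extChartAt I x₀ x₀)]
      fun z ↦ nabla G (fieldRep I x₀ X) z (tangentCoord I x₀ x₀ v) := by
    filter_upwards [hG.isOpen.mem_nhds hG.mem] with z hz
    rw [fieldRep_leviCivita hU hG hN hz (hd z hz), fieldRep_extend v (hG.subset hz)]
  rw [tangentCoord_leviCivita hU hG hN
    (hrep.differentiableAt_iff.2 (hd2.clm_apply (differentiableAt_const _))), nabla_apply,
    hrep.fderiv_eq, hrep.eq_of_nhds, fderiv_apply_const hd2]

include hU hG hN in
lemma vectorLaplacian_eq {X : ∀ x : M, TangentSpace I x}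
    (hX : ContDiffOn ℝ ∞ (fieldRep I x₀ X) N) :
    tangentCoord I x₀ x₀ (vectorLaplacian I g U X x₀) = metricTrace I g x₀ fun u v ↦
      nablaSq G (fieldRep I x₀ X) (extChartAt I x₀ x₀) (tangentCoord I x₀ x₀ u)
        (tangentCoord I x₀ x₀ v) := by
  have hd : DifferentiableAt ℝ (fieldRep I x₀ X) (extChartAt I x₀ x₀) :=
    (hX.contDiffAt (hG.isOpen.mem_nhds hG.mem)).differentiableAt (by simp)
  rw [vectorLaplacian]
  refine (map_metricTrace (tangentCoord I x₀ x₀).toLinearMap _).trans ?_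
  congr 1
  funext u v
  rw [ContinuousLinearMap.coe_coe, map_sub, leviCivita_leviCivita_extend hU hG hN hX,
    tangentCoord_leviCivita hU hG hN hd, tangentCoord_leviCivita_extend hU hG hN]
  rfl

include hU hG hN in
lemma normSqNabla_eq {X : ∀ x : M, TangentSpace I x}
    (hX : ContDiffOn ℝ ∞ (fieldRep I x₀ X) N) :
    normSqNabla I g U X x₀ = metricTrace I g x₀ fun u v ↦
      G (extChartAt I x₀ x₀)
        (nabla G (fieldRep I x₀ X) (extChartAt I x₀ x₀) (tangentCoord I x₀ x₀ u))
        (nabla G (fieldRep I x₀ X) (extChartAt I x₀ x₀) (tangentCoord I x₀ x₀ v)) := by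
  have hd : DifferentiableAt ℝ (fieldRep I x₀ X) (extChartAt I x₀ x₀) :=
    (hX.contDiffAt (hG.isOpen.mem_nhds hG.mem)).differentiableAt (by simp)
  rw [normSqNabla]
  congr 1
  funext u v
  rw [hG.eq x₀ (mem_chart_source H x₀) hG.mem, tangentCoord_leviCivita hU hG hN hd,
    tangentCoord_leviCivita hU hG hN hd]

include hU hG hN in
lemma curvature_eq (u v w : TangentSpace I x₀) :
    tangentCoord I x₀ x₀ (curvature I g U x₀ u v w) = curv G (extChartAt I x₀ x₀)
      (tangentCoord I x₀ x₀ u) (tangentCoord I x₀ x₀ v) (tangentCoord I x₀ x₀ w) := by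
  have hs₀ := mem_chart_source H x₀
  have hΓ : DifferentiableAt ℝ (christoffel G) (extChartAt I x₀ x₀) :=
    (hG.contDiffOn_christoffel.contDiffAt
      (hG.isOpen.mem_nhds hG.mem)).differentiableAt (by simp)
  have hext : ∀ (a : TangentSpace I x₀), ∀ z ∈ N,
      DifferentiableAt ℝ (fieldRep I x₀ (FiberBundle.extend E a)) z := fun a z hz ↦
    (fieldRep_extend_eventuallyEq hG a hz).differentiableAt_iff.2 (differentiableAt_const _)
  have key : ∀ a b : TangentSpace I x₀,
      tangentCoord I x₀ x₀ (leviCivita I g U (fun y ↦ leviCivita I g U (FiberBundle.extend E w) y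
        (FiberBundle.extend E b y)) x₀ a) =
      fderiv ℝ (christoffel G) (extChartAt I x₀ x₀) (tangentCoord I x₀ x₀ a)
        (tangentCoord I x₀ x₀ b) (tangentCoord I x₀ x₀ w)
      + christoffel G (extChartAt I x₀ x₀) (tangentCoord I x₀ x₀ a)
        (christoffel G (extChartAt I x₀ x₀) (tangentCoord I x₀ x₀ b)
          (tangentCoord I x₀ x₀ w)) := by
    intro a b
    have hrep : fieldRep I x₀ (fun y ↦ leviCivita I g U (FiberBundle.extend E w) y
        (FiberBundle.extend E b y)) =ᶠ[𝓝 (extChartAt I x₀ x₀)]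
        fun z ↦ christoffel G z (tangentCoord I x₀ x₀ b) (tangentCoord I x₀ x₀ w) := by
      filter_upwards [hG.isOpen.mem_nhds hG.mem] with z hz
      rw [fieldRep_leviCivita hU hG hN hz (hext w z hz), fieldRep_extend b (hG.subset hz),
        nabla_apply, (fieldRep_extend_eventuallyEq hG w hz).fderiv_eq,
        (fieldRep_extend_eventuallyEq hG w hz).eq_of_nhds, fderiv_fun_const]
      exact zero_add _
    have hd1 : DifferentiableAt ℝ (fun z ↦ christoffel G z (tangentCoord I x₀ x₀ b))
        (extChartAt I x₀ x₀) :=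
      hΓ.clm_apply (differentiableAt_const _)
    rw [tangentCoord_leviCivita hU hG hN
      (hrep.differentiableAt_iff.2 (hd1.clm_apply (differentiableAt_const _))), nabla_apply,
      hrep.fderiv_eq, hrep.eq_of_nhds, fderiv_apply_const hd1, fderiv_apply_const hΓ]
  have hbr : VectorField.mlieBracket I (FiberBundle.extend E u) (FiberBundle.extend E v) x₀ = 0 := by
    apply tangentCoord_injective (x₀ := x₀) hs₀
    rw [tangentCoord_mlieBracket (FiberBundle.mdifferentiableAt_extend I E u)
      (FiberBundle.mdifferentiableAt_extend I E v) hs₀,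
      (fieldRep_extend_eventuallyEq hG u hG.mem).fderiv_eq,
      (fieldRep_extend_eventuallyEq hG v hG.mem).fderiv_eq, fderiv_fun_const, fderiv_fun_const,
      map_zero]
    exact sub_self _
  rw [curvature, hbr, map_zero, sub_zero, map_sub, key, key]
  rfl

include hU hG hN in
lemma ricci_eq (v w : TangentSpace I x₀) (L : E →ₗ[ℝ] E)
    (hL : ∀ u, L u = curv G (extChartAt I x₀ x₀) u (tangentCoord I x₀ x₀ v)
      (tangentCoord I x₀ x₀ w)) :
    ricci I g U x₀ v w = LinearMap.trace ℝ E L := by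
  set b : Module.Basis (Fin (Module.finrank ℝ E)) ℝ E := Module.finBasis ℝ E with hb
  rw [LinearMap.trace_eq_matrix_trace ℝ b, Matrix.trace, ricci]
  refine Finset.sum_congr rfl fun a _ ↦ ?_
  rw [Matrix.diag_apply, LinearMap.toMatrix_apply, hL]
  have h := curvature_eq hU hG hN (tangentBasis I x₀ a) v w
  have hb' : tangentCoord I x₀ x₀ (tangentBasis I x₀ a) = b a :=
    tangentCoord_self x₀ (tangentBasis I x₀ a)
  rw [hb'] at h
  rw [← h]
  have h2 := tangentCoord_self x₀ (curvature I g U x₀ (tangentBasis I x₀ a) v w)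
  exact congrArg (fun e : E ↦ b.coord a e) h2.symm

end Coordinates

end RiemGeom

namespace RiemGeom

section Tensor

variable {E : Type*} [NormedAddCommGroup E] [NormedSpace ℝ E] [FiniteDimensional ℝ E]
  {G : E → E →L[ℝ] E →L[ℝ] ℝ} {N : Set E} {X : E → E} {z : E}

omit [FiniteDimensional ℝ E] in
lemma differentiableAt_of_contDiffOn {F : Type*} [NormedAddCommGroup F] [NormedSpace ℝ F]
    {f : E → F} (hN : IsOpen N) (hf : ContDiffOn ℝ ∞ f N) (hz : z ∈ N) :
    DifferentiableAt ℝ f z :=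
  (hf.contDiffAt (hN.mem_nhds hz)).differentiableAt (by simp)

omit [FiniteDimensional ℝ E] in
lemma contDiffOn_fderiv_of_isOpen {F : Type*} [NormedAddCommGroup F] [NormedSpace ℝ F]
    {f : E → F} (hN : IsOpen N) (hf : ContDiffOn ℝ ∞ f N) :
    ContDiffOn ℝ ∞ (fderiv ℝ f) N :=
  hf.fderiv_of_isOpen hN (by simp)

omit [FiniteDimensional ℝ E] in
lemma fderiv_fderiv_comm {F : Type*} [NormedAddCommGroup F] [NormedSpace ℝ F]
    {f : E → F} (hN : IsOpen N) (hf : ContDiffOn ℝ ∞ f N) (hz : z ∈ N) (u v : E) :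
    fderiv ℝ (fderiv ℝ f) z u v = fderiv ℝ (fderiv ℝ f) z v u :=
  ((hf.contDiffAt (hN.mem_nhds hz)).isSymmSndFDerivAt (by
    rw [minSmoothness_of_isRCLikeNormedField]; exact WithTop.coe_le_coe.2 le_top)) u v

/-- The trace as a continuous linear functional on endomorphisms. -/
def traceCLM (E : Type*) [NormedAddCommGroup E] [NormedSpace ℝ E] [FiniteDimensional ℝ E] :
    (E →L[ℝ] E) →L[ℝ] ℝ :=
  LinearMap.toContinuousLinearMap
    ((LinearMap.trace ℝ E).comp (ContinuousLinearMap.coeLM ℝ : (E →L[ℝ] E) →ₗ[ℝ] (E →ₗ[ℝ] E)))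

lemma traceCLM_apply (L : E →L[ℝ] E) : traceCLM E L = LinearMap.trace ℝ E L.toLinearMap := rfl

/-- Derivative of `G(X, Y)` along a vector. -/
lemma IsMetricOn.fderiv_inner (hG : IsMetricOn G N) (hz : z ∈ N) {Y : E → E}
    (hX : DifferentiableAt ℝ X z) (hY : DifferentiableAt ℝ Y z) (u : E) :
    fderiv ℝ (fun z ↦ G z (X z) (Y z)) z u =
      G z (nabla G X z u) (Y z) + G z (X z) (nabla G Y z u) := by
  have hd := hG.differentiableAt hz
  rw [fderiv_clm_apply (hd.clm_apply hX) hY, fderiv_clm_apply hd hX]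
  simp only [add_apply, ContinuousLinearMap.comp_apply,
    ContinuousLinearMap.flip_apply, map_add, hG.fderiv_eq hz, nabla_apply]
  ring

omit [FiniteDimensional ℝ E] in
lemma nabla_const (v : E) (u : E) : nabla G (fun _ ↦ v) z u = christoffel G z u v := by
  rw [nabla_apply, fderiv_fun_const]
  exact zero_add _

/-- If the one-form `G(X, ·)` is `α`, then `G(∇X, ·)` is the covariant derivative of `α`. -/
lemma IsMetricOn.inner_nabla (hG : IsMetricOn G N) (hX : ContDiffOn ℝ ∞ X N)
    {α : E → E →L[ℝ] ℝ} (hα : ∀ z ∈ N, ∀ v, G z (X z) v = α z v)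
    (hz : z ∈ N) (hαd : DifferentiableAt ℝ α z) (u v : E) :
    G z (nabla G X z u) v = fderiv ℝ α z u v - α z (christoffel G z u v) := by
  have h1 := hG.fderiv_inner hz (differentiableAt_of_contDiffOn hG.isOpen hX hz)
    (differentiableAt_const v) u
  have h2 : (fun z ↦ G z (X z) v) =ᶠ[𝓝 z] fun z ↦ α z v := by
    filter_upwards [hG.isOpen.mem_nhds hz] with z' hz' using hα z' hz' v
  rw [h2.fderiv_eq, fderiv_apply_const hαd, nabla_const, hα z hz] at h1
  linarith

/-- `∇X` is symmetric if `G(X, ·)` is of the form `F(ρ) dρ`. -/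
lemma IsMetricOn.nabla_symm (hG : IsMetricOn G N) (hX : ContDiffOn ℝ ∞ X N)
    {ρ : E → ℝ} {F : E → ℝ} {F' : E → ℝ} (hρ : ContDiffOn ℝ ∞ ρ N) (hF : ContDiffOn ℝ ∞ F N)
    (hF' : ∀ z ∈ N, ∀ v, fderiv ℝ F z v = F' z * fderiv ℝ ρ z v)
    (hα : ∀ z ∈ N, ∀ v, G z (X z) v = F z * fderiv ℝ ρ z v) (hz : z ∈ N) (u v : E) :
    G z (nabla G X z u) v = G z (nabla G X z v) u := by
  have hFd := differentiableAt_of_contDiffOn hG.isOpen hF hz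
  have hρd := differentiableAt_of_contDiffOn hG.isOpen
    (contDiffOn_fderiv_of_isOpen hG.isOpen hρ) hz
  have hα' : ∀ z ∈ N, ∀ v, G z (X z) v = (F z • fderiv ℝ ρ z) v := hα
  have hd : DifferentiableAt ℝ (fun z ↦ F z • fderiv ℝ ρ z) z := hFd.smul hρd
  have key : ∀ u v : E, fderiv ℝ (fun z ↦ F z • fderiv ℝ ρ z) z u v =
      F z * fderiv ℝ (fderiv ℝ ρ) z u v + F' z * fderiv ℝ ρ z u * fderiv ℝ ρ z v := by
    intro u v
    rw [fderiv_fun_smul hFd hρd]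
    simp [hF' z hz]
  rw [hG.inner_nabla hX hα' hz hd, hG.inner_nabla hX hα' hz hd, key, key,
    fderiv_fderiv_comm hG.isOpen hρ hz, hG.christoffel_comm hz u v]
  ring

lemma IsMetricOn.differentiableAt_nabla (hG : IsMetricOn G N) (hX : ContDiffOn ℝ ∞ X N)
    (hz : z ∈ N) : DifferentiableAt ℝ (nabla G X) z :=
  differentiableAt_of_contDiffOn hG.isOpen (hG.contDiffOn_nabla hX) hz

/-- If `∇X` is symmetric, so is `∇_u ∇X`. -/
lemma IsMetricOn.nablaSq_symm (hG : IsMetricOn G N) (hX : ContDiffOn ℝ ∞ X N)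
    (hS : ∀ z ∈ N, ∀ u v, G z (nabla G X z u) v = G z (nabla G X z v) u)
    (hz : z ∈ N) (u v w : E) :
    G z (nablaSq G X z u v) w = G z (nablaSq G X z u w) v := by
  have hd := hG.differentiableAt_nabla hX hz
  have key : ∀ v w : E, fderiv ℝ (fun z ↦ G z (nabla G X z v) w) z u =
      G z (fderiv ℝ (nabla G X) z u v + christoffel G z u (nabla G X z v)) w
      + G z (nabla G X z v) (christoffel G z u w) := by
    intro v w
    rw [hG.fderiv_inner hz (X := fun z ↦ nabla G X z v)
      (hd.clm_apply (differentiableAt_const v)) (differentiableAt_const w), nabla_const,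
      nabla_apply, fderiv_apply_const hd]
  have h2 : (fun z ↦ G z (nabla G X z v) w) =ᶠ[𝓝 z] fun z ↦ G z (nabla G X z w) v := by
    filter_upwards [hG.isOpen.mem_nhds hz] with z' hz' using hS z' hz' v w
  have h3 := congrArg (fun A : E →L[ℝ] ℝ ↦ A u) h2.fderiv_eq
  simp only [key] at h3
  rw [nablaSq, nablaSq, map_sub, map_sub, sub_apply, sub_apply,
    hS z hz (christoffel G z u v), hS z hz (christoffel G z u w)]
  linarith

/-- The Ricci identity for vector fields. -/
lemma IsMetricOn.nablaSq_sub (hG : IsMetricOn G N) (hX : ContDiffOn ℝ ∞ X N)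
    (hz : z ∈ N) (u v : E) :
    nablaSq G X z u v - nablaSq G X z v u = curv G z u v (X z) := by
  have hXd := differentiableAt_of_contDiffOn hG.isOpen hX hz
  have hXd2 := differentiableAt_of_contDiffOn hG.isOpen
    (contDiffOn_fderiv_of_isOpen hG.isOpen hX) hz
  have hΓ := differentiableAt_of_contDiffOn hG.isOpen hG.contDiffOn_christoffel hz
  have hd := hG.differentiableAt_nabla hX hz
  have key : ∀ u v : E, fderiv ℝ (nabla G X) z u v =
      fderiv ℝ (fderiv ℝ X) z u v + (fderiv ℝ (christoffel G) z u v (X z)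
        + christoffel G z v (fderiv ℝ X z u)) := by
    intro u v
    rw [← fderiv_apply_const hd]
    have : (fun z ↦ nabla G X z v) = fun z ↦ fderiv ℝ X z v + christoffel G z v (X z) := rfl
    have hΓv : DifferentiableAt ℝ (fun z ↦ christoffel G z v) z :=
      hΓ.clm_apply (differentiableAt_const v)
    rw [this, fderiv_fun_add (hXd2.clm_apply (differentiableAt_const v)) (hΓv.clm_apply hXd),
      add_apply, fderiv_apply_const hXd2, fderiv_clm_apply hΓv hXd]
    simp only [add_apply, ContinuousLinearMap.comp_apply, ContinuousLinearMap.flip_apply,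
      fderiv_apply_const hΓ]
    abel
  simp only [nablaSq, curv, key, nabla_apply, map_add, hG.christoffel_comm hz v u]
  rw [fderiv_fderiv_comm hG.isOpen hX hz u v]
  abel

/-- The trace of `∇_v ∇X` is the derivative of the divergence of `X`. -/
lemma IsMetricOn.trace_nablaSq (hG : IsMetricOn G N) (hX : ContDiffOn ℝ ∞ X N)
    (hz : z ∈ N) (v : E) (L : E →ₗ[ℝ] E) (hL : ∀ u, L u = nablaSq G X z v u) :
    LinearMap.trace ℝ E L = fderiv ℝ (fun z ↦ traceCLM E (nabla G X z)) z v := by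
  have hd := hG.differentiableAt_nabla hX hz
  have h1 : fderiv ℝ (fun z ↦ traceCLM E (nabla G X z)) z v =
      traceCLM E (fderiv ℝ (nabla G X) z v) := by
    have := ((traceCLM E).hasFDerivAt.comp z hd.hasFDerivAt).fderiv
    exact congrArg (fun A : E →L[ℝ] ℝ ↦ A v) this
  have h2 : L = (fderiv ℝ (nabla G X) z v).toLinearMap
      + (christoffel G z v).toLinearMap * (nabla G X z).toLinearMap
      - (nabla G X z).toLinearMap * (christoffel G z v).toLinearMap := by
    ext u
    rw [hL]
    rfl
  rw [h1, h2, map_sub, map_add, LinearMap.trace_mul_comm, traceCLM_apply]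
  ring

/-- The Bochner formula: contraction of `∇_u ∇X`, for symmetric `∇X`. -/
lemma IsMetricOn.trace_nablaSq_flip (hG : IsMetricOn G N) (hX : ContDiffOn ℝ ∞ X N)
    (hz : z ∈ N) (v : E) (L C : E →ₗ[ℝ] E) (hL : ∀ u, L u = nablaSq G X z u v)
    (hC : ∀ u, C u = curv G z u v (X z)) :
    LinearMap.trace ℝ E L =
      fderiv ℝ (fun z ↦ traceCLM E (nabla G X z)) z v + LinearMap.trace ℝ E C := by
  rw [← hG.trace_nablaSq hX hz v (L - C) (fun u ↦ ?_), map_sub]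
  · ring
  · rw [LinearMap.sub_apply, hL, hC, ← hG.nablaSq_sub hX hz]
    abel

lemma IsMetricOn.nablaSq_self (hG : IsMetricOn G N) (hX : ContDiffOn ℝ ∞ X N)
    {σ : E → ℝ} (hσ : DifferentiableAt ℝ σ z) (hSX : ∀ z ∈ N, nabla G X z (X z) = σ z • X z)
    (hz : z ∈ N) (u : E) :
    nablaSq G X z u (X z) =
      fderiv ℝ σ z u • X z + σ z • nabla G X z u - nabla G X z (nabla G X z u) := by
  have hd := hG.differentiableAt_nabla hX hz
  have hXd := differentiableAt_of_contDiffOn hG.isOpen hX hz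
  have h2 : (fun z ↦ nabla G X z (X z)) =ᶠ[𝓝 z] fun z ↦ σ z • X z := by
    filter_upwards [hG.isOpen.mem_nhds hz] with z' hz' using hSX z' hz'
  have h3 := congrArg (fun A : E →L[ℝ] E ↦ A u) h2.fderiv_eq
  rw [fderiv_clm_apply hd hXd, fderiv_fun_smul hσ hXd] at h3
  simp only [add_apply, ContinuousLinearMap.comp_apply, ContinuousLinearMap.flip_apply,
    smul_apply, ContinuousLinearMap.smulRight_apply] at h3
  have h4 : fderiv ℝ (nabla G X) z u (X z) =
      σ z • fderiv ℝ X z u + fderiv ℝ σ z u • X z - nabla G X z (fderiv ℝ X z u) :=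
    eq_sub_of_add_eq' h3
  rw [nablaSq, h4, hSX z hz, map_smul, ← map_smul, nabla_apply G X z u, map_add, map_smul]
  module

end Tensor

end RiemGeom

namespace RiemGeom

section Radial

variable {E : Type*} [NormedAddCommGroup E] [NormedSpace ℝ E] [FiniteDimensional ℝ E]

/-- A metric `G` on `N` with a function `r` and the field `ξ = r ∂/∂r` having the properties of the
radial function and the Euler field for the bundle metric with profiles `h`, `k`. -/
structure IsRadial (G : E → E →L[ℝ] E →L[ℝ] ℝ) (N : Set E) (r : E → ℝ) (ξ : E → E)
    (h k : ℝ → ℝ) (n m : ℕ) : Prop extends IsMetricOn G N where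
  contDiffOn_r : ContDiffOn ℝ ∞ r N
  r_pos : ∀ z ∈ N, 0 < r z
  contDiffOn_ξ : ContDiffOn ℝ ∞ ξ N
  inner_ξ : ∀ z ∈ N, ∀ v, G z (ξ z) v = k (r z) ^ 2 * r z * fderiv ℝ r z v
  fderiv_ξ : ∀ z ∈ N, fderiv ℝ r z (ξ z) = r z
  trace_ξ : ∀ z ∈ N, traceCLM E (nabla G ξ z) =
    n * (r z * deriv h (r z) / h (r z)) + m * (r z * deriv k (r z) / k (r z) + 1)

/-- The field `f(r) ∂/∂r`. -/
def radField (r : E → ℝ) (ξ : E → E) (f : ℝ → ℝ) (z : E) : E := (f (r z) / r z) • ξ z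

/-- The divergence of `f(r) ∂/∂r` as a function of `r`. -/
def radDiv (h k : ℝ → ℝ) (n m : ℕ) (f : ℝ → ℝ) (t : ℝ) : ℝ :=
  deriv f t + ((m - 1) / t + n * (deriv h t / h t) + m * (deriv k t / k t)) * f t

lemma contDiffOn_deriv {f : ℝ → ℝ} (hf : ContDiffOn ℝ ∞ f (Set.Ioi 0)) :
    ContDiffOn ℝ ∞ (deriv f) (Set.Ioi 0) :=
  hf.deriv_of_isOpen isOpen_Ioi (by simp)

lemma hasDerivAt_of_contDiffOn {f : ℝ → ℝ} (hf : ContDiffOn ℝ ∞ f (Set.Ioi 0)) {t : ℝ}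
    (ht : 0 < t) : HasDerivAt f (deriv f t) t :=
  (differentiableAt_of_contDiffOn isOpen_Ioi hf ht).hasDerivAt

variable {G : E → E →L[ℝ] E →L[ℝ] ℝ} {N : Set E} {r : E → ℝ} {ξ : E → E} {h k : ℝ → ℝ} {n m : ℕ}
  {z : E} {f : ℝ → ℝ}

namespace IsRadial

lemma contDiffOn_comp (hR : IsRadial G N r ξ h k n m) (hf : ContDiffOn ℝ ∞ f (Set.Ioi 0)) :
    ContDiffOn ℝ ∞ (fun z ↦ f (r z)) N :=
  hf.comp hR.contDiffOn_r hR.r_pos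

lemma differentiableAt_r (hR : IsRadial G N r ξ h k n m) (hz : z ∈ N) : DifferentiableAt ℝ r z :=
  differentiableAt_of_contDiffOn hR.isOpen hR.contDiffOn_r hz

lemma fderiv_comp (hR : IsRadial G N r ξ h k n m) (hz : z ∈ N) {F : ℝ → ℝ} {F' : ℝ}
    (hF : HasDerivAt F F' (r z)) (v : E) :
    fderiv ℝ (fun z ↦ F (r z)) z v = F' * fderiv ℝ r z v := by
  have := (hF.comp_hasFDerivAt z (hR.differentiableAt_r hz).hasFDerivAt).fderiv
  exact congrArg (fun A : E →L[ℝ] ℝ ↦ A v) this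

lemma contDiffOn_radField (hR : IsRadial G N r ξ h k n m) (hf : ContDiffOn ℝ ∞ f (Set.Ioi 0)) :
    ContDiffOn ℝ ∞ (radField r ξ f) N :=
  ((hR.contDiffOn_comp hf).div hR.contDiffOn_r fun z hz ↦ (hR.r_pos z hz).ne').smul hR.contDiffOn_ξ

lemma inner_radField (hR : IsRadial G N r ξ h k n m) (hz : z ∈ N) (v : E) :
    G z (radField r ξ f z) v = f (r z) * k (r z) ^ 2 * fderiv ℝ r z v := by
  have := (hR.r_pos z hz).ne'
  rw [radField, map_smul, smul_apply, hR.inner_ξ z hz, smul_eq_mul]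
  field_simp

lemma fderiv_radField (hR : IsRadial G N r ξ h k n m) (hz : z ∈ N) :
    fderiv ℝ r z (radField r ξ f z) = f (r z) := by
  have := (hR.r_pos z hz).ne'
  rw [radField, map_smul, hR.fderiv_ξ z hz, smul_eq_mul]
  field_simp

lemma nabla_radField (hR : IsRadial G N r ξ h k n m) (hf : ContDiffOn ℝ ∞ f (Set.Ioi 0))
    (hz : z ∈ N) (u : E) :
    nabla G (radField r ξ f) z u = (f (r z) / r z) • nabla G ξ z u
      + ((deriv f (r z) * r z - f (r z)) / r z ^ 2 * fderiv ℝ r z u) • ξ z := by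
  have hrz := hR.r_pos z hz
  have hd : HasDerivAt (fun t ↦ f t / t) ((deriv f (r z) * r z - f (r z)) / r z ^ 2) (r z) := by
    simpa using (hasDerivAt_of_contDiffOn hf hrz).fun_div (hasDerivAt_id' (r z)) hrz.ne'
  have hfd : DifferentiableAt ℝ (fun z ↦ f (r z) / r z) z :=
    (hd.comp_hasFDerivAt z (hR.differentiableAt_r hz).hasFDerivAt).differentiableAt
  have hξ := differentiableAt_of_contDiffOn hR.isOpen hR.contDiffOn_ξ hz
  have h1 : fderiv ℝ (radField r ξ f) z = _ := fderiv_fun_smul hfd hξ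
  rw [nabla_apply, h1, nabla_apply, add_apply, smul_apply, ContinuousLinearMap.smulRight_apply,
    hR.fderiv_comp hz hd, radField, map_smul]
  module

lemma trace_nabla_radField (hR : IsRadial G N r ξ h k n m) (hf : ContDiffOn ℝ ∞ f (Set.Ioi 0))
    (hz : z ∈ N) : traceCLM E (nabla G (radField r ξ f) z) = radDiv h k n m f (r z) := by
  have hrz := (hR.r_pos z hz).ne'
  have h1 : nabla G (radField r ξ f) z = (f (r z) / r z) • nabla G ξ z
      + ((deriv f (r z) * r z - f (r z)) / r z ^ 2) • (fderiv ℝ r z).smulRight (ξ z) := by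
    ext u
    rw [hR.nabla_radField hf hz, add_apply, smul_apply, smul_apply,
      ContinuousLinearMap.smulRight_apply, smul_smul]
  have h2 : traceCLM E ((fderiv ℝ r z).smulRight (ξ z)) = r z := by
    rw [← hR.fderiv_ξ z hz, traceCLM_apply]
    exact LinearMap.trace_smulRight (fderiv ℝ r z).toLinearMap (ξ z)
  rw [h1, map_add, map_smul, map_smul, h2, hR.trace_ξ z hz, radDiv, smul_eq_mul, smul_eq_mul]
  field_simp
  ring

lemma nabla_radField_symm (hR : IsRadial G N r ξ h k n m) (hf : ContDiffOn ℝ ∞ f (Set.Ioi 0))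
    (hk : ContDiffOn ℝ ∞ k (Set.Ioi 0)) : ∀ z ∈ N, ∀ u v,
    G z (nabla G (radField r ξ f) z u) v = G z (nabla G (radField r ξ f) z v) u := by
  have hF : ContDiffOn ℝ ∞ (fun t ↦ f t * k t ^ 2) (Set.Ioi 0) := hf.mul (hk.pow 2)
  exact fun z hz u v ↦ hR.nabla_symm (hR.contDiffOn_radField hf) hR.contDiffOn_r
    (hR.contDiffOn_comp hF)
    (fun z hz v ↦ hR.fderiv_comp hz (hasDerivAt_of_contDiffOn hF (hR.r_pos z hz)) v)
    (fun z hz v ↦ hR.inner_radField hz v) hz u v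

lemma nabla_radField_self (hR : IsRadial G N r ξ h k n m) (hf : ContDiffOn ℝ ∞ f (Set.Ioi 0))
    (hk : ContDiffOn ℝ ∞ k (Set.Ioi 0)) (hk_pos : ∀ t, 0 < t → 0 < k t) (hz : z ∈ N) :
    nabla G (radField r ξ f) z (radField r ξ f z) =
      (deriv f (r z) + f (r z) * (deriv k (r z) / k (r z))) • radField r ξ f z := by
  have hrz := hR.r_pos z hz
  have hkz := (hk_pos _ hrz).ne'
  have hXd := differentiableAt_of_contDiffOn hR.isOpen (hR.contDiffOn_radField hf) hz
  refine hR.eq_of_inner hz fun v ↦ ?_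
  rw [hR.nabla_radField_symm hf hk z hz, map_smul, smul_apply, smul_eq_mul,
    hR.inner_radField hz]
  have h1 := hR.fderiv_inner hz hXd hXd v
  have h2 : (fun z ↦ G z (radField r ξ f z) (radField r ξ f z)) =ᶠ[𝓝 z]
      fun z ↦ (f (r z) * k (r z)) ^ 2 := by
    filter_upwards [hR.isOpen.mem_nhds hz] with z' hz'
    rw [hR.inner_radField hz', hR.fderiv_radField hz']
    ring
  have h3 : HasDerivAt (fun t ↦ (f t * k t) ^ 2) _ (r z) :=
    ((hasDerivAt_of_contDiffOn hf hrz).mul (hasDerivAt_of_contDiffOn hk hrz)).pow 2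
  rw [h2.fderiv_eq, hR.fderiv_comp hz h3, hR.symm z hz (radField r ξ f z)] at h1
  simp only [Nat.cast_ofNat, Nat.add_one_sub_one, pow_one] at h1
  have h4 : G z (nabla G (radField r ξ f) z v) (radField r ξ f z) =
    f (r z) * k (r z) * (deriv f (r z) * k (r z) + f (r z) * deriv k (r z)) *
      fderiv ℝ r z v := by
    simp only [Pi.mul_apply] at h1
    linarith
  rw [h4]
  field_simp

/-- A vector representing a multiple of `dr` is a multiple of `ξ`. -/
lemma eq_smul_ξ (hR : IsRadial G N r ξ h k n m) (hk_pos : ∀ t, 0 < t → 0 < k t) (hz : z ∈ N)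
    {w : E} {c : ℝ} (hw : ∀ v, G z w v = c * fderiv ℝ r z v) :
    w = (c / k (r z) ^ 2) • (r z)⁻¹ • ξ z := by
  have hrz := hR.r_pos z hz
  have hkz := (hk_pos _ hrz).ne'
  refine hR.eq_of_inner hz fun v ↦ ?_
  rw [hw, map_smul, map_smul, smul_apply, smul_apply, hR.inner_ξ z hz, smul_eq_mul, smul_eq_mul]
  field_simp

end IsRadial

lemma contDiffOn_radDiv (hh : ContDiffOn ℝ ∞ h (Set.Ioi 0)) (hk : ContDiffOn ℝ ∞ k (Set.Ioi 0))
    (hh_pos : ∀ t, 0 < t → 0 < h t) (hk_pos : ∀ t, 0 < t → 0 < k t)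
    (hf : ContDiffOn ℝ ∞ f (Set.Ioi 0)) : ContDiffOn ℝ ∞ (radDiv h k n m f) (Set.Ioi 0) := by
  have h1 : ContDiffOn ℝ ∞ (fun t : ℝ ↦ ((m : ℝ) - 1) / t) (Set.Ioi 0) :=
    contDiffOn_const.div contDiffOn_id fun t ht ↦ (Set.mem_Ioi.1 ht).ne'
  have h2 : ContDiffOn ℝ ∞ (fun t : ℝ ↦ (n : ℝ) * (deriv h t / h t)) (Set.Ioi 0) :=
    contDiffOn_const.mul ((contDiffOn_deriv hh).div hh fun t ht ↦ (hh_pos t ht).ne')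
  have h3 : ContDiffOn ℝ ∞ (fun t : ℝ ↦ (m : ℝ) * (deriv k t / k t)) (Set.Ioi 0) :=
    contDiffOn_const.mul ((contDiffOn_deriv hk).div hk fun t ht ↦ (hk_pos t ht).ne')
  exact (contDiffOn_deriv hf).add (((h1.add h2).add h3).mul hf)

end Radial

section Results

variable {E : Type*} [NormedAddCommGroup E] [NormedSpace ℝ E] [FiniteDimensional ℝ E]
  {H : Type*} [TopologicalSpace H] {I : ModelWithCorners ℝ E H} [I.Boundaryless]
  {M : Type*} [TopologicalSpace M] [ChartedSpace H M] [IsManifold I ∞ M]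
  {g : ∀ x : M, TangentSpace I x → TangentSpace I x → ℝ} {x₀ : M} {U : Set M}
  {G : E → E →L[ℝ] E →L[ℝ] ℝ} {N : Set E}
  (hU : ∀ x ∈ U, ∃ G N, IsMetricChart g x G N) (hG : IsMetricChart g x₀ G N)
  (hN : ∀ z ∈ N, (extChartAt I x₀).symm z ∈ U)
  {r : E → ℝ} {ξ : E → E} {h k s : ℝ → ℝ} {n m : ℕ}
  (hR : IsRadial G N r ξ h k n m)
  (hh : ContDiffOn ℝ ∞ h (Set.Ioi 0)) (hk : ContDiffOn ℝ ∞ k (Set.Ioi 0))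
  (hs : ContDiffOn ℝ ∞ s (Set.Ioi 0))
  (hh_pos : ∀ t, 0 < t → 0 < h t) (hk_pos : ∀ t, 0 < t → 0 < k t)

include hG in
omit [I.Boundaryless] in
lemma IsMetricChart.metricTrace_eq (L : E →ₗ[ℝ] E)
    (A : TangentSpace I x₀ → TangentSpace I x₀ → ℝ)
    (hA : ∀ u v, A u v =
      G (extChartAt I x₀ x₀) (L (tangentCoord I x₀ x₀ u)) (tangentCoord I x₀ x₀ v)) :
    metricTrace I g x₀ A = LinearMap.trace ℝ E L :=
  metricTrace_eq_trace (G (extChartAt I x₀ x₀)) (hG.eq x₀ (mem_chart_source H x₀) hG.mem)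
    (hG.symm _ hG.mem) (hG.pos _ hG.mem) L A hA

include hU hG hN hR hk hs hk_pos in
lemma laplacian_radial {f : M → ℝ}
    (hf : ∀ z ∈ N, f ((extChartAt I x₀).symm z) = s (r z)) :
    laplacian I g U f x₀ =
      radDiv h k n m (fun t ↦ deriv s t / k t ^ 2) (r (extChartAt I x₀ x₀)) := by
  set z := extChartAt I x₀ x₀ with hz
  have hq : ContDiffOn ℝ ∞ (fun t ↦ deriv s t / k t ^ 2) (Set.Ioi 0) :=
    (contDiffOn_deriv hs).div (hk.pow 2) fun t ht ↦ (pow_pos (hk_pos t ht) 2).ne'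
  have hfN : ContDiffOn ℝ ∞ (f ∘ (extChartAt I x₀).symm) N :=
    (hR.contDiffOn_comp hs).congr hf
  have hfd : ∀ z ∈ N, ∀ v, fderiv ℝ (f ∘ (extChartAt I x₀).symm) z v =
      deriv s (r z) * fderiv ℝ r z v := by
    intro z hz v
    have he : f ∘ (extChartAt I x₀).symm =ᶠ[𝓝 z] fun z ↦ s (r z) := by
      filter_upwards [hG.isOpen.mem_nhds hz] with z' hz' using hf z' hz'
    rw [he.fderiv_eq, hR.fderiv_comp hz (hasDerivAt_of_contDiffOn hs (hR.r_pos z hz))]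
  rw [laplacian_eq hU hG hN hfN, ← hR.trace_nabla_radField hq hG.mem, traceCLM_apply]
  apply hG.metricTrace_eq
  intro u v
  refine (hG.inner_nabla (hR.contDiffOn_radField hq) ?_ hG.mem
    (differentiableAt_of_contDiffOn hG.isOpen (contDiffOn_fderiv_of_isOpen hG.isOpen hfN) hG.mem)
    _ _).symm
  intro z hz v
  have := (hk_pos _ (hR.r_pos z hz)).ne'
  rw [hR.inner_radField hz, hfd z hz]
  field_simp

include hG in
omit [I.Boundaryless] [FiniteDimensional ℝ E] in
lemma nabla_congr {X Y : E → E} (hXY : ∀ z ∈ N, X z = Y z) : ∀ z ∈ N, nabla G X z = nabla G Y z := by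
  intro z hz
  have : X =ᶠ[𝓝 z] Y := by
    filter_upwards [hG.isOpen.mem_nhds hz] with z' hz' using hXY z' hz'
  rw [nabla, nabla, this.fderiv_eq, hXY z hz]

include hG in
omit [I.Boundaryless] in
lemma nablaSq_congr {X Y : E → E} (hXY : ∀ z ∈ N, X z = Y z) {z : E} (hz : z ∈ N) (u v : E) :
    nablaSq G X z u v = nablaSq G Y z u v := by
  have h1 := nabla_congr hG hXY
  have : nabla G X =ᶠ[𝓝 z] nabla G Y := by
    filter_upwards [hG.isOpen.mem_nhds hz] with z' hz' using h1 z' hz'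
  rw [nablaSq, nablaSq, this.fderiv_eq, h1 z hz]

/-- The endomorphism `u ↦ R(u, v) w`. -/
def curvEnd (G : E → E →L[ℝ] E →L[ℝ] ℝ) (z v w : E) : E →ₗ[ℝ] E where
  toFun u := curv G z u v w
  map_add' u u' := by simp only [curv, map_add, add_apply]; abel
  map_smul' c u := by
    simp only [curv, map_smul, smul_apply, RingHom.id_apply]; module

/-- The endomorphism `u ↦ ∇_u ∇X (v)`. -/
def nablaSqEnd (G : E → E →L[ℝ] E →L[ℝ] ℝ) (X : E → E) (z v : E) : E →ₗ[ℝ] E where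
  toFun u := nablaSq G X z u v
  map_add' u u' := by simp only [nablaSq, map_add, add_apply]; abel
  map_smul' c u := by
    simp only [nablaSq, map_smul, smul_apply, RingHom.id_apply]; module

include hU hG hN in
lemma trace_curvEnd (hric : IsRicciFlatOn I g U) (v w : E) :
    LinearMap.trace ℝ E (curvEnd G (extChartAt I x₀ x₀) v w) = 0 := by
  have hx : x₀ ∈ U := by
    have := hN _ hG.mem
    rwa [(extChartAt I x₀).left_inv (mem_extChartAt_source x₀)] at this
  have hs₀ := mem_chart_source H x₀
  rw [← hric x₀ hx (tangentCoordSymm I x₀ x₀ v) (tangentCoordSymm I x₀ x₀ w)]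
  refine (ricci_eq hU hG hN _ _ _ fun u ↦ ?_).symm
  rw [tangentCoord_symm hs₀, tangentCoord_symm hs₀]
  rfl

include hU hG hN hR in
lemma trace_nablaSq_radField (hs : ContDiffOn ℝ ∞ s (Set.Ioi 0))
    (hd : DifferentiableAt ℝ (radDiv h k n m s) (r (extChartAt I x₀ x₀)))
    (hric : IsRicciFlatOn I g U) (v : E) :
    LinearMap.trace ℝ E (nablaSqEnd G (radField r ξ s) (extChartAt I x₀ x₀) v) =
      deriv (radDiv h k n m s) (r (extChartAt I x₀ x₀)) *
        fderiv ℝ r (extChartAt I x₀ x₀) v := by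
  have hX := hR.contDiffOn_radField hs
  have he : (fun z ↦ traceCLM E (nabla G (radField r ξ s) z)) =ᶠ[𝓝 (extChartAt I x₀ x₀)]
      fun z ↦ radDiv h k n m s (r z) := by
    filter_upwards [hG.isOpen.mem_nhds hG.mem] with z' hz' using hR.trace_nabla_radField hs hz'
  rw [hG.trace_nablaSq_flip hX hG.mem v _
    (curvEnd G (extChartAt I x₀ x₀) v (radField r ξ s (extChartAt I x₀ x₀))) (fun u ↦ rfl)
    (fun u ↦ rfl), trace_curvEnd hU hG hN hric, he.fderiv_eq, hR.fderiv_comp hG.mem hd.hasDerivAt,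
    add_zero]

include hU hG hN hR hh hk hs hh_pos hk_pos in
lemma vectorLaplacian_radial (hric : IsRicciFlatOn I g U) {X : ∀ x : M, TangentSpace I x}
    (hX : ∀ z ∈ N, fieldRep I x₀ X z = radField r ξ s z) :
    tangentCoord I x₀ x₀ (vectorLaplacian I g U X x₀) =
      (deriv (radDiv h k n m s) (r (extChartAt I x₀ x₀)) / k (r (extChartAt I x₀ x₀)) ^ 2) •
        (r (extChartAt I x₀ x₀))⁻¹ • ξ (extChartAt I x₀ x₀) := by
  have hX' := hR.contDiffOn_radField hs
  apply hR.eq_smul_ξ hk_pos hG.mem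
  intro v
  rw [← trace_nablaSq_radField hU hG hN hR hs (differentiableAt_of_contDiffOn isOpen_Ioi
    (contDiffOn_radDiv hh hk hh_pos hk_pos hs) (hR.r_pos _ hG.mem)) hric,
    vectorLaplacian_eq hU hG hN (hX'.congr hX)]
  refine (map_metricTrace ((G (extChartAt I x₀ x₀)).flip v).toLinearMap _).trans ?_
  apply hG.metricTrace_eq
  intro u w
  rw [nablaSq_congr hG hX hG.mem]
  exact hG.nablaSq_symm hX' (hR.nabla_radField_symm hs hk) hG.mem _ _ _

include hU hG hN hR hh hk hs hh_pos hk_pos in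
lemma normSqNabla_radial (hric : IsRicciFlatOn I g U) {X : ∀ x : M, TangentSpace I x}
    (hX : ∀ z ∈ N, fieldRep I x₀ X z = radField r ξ s z) {t : ℝ}
    (ht : t = r (extChartAt I x₀ x₀)) :
    normSqNabla I g U X x₀ =
      s t * deriv (fun t ↦ deriv s t + s t * (deriv k t / k t)) t
      + (deriv s t + s t * (deriv k t / k t)) * radDiv h k n m s t
      - s t * deriv (radDiv h k n m s) t := by
  have hX' := hR.contDiffOn_radField hs
  set z := extChartAt I x₀ x₀ with hz
  have htp : 0 < t := ht ▸ hR.r_pos _ hG.mem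
  have hσ : ContDiffOn ℝ ∞ (fun t ↦ deriv s t + s t * (deriv k t / k t)) (Set.Ioi 0) :=
    (contDiffOn_deriv hs).add (hs.mul ((contDiffOn_deriv hk).div hk fun t ht ↦ (hk_pos t ht).ne'))
  have hσd := hasDerivAt_of_contDiffOn hσ htp
  rw [ht] at hσd
  have hself := fun u ↦ hG.nablaSq_self hX'
    (differentiableAt_of_contDiffOn hG.isOpen (hR.contDiffOn_comp hσ) hG.mem)
    (fun z hz ↦ hR.nabla_radField_self hs hk hk_pos hz) hG.mem u
  have htr := trace_nablaSq_radField hU hG hN hR hs (differentiableAt_of_contDiffOn isOpen_Ioi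
    (contDiffOn_radDiv hh hk hh_pos hk_pos hs) (hR.r_pos _ hG.mem)) hric (radField r ξ s z)
  have hL : nablaSqEnd G (radField r ξ s) z (radField r ξ s z) =
      (fderiv ℝ (fun z ↦ deriv s (r z) + s (r z) * (deriv k (r z) / k (r z))) z).toLinearMap.smulRight
        (radField r ξ s z)
      + (deriv s (r z) + s (r z) * (deriv k (r z) / k (r z))) •
        (nabla G (radField r ξ s) z).toLinearMap
      - (nabla G (radField r ξ s) z).toLinearMap * (nabla G (radField r ξ s) z).toLinearMap := by
    ext u
    exact hself u
  have hmain : normSqNabla I g U X x₀ = LinearMap.trace ℝ E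
      ((nabla G (radField r ξ s) z).toLinearMap * (nabla G (radField r ξ s) z).toLinearMap) := by
    rw [normSqNabla_eq hU hG hN (hX'.congr hX)]
    apply hG.metricTrace_eq
    intro u v
    rw [nabla_congr hG hX _ hG.mem]
    have := hR.nabla_radField_symm hs hk z hG.mem (nabla G (radField r ξ s) z (tangentCoord I x₀ x₀ u))
      (tangentCoord I x₀ x₀ v)
    rw [hG.symm _ hG.mem, ← this]
    rfl
  have h3 := hR.trace_nabla_radField hs hG.mem
  rw [traceCLM_apply] at h3
  rw [hL, map_sub, map_add, LinearMap.trace_smulRight, map_smul, ← hmain, h3, ← hz,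
    hR.fderiv_radField hG.mem, ContinuousLinearMap.coe_coe, hR.fderiv_comp hG.mem hσd,
    hR.fderiv_radField hG.mem, smul_eq_mul, ← ht] at htr
  linarith

end Results

end RiemGeom

namespace RiemGeom

section Trivial

variable {EB : Type*} [NormedAddCommGroup EB] [NormedSpace ℝ EB]
  {F : Type*} [NormedAddCommGroup F] [NormedSpace ℝ F]

/-- A base metric `γ`, a fibre metric `η` and the form `A` of a connection compatible with `η` on
the trivial bundle with fibre `F` over the open set `W`. -/
structure IsTrivialBundleData (γ : EB → EB →L[ℝ] EB →L[ℝ] ℝ) (η : EB → F →L[ℝ] F →L[ℝ] ℝ)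
    (A : EB → EB →L[ℝ] F →L[ℝ] F) (W : Set EB) : Prop where
  base : IsMetricOn γ W
  contDiffOn_fibre : ContDiffOn ℝ ∞ η W
  fibre_symm : ∀ x ∈ W, ∀ a b, η x a b = η x b a
  fibre_pos : ∀ x ∈ W, ∀ a, a ≠ 0 → 0 < η x a a
  contDiffOn_form : ContDiffOn ℝ ∞ A W
  compatible : ∀ x ∈ W, ∀ u a b, fderiv ℝ η x u a b = η x (A x u a) b + η x a (A x u b)

/-- The fibre norm. -/
def fibreNorm (η : EB → F →L[ℝ] F →L[ℝ] ℝ) (z : EB × F) : ℝ := √(η z.1 z.2 z.2)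

/-- The Euler field of the trivial bundle. -/
def eulerField (z : EB × F) : EB × F := (0, z.2)

/-- The vertical component of a tangent vector with respect to the connection `d + A`. -/
def vertComp (A : EB → EB →L[ℝ] F →L[ℝ] F) (z : EB × F) : EB × F →L[ℝ] F :=
  ContinuousLinearMap.snd ℝ EB F + (A z.1).flip z.2 ∘L ContinuousLinearMap.fst ℝ EB F

/-- The metric `h(r)² γ + k(r)² η` on the total space of the trivial bundle. -/
def totalMetric (γ : EB → EB →L[ℝ] EB →L[ℝ] ℝ) (η : EB → F →L[ℝ] F →L[ℝ] ℝ)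
    (A : EB → EB →L[ℝ] F →L[ℝ] F) (h k : ℝ → ℝ) (z : EB × F) :
    EB × F →L[ℝ] EB × F →L[ℝ] ℝ :=
  h (fibreNorm η z) ^ 2 • (γ z.1).bilinearComp (ContinuousLinearMap.fst ℝ EB F)
      (ContinuousLinearMap.fst ℝ EB F)
    + k (fibreNorm η z) ^ 2 • (η z.1).bilinearComp (vertComp A z) (vertComp A z)

variable {γ : EB → EB →L[ℝ] EB →L[ℝ] ℝ} {η : EB → F →L[ℝ] F →L[ℝ] ℝ}
  {A : EB → EB →L[ℝ] F →L[ℝ] F} {W : Set EB} {h k : ℝ → ℝ} {z : EB × F}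

lemma totalMetric_apply (v w : EB × F) :
    totalMetric γ η A h k z v w = h (fibreNorm η z) ^ 2 * γ z.1 v.1 w.1
      + k (fibreNorm η z) ^ 2 * η z.1 (v.2 + A z.1 v.1 z.2) (w.2 + A z.1 w.1 z.2) := rfl

/-- The complement of the zero section of the trivial bundle over `W`. -/
def puncturedDomain (W : Set EB) : Set (EB × F) := {z | z.1 ∈ W ∧ z.2 ≠ 0}

namespace IsTrivialBundleData

variable (hD : IsTrivialBundleData γ η A W)
include hD

lemma isOpen_puncturedDomain : IsOpen (puncturedDomain W : Set (EB × F)) :=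
  (hD.base.isOpen.preimage continuous_fst).inter (isOpen_ne.preimage continuous_snd)

lemma fibreNorm_pos (hz : z ∈ puncturedDomain W) : 0 < fibreNorm η z :=
  Real.sqrt_pos.2 (hD.fibre_pos _ hz.1 _ hz.2)

lemma sq_fibreNorm (hz : z ∈ puncturedDomain W) : fibreNorm η z ^ 2 = η z.1 z.2 z.2 :=
  Real.sq_sqrt (hD.fibre_pos _ hz.1 _ hz.2).le

lemma contDiffOn_fibre_fst :
    ContDiffOn ℝ ∞ (fun z : EB × F ↦ η z.1) (puncturedDomain W) :=
  hD.contDiffOn_fibre.comp contDiff_fst.contDiffOn fun _ hz ↦ hz.1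

lemma contDiffOn_sq_fibreNorm :
    ContDiffOn ℝ ∞ (fun z : EB × F ↦ η z.1 z.2 z.2) (puncturedDomain W) :=
  (hD.contDiffOn_fibre_fst.clm_apply contDiff_snd.contDiffOn).clm_apply contDiff_snd.contDiffOn

lemma contDiffOn_fibreNorm : ContDiffOn ℝ ∞ (fibreNorm η) (puncturedDomain W) :=
  hD.contDiffOn_sq_fibreNorm.sqrt fun _ hz ↦ (hD.fibre_pos _ hz.1 _ hz.2).ne'

omit hD in
lemma fibreNorm_line {t : ℝ} (ht : -1 < t) :
    fibreNorm η (z + t • eulerField z) = (1 + t) * fibreNorm η z := by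
  have h1 : z + t • eulerField z = (z.1, (1 + t) • z.2) := by
    ext
    · simp [eulerField]
    · simp only [eulerField, Prod.snd_add, Prod.smul_snd]; module
  rw [h1, fibreNorm, fibreNorm]
  simp only [map_smul, smul_apply, smul_eq_mul]
  rw [← mul_assoc, ← pow_two, Real.sqrt_mul (sq_nonneg _), Real.sqrt_sq (by linarith)]

lemma fderiv_fibreNorm_eulerField (hz : z ∈ puncturedDomain W) :
    fderiv ℝ (fibreNorm η) z (eulerField z) = fibreNorm η z := by
  have h1 := (differentiableAt_of_contDiffOn hD.isOpen_puncturedDomain hD.contDiffOn_fibreNorm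
    hz).hasFDerivAt.hasLineDerivAt (eulerField z)
  have h2 : HasDerivAt (fun t : ℝ ↦ (1 + t) * fibreNorm η z) (1 * fibreNorm η z) 0 :=
    ((hasDerivAt_id' (0 : ℝ)).const_add 1).mul_const _
  rw [one_mul] at h2
  refine HasDerivAt.unique h1 (h2.congr_of_eventuallyEq ?_)
  filter_upwards [lt_mem_nhds (show (-1 : ℝ) < 0 by norm_num)] with t ht
  exact fibreNorm_line ht

lemma fderiv_fibreNorm (hz : z ∈ puncturedDomain W) (v : EB × F) :
    fibreNorm η z * fderiv ℝ (fibreNorm η) z v = η z.1 z.2 (v.2 + A z.1 v.1 z.2) := by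
  have hr := differentiableAt_of_contDiffOn hD.isOpen_puncturedDomain hD.contDiffOn_fibreNorm hz
  have he : (fun z ↦ fibreNorm η z ^ 2) =ᶠ[𝓝 z] fun z ↦ η z.1 z.2 z.2 := by
    filter_upwards [hD.isOpen_puncturedDomain.mem_nhds hz] with z' hz' using hD.sq_fibreNorm hz'
  have hη := differentiableAt_of_contDiffOn hD.base.isOpen hD.contDiffOn_fibre hz.1
  have h1 : HasFDerivAt (fun z : EB × F ↦ η z.1) _ z :=
    hη.hasFDerivAt.comp z (hasFDerivAt_fst (𝕜 := ℝ) (p := z))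
  have h2 := ((h1.clm_apply (hasFDerivAt_snd (𝕜 := ℝ) (p := z))).clm_apply
    (hasFDerivAt_snd (𝕜 := ℝ) (p := z))).fderiv
  have h3 := (hr.hasFDerivAt.pow 2).fderiv
  rw [← he.fderiv_eq] at h2
  have h4 := congrArg (fun L : EB × F →L[ℝ] ℝ ↦ L v) (h3.symm.trans h2)
  simp at h4
  have h5 := hD.compatible _ hz.1 v.1 z.2 z.2
  rw [hD.fibre_symm _ hz.1 v.2, h5, hD.fibre_symm _ hz.1 (A z.1 v.1 z.2)] at h4
  rw [map_add]
  linarith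

variable (hh : ContDiffOn ℝ ∞ h (Set.Ioi 0)) (hk : ContDiffOn ℝ ∞ k (Set.Ioi 0))
  (hh_pos : ∀ t, 0 < t → 0 < h t) (hk_pos : ∀ t, 0 < t → 0 < k t)

include hh hk hh_pos hk_pos in
lemma isMetricOn [FiniteDimensional ℝ EB] [FiniteDimensional ℝ F] :
    IsMetricOn (totalMetric γ η A h k) (puncturedDomain W) where
  isOpen := hD.isOpen_puncturedDomain
  contDiffOn := by
    rw [contDiffOn_clm_apply]
    intro v
    rw [contDiffOn_clm_apply]
    intro w
    have hγ : ContDiffOn ℝ ∞ (fun z : EB × F ↦ γ z.1) (puncturedDomain W) :=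
      hD.base.contDiffOn.comp contDiff_fst.contDiffOn fun _ hz ↦ hz.1
    have hA : ContDiffOn ℝ ∞ (fun z : EB × F ↦ A z.1) (puncturedDomain W) :=
      hD.contDiffOn_form.comp contDiff_fst.contDiffOn fun _ hz ↦ hz.1
    have hV : ∀ v : EB × F,
        ContDiffOn ℝ ∞ (fun z : EB × F ↦ v.2 + A z.1 v.1 z.2) (puncturedDomain W) := fun v ↦
      contDiffOn_const.add ((hA.clm_apply contDiffOn_const).clm_apply contDiff_snd.contDiffOn)
    have hr : ∀ {f : ℝ → ℝ}, ContDiffOn ℝ ∞ f (Set.Ioi 0) →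
        ContDiffOn ℝ ∞ (fun z ↦ f (fibreNorm η z) ^ 2) (puncturedDomain W) := fun hf ↦
      (hf.comp hD.contDiffOn_fibreNorm fun z hz ↦ hD.fibreNorm_pos hz).pow 2
    exact ((hr hh).mul ((hγ.clm_apply contDiffOn_const).clm_apply contDiffOn_const)).add
      ((hr hk).mul ((hD.contDiffOn_fibre_fst.clm_apply (hV v)).clm_apply (hV w)))
  symm z hz v w := by
    rw [totalMetric_apply, totalMetric_apply, hD.base.symm _ hz.1, hD.fibre_symm _ hz.1]
  pos z hz v hv := by
    have hp := hD.fibreNorm_pos hz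
    have h1 := pow_pos (hh_pos _ hp) 2
    have h2 := pow_pos (hk_pos _ hp) 2
    rw [totalMetric_apply]
    by_cases hv1 : v.1 = 0
    · have hv2 : v.2 ≠ 0 := fun h0 ↦ hv (Prod.ext hv1 h0)
      have := mul_pos h2 (hD.fibre_pos _ hz.1 _ hv2)
      simpa [hv1] using this
    · have h3 : 0 ≤ η z.1 (v.2 + A z.1 v.1 z.2) (v.2 + A z.1 v.1 z.2) := by
        by_cases h0 : v.2 + A z.1 v.1 z.2 = 0
        · simp [h0]
        · exact (hD.fibre_pos _ hz.1 _ h0).le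
      exact add_pos_of_pos_of_nonneg (mul_pos h1 (hD.base.pos _ hz.1 _ hv1)) (mul_nonneg h2.le h3)

omit hD in
lemma totalMetric_eulerField (v : EB × F) :
    totalMetric γ η A h k z (eulerField z) v =
      k (fibreNorm η z) ^ 2 * η z.1 z.2 (v.2 + A z.1 v.1 z.2) := by
  rw [totalMetric_apply]
  simp [eulerField]

omit hD in
lemma contDiff_eulerField : ContDiff ℝ ∞ (eulerField : EB × F → EB × F) :=
  contDiff_const.prodMk contDiff_snd

omit hD in
lemma fderiv_eulerField (v : EB × F) : fderiv ℝ (eulerField : EB × F → EB × F) z v = (0, v.2) := by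
  have h1 := ((hasFDerivAt_const (𝕜 := ℝ) (0 : EB) z).prodMk
    (hasFDerivAt_snd (𝕜 := ℝ) (p := z))).fderiv
  exact congrArg (fun L : EB × F →L[ℝ] EB × F ↦ L v) h1

include hh hk hh_pos hk_pos in
lemma fderiv_totalMetric_eulerField [FiniteDimensional ℝ EB] [FiniteDimensional ℝ F]
    (hz : z ∈ puncturedDomain W) (v w : EB × F) :
    fderiv ℝ (totalMetric γ η A h k) z (eulerField z) v w =
      2 * h (fibreNorm η z) * (deriv h (fibreNorm η z) * fibreNorm η z) * γ z.1 v.1 w.1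
      + 2 * k (fibreNorm η z) * (deriv k (fibreNorm η z) * fibreNorm η z) *
        η z.1 (v.2 + A z.1 v.1 z.2) (w.2 + A z.1 w.1 z.2)
      + k (fibreNorm η z) ^ 2 * (η z.1 (A z.1 v.1 z.2) (w.2 + A z.1 w.1 z.2)
        + η z.1 (v.2 + A z.1 v.1 z.2) (A z.1 w.1 z.2)) := by
  have hG := hD.isMetricOn hh hk hh_pos hk_pos
  have hp := hD.fibreNorm_pos hz
  have h1 := ((((hG.differentiableAt hz).hasFDerivAt.clm_apply
    (hasFDerivAt_const v z)).clm_apply (hasFDerivAt_const w z)).hasLineDerivAt (eulerField z))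
  have hr : HasDerivAt (fun t : ℝ ↦ (1 + t) * fibreNorm η z) (fibreNorm η z) 0 := by
    simpa using ((hasDerivAt_id' (0 : ℝ)).const_add 1).mul_const (fibreNorm η z)
  have hf : ∀ {f : ℝ → ℝ}, ContDiffOn ℝ ∞ f (Set.Ioi 0) →
      HasDerivAt (fun t : ℝ ↦ f ((1 + t) * fibreNorm η z) ^ 2)
        (2 * f (fibreNorm η z) * (deriv f (fibreNorm η z) * fibreNorm η z)) 0 := by
    intro f hf
    have h2 : HasDerivAt f (deriv f (fibreNorm η z)) ((1 + 0) * fibreNorm η z) := by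
      rw [add_zero, one_mul]; exact hasDerivAt_of_contDiffOn hf hp
    have h3 := (h2.comp (0 : ℝ) hr).pow 2
    simp at h3
    exact h3
  have hV : ∀ v : EB × F, HasDerivAt (fun t : ℝ ↦ v.2 + (1 + t) • A z.1 v.1 z.2)
      (A z.1 v.1 z.2) 0 := fun v ↦ by
    simpa using (((hasDerivAt_id' (0 : ℝ)).const_add 1).smul_const (A z.1 v.1 z.2)).const_add v.2
  have h3 := (((hf hh).mul_const (γ z.1 v.1 w.1))).add
    ((hf hk).mul (((hasDerivAt_const (0 : ℝ) (η z.1)).clm_apply (hV v)).clm_apply (hV w)))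
  have h4 := h1.unique (h3.congr_of_eventuallyEq (f₁ := fun t : ℝ ↦
    totalMetric γ η A h k (z + t • eulerField z) v w) ?_)
  · simp at h4
    rw [h4]
    simp only [map_add, add_apply]
    ring
  · filter_upwards [lt_mem_nhds (show (-1 : ℝ) < 0 by norm_num)] with t ht
    rw [totalMetric_apply, fibreNorm_line ht]
    have h5 : (z + t • eulerField z).1 = z.1 := by simp [eulerField]
    have h6 : (z + t • eulerField z).2 = (1 + t) • z.2 := by
      simp only [eulerField, Prod.snd_add, Prod.smul_snd]; module
    simp only [h5, h6, map_smul]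
    rfl

/-- The covariant derivative of the Euler field. -/
def eulerDeriv (A : EB → EB →L[ℝ] F →L[ℝ] F) (a b : ℝ) (z : EB × F) : EB × F →L[ℝ] EB × F :=
  a • ((ContinuousLinearMap.id ℝ EB).prod (-(A z.1).flip z.2) ∘L ContinuousLinearMap.fst ℝ EB F)
    + b • (ContinuousLinearMap.inr ℝ EB F ∘L vertComp A z)

omit hD in
lemma eulerDeriv_apply (a b : ℝ) (v : EB × F) :
    eulerDeriv A a b z v = (a • v.1, a • -(A z.1 v.1 z.2) + b • (v.2 + A z.1 v.1 z.2)) := by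
  ext
  · change a • v.1 + b • (0 : EB) = _
    simp
  · rfl

omit hD in
lemma trace_eulerDeriv [FiniteDimensional ℝ EB] [FiniteDimensional ℝ F] (a b : ℝ) :
    traceCLM (EB × F) (eulerDeriv A a b z) =
      Module.finrank ℝ EB * a + Module.finrank ℝ F * b := by
  have h1 : traceCLM (EB × F) ((ContinuousLinearMap.id ℝ EB).prod (-(A z.1).flip z.2) ∘L
      ContinuousLinearMap.fst ℝ EB F) = Module.finrank ℝ EB := by
    refine (LinearMap.trace_comp_comm' (LinearMap.fst ℝ EB F)
      ((ContinuousLinearMap.id ℝ EB).prod (-(A z.1).flip z.2)).toLinearMap).trans ?_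
    exact LinearMap.trace_id ℝ EB
  have h2 : traceCLM (EB × F) (ContinuousLinearMap.inr ℝ EB F ∘L vertComp A z) =
      Module.finrank ℝ F := by
    refine (LinearMap.trace_comp_comm' (vertComp A z).toLinearMap
      (LinearMap.inr ℝ EB F)).trans ?_
    have h3 : (vertComp A z).toLinearMap ∘ₗ LinearMap.inr ℝ EB F = LinearMap.id := by
      ext v
      change v + A z.1 0 z.2 = v
      simp
    rw [h3, LinearMap.trace_id]
  rw [eulerDeriv, map_add, map_smul, map_smul, h1, h2, smul_eq_mul, smul_eq_mul]
  ring

include hh hk hh_pos hk_pos in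
lemma inner_nabla_eulerField_symm [FiniteDimensional ℝ EB] [FiniteDimensional ℝ F]
    (hz : z ∈ puncturedDomain W) (v w : EB × F) :
    totalMetric γ η A h k z (nabla (totalMetric γ η A h k) eulerField z v) w =
      totalMetric γ η A h k z (nabla (totalMetric γ η A h k) eulerField z w) v := by
  have hkr : ContDiffOn ℝ ∞ (fun t ↦ k t ^ 2 * t) (Set.Ioi 0) := (hk.pow 2).mul contDiffOn_id
  refine (hD.isMetricOn hh hk hh_pos hk_pos).nabla_symm contDiff_eulerField.contDiffOn
    hD.contDiffOn_fibreNorm (F := fun z ↦ k (fibreNorm η z) ^ 2 * fibreNorm η z)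
    (F' := fun z ↦ deriv (fun t ↦ k t ^ 2 * t) (fibreNorm η z))
    (hkr.comp hD.contDiffOn_fibreNorm fun z hz ↦ hD.fibreNorm_pos hz) ?_ ?_ hz v w
  · intro z hz v
    have := ((hasDerivAt_of_contDiffOn hkr (hD.fibreNorm_pos hz)).comp_hasFDerivAt z
      (differentiableAt_of_contDiffOn hD.isOpen_puncturedDomain
        hD.contDiffOn_fibreNorm hz).hasFDerivAt).fderiv
    exact congrArg (fun L : EB × F →L[ℝ] ℝ ↦ L v) this
  · intro z hz v
    rw [totalMetric_eulerField, ← hD.fderiv_fibreNorm hz]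
    ring

include hh hk hh_pos hk_pos in
lemma nabla_eulerField [FiniteDimensional ℝ EB] [FiniteDimensional ℝ F]
    (hz : z ∈ puncturedDomain W) :
    nabla (totalMetric γ η A h k) eulerField z =
      eulerDeriv A (fibreNorm η z * deriv h (fibreNorm η z) / h (fibreNorm η z))
        (fibreNorm η z * deriv k (fibreNorm η z) / k (fibreNorm η z) + 1) z := by
  have hG := hD.isMetricOn hh hk hh_pos hk_pos
  have hp := hD.fibreNorm_pos hz
  have hh0 := (hh_pos _ hp).ne'
  have hk0 := (hk_pos _ hp).ne'
  refine ContinuousLinearMap.ext fun v ↦ hG.eq_of_inner hz fun w ↦ ?_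
  have h1 := hD.inner_nabla_eulerField_symm hh hk hh_pos hk_pos hz v w
  have h2 : ∀ v w, totalMetric γ η A h k z (nabla (totalMetric γ η A h k) eulerField z v) w =
      totalMetric γ η A h k z (0, v.2) w
      + totalMetric γ η A h k z (christoffel (totalMetric γ η A h k) z (eulerField z) v) w := by
    intro v w
    rw [nabla_apply, fderiv_eulerField, hG.christoffel_comm hz v, map_add, add_apply]
  have h3 := hG.fderiv_eq hz (eulerField z) v w
  rw [hG.symm z hz v, hD.fderiv_totalMetric_eulerField hh hk hh_pos hk_pos hz] at h3
  have h4 := h2 v w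
  have h5 := h2 w v
  rw [← h1] at h5
  rw [totalMetric_apply (0, v.2)] at h4
  rw [totalMetric_apply (0, w.2)] at h5
  simp only [map_zero, zero_apply, add_zero, mul_zero, zero_add] at h4 h5
  rw [hD.fibre_symm _ hz.1 w.2] at h5
  have h6 : totalMetric γ η A h k z (nabla (totalMetric γ η A h k) eulerField z v) w =
      h (fibreNorm η z) * (deriv h (fibreNorm η z) * fibreNorm η z) * γ z.1 v.1 w.1
      + (k (fibreNorm η z) * (deriv k (fibreNorm η z) * fibreNorm η z) + k (fibreNorm η z) ^ 2) *
        η z.1 (v.2 + A z.1 v.1 z.2) (w.2 + A z.1 w.1 z.2) := by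
    simp only [map_add, add_apply] at h3 h4 h5 ⊢
    linear_combination (h4 + h5 - h3) / 2
  rw [h6, totalMetric_apply, eulerDeriv_apply]
  simp only [map_add, map_smul, map_neg, add_apply, smul_apply, smul_eq_mul, neg_apply]
  field_simp
  ring

include hh hk hh_pos hk_pos in
lemma isRadial [FiniteDimensional ℝ EB] [FiniteDimensional ℝ F] :
    IsRadial (totalMetric γ η A h k) (puncturedDomain W) (fibreNorm η) eulerField h k
      (Module.finrank ℝ EB) (Module.finrank ℝ F) where
  toIsMetricOn := hD.isMetricOn hh hk hh_pos hk_pos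
  contDiffOn_r := hD.contDiffOn_fibreNorm
  r_pos _ hz := hD.fibreNorm_pos hz
  contDiffOn_ξ := contDiff_eulerField.contDiffOn
  inner_ξ z hz v := by
    rw [totalMetric_eulerField, ← hD.fderiv_fibreNorm hz]
    ring
  fderiv_ξ _ hz := hD.fderiv_fibreNorm_eulerField hz
  trace_ξ z hz := by
    rw [hD.nabla_eulerField hh hk hh_pos hk_pos hz, trace_eulerDeriv, mul_div_assoc, mul_div_assoc]

end IsTrivialBundleData

end Trivial

end RiemGeom

namespace BundleMetric

section Sections

variable {EB : Type*} [NormedAddCommGroup EB] [NormedSpace ℝ EB]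
  {B : Type*} [TopologicalSpace B] [ChartedSpace EB B]
  {F : Type*} [NormedAddCommGroup F] [NormedSpace ℝ F]
  {V : B → Type*} [TopologicalSpace (TotalSpace F V)]
  [∀ b, AddCommGroup (V b)] [∀ b, Module ℝ (V b)] [∀ b, TopologicalSpace (V b)]
  [FiberBundle F V] [VectorBundle ℝ F V] [ContMDiffVectorBundle ∞ F V 𝓘(ℝ, EB)]

/-- Sections that are constant in a trivialization are smooth. -/
lemma contMDiffOn_symmL_const (t : Trivialization F (TotalSpace.proj : TotalSpace F V → B))
    [MemTrivializationAtlas t] (f : F) :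
    ContMDiffOn 𝓘(ℝ, EB) (𝓘(ℝ, EB).prod 𝓘(ℝ, F)) ∞
      (fun b ↦ (⟨b, t.symmL ℝ b f⟩ : TotalSpace F V)) t.baseSet := by
  rw [t.contMDiffOn_section_baseSet_iff]
  refine (contMDiffOn_const (c := f)).congr fun b hb ↦ ?_
  rw [← t.continuousLinearMapAt_apply_of_mem ℝ hb, t.continuousLinearMapAt_symmL hb]

omit [ContMDiffVectorBundle ∞ F V 𝓘(ℝ, EB)] in
/-- A section smooth near a point agrees near that point with a globally smooth section. -/
lemma exists_contMDiff_eventuallyEq [FiniteDimensional ℝ EB] [T2Space B]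
    [IsManifold 𝓘(ℝ, EB) ∞ B] {σ : ∀ b, V b} {s : Set B} (hs : IsOpen s)
    (hσ : ContMDiffOn 𝓘(ℝ, EB) (𝓘(ℝ, EB).prod 𝓘(ℝ, F)) ∞
      (fun b ↦ (⟨b, σ b⟩ : TotalSpace F V)) s) {b : B} (hb : b ∈ s) :
    ∃ τ : ∀ b, V b, ContMDiff 𝓘(ℝ, EB) (𝓘(ℝ, EB).prod 𝓘(ℝ, F)) ∞
      (fun b ↦ (⟨b, τ b⟩ : TotalSpace F V)) ∧ ∀ᶠ b' in 𝓝 b, τ b' = σ b' := by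
  obtain ⟨ψ, -, hψ⟩ := (SmoothBumpFunction.nhds_basis_tsupport (I := 𝓘(ℝ, EB)) b).mem_iff.1
    (hs.mem_nhds hb)
  refine ⟨(ψ : B → ℝ) • σ,
    ContMDiffOn.smul_section_of_tsupport ψ.contMDiff.contMDiffOn hs hψ hσ, ?_⟩
  filter_upwards [ψ.eventuallyEq_one] with b' hb'
  simp [hb']

end Sections

section Forms

variable {EB : Type*} [NormedAddCommGroup EB] [NormedSpace ℝ EB]
  {B : Type*} [TopologicalSpace B] [ChartedSpace EB B] [IsManifold 𝓘(ℝ, EB) ∞ B]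
  {F : Type*} [NormedAddCommGroup F] [NormedSpace ℝ F]
  {V : B → Type*} [TopologicalSpace (TotalSpace F V)]
  [∀ b, NormedAddCommGroup (V b)] [∀ b, InnerProductSpace ℝ (V b)]
  [FiberBundle F V] [VectorBundle ℝ F V]

/-- The base metric in the chart at `b₀`, as a function on the base. -/
def baseForm (gB : ContMDiffRiemannianMetric 𝓘(ℝ, EB) ∞ EB
    (fun b : B ↦ TangentSpace 𝓘(ℝ, EB) b)) (b₀ b : B) : EB →L[ℝ] EB →L[ℝ] ℝ :=
  (RiemGeom.tangentCoordSymm 𝓘(ℝ, EB) b₀ b).precomp ℝ ∘L gB.inner b ∘L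
    RiemGeom.tangentCoordSymm 𝓘(ℝ, EB) b₀ b

/-- The fibre metric in the trivialization at `b₀`. -/
def fibreForm (F : Type*) [NormedAddCommGroup F] [NormedSpace ℝ F]
    (V : B → Type*) [TopologicalSpace (TotalSpace F V)]
    [∀ b, NormedAddCommGroup (V b)] [∀ b, InnerProductSpace ℝ (V b)]
    [FiberBundle F V] [VectorBundle ℝ F V] (b₀ b : B) : F →L[ℝ] F →L[ℝ] ℝ :=
  (innerSL ℝ : V b →L[ℝ] V b →L[ℝ] ℝ).bilinearComp
    ((trivializationAt F V b₀).symmL ℝ b) ((trivializationAt F V b₀).symmL ℝ b)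

/-- The connection of the trivialization `t`. -/
def trivialConnection (t : Trivialization F (TotalSpace.proj : TotalSpace F V → B))
    [MemTrivializationAtlas t] (σ : ∀ b, V b) (b : B) : TangentSpace 𝓘(ℝ, EB) b →L[ℝ] V b :=
  t.symmL ℝ b ∘L mvfderiv 𝓘(ℝ, EB) (fun b ↦ t.continuousLinearMapAt ℝ b (σ b)) b

variable [ContMDiffVectorBundle ∞ F V 𝓘(ℝ, EB)]

omit [IsManifold 𝓘(ℝ, EB) ∞ B] in
lemma mdifferentiableAt_continuousLinearMapAt
    (t : Trivialization F (TotalSpace.proj : TotalSpace F V → B)) [MemTrivializationAtlas t]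
    {σ : ∀ b, V b} {b : B} (hb : b ∈ t.baseSet)
    (hσ : MDifferentiableAt 𝓘(ℝ, EB) (𝓘(ℝ, EB).prod 𝓘(ℝ, F))
      (fun b ↦ (⟨b, σ b⟩ : TotalSpace F V)) b) :
    MDifferentiableAt 𝓘(ℝ, EB) 𝓘(ℝ, F) (fun b ↦ t.continuousLinearMapAt ℝ b (σ b)) b := by
  refine ((t.mdifferentiableAt_section_iff 𝓘(ℝ, EB) σ hb).1 hσ).congr_of_eventuallyEq ?_
  filter_upwards [t.open_baseSet.mem_nhds hb] with b' hb'
  exact t.continuousLinearMapAt_apply_of_mem ℝ hb' _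

omit [IsManifold 𝓘(ℝ, EB) ∞ B] in
lemma isCovariantDerivativeOn_trivialConnection
    (t : Trivialization F (TotalSpace.proj : TotalSpace F V → B)) [MemTrivializationAtlas t] :
    IsCovariantDerivativeOn F (trivialConnection (EB := EB) t) t.baseSet where
  add {σ σ' b} hσ hσ' hb := by
    have h1 := mvfderiv_fun_add (mdifferentiableAt_continuousLinearMapAt t hb hσ)
      (mdifferentiableAt_continuousLinearMapAt t hb hσ')
    ext u
    simp only [trivialConnection, Pi.add_apply, map_add, h1, ContinuousLinearMap.comp_apply,
      add_apply]
  leibniz {σ g b} hσ hg hb := by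
    have h1 := mvfderiv_fun_smul hg (mdifferentiableAt_continuousLinearMapAt t hb hσ)
    ext u
    simp only [trivialConnection, Pi.smul_apply', map_smul, h1, ContinuousLinearMap.comp_apply,
      add_apply, map_add, smul_apply, ContinuousLinearMap.smulRight_apply]
    rw [t.symmL_continuousLinearMapAt hb]

/-- The difference of a connection and the trivial one, as a form in the trivialization at `b₀`. -/
def connectionForm [FiniteDimensional ℝ F] (D : CovariantDerivative 𝓘(ℝ, EB) F V) (b₀ b : B) :
    EB →L[ℝ] F →L[ℝ] F :=
  ((RiemGeom.tangentCoordSymm 𝓘(ℝ, EB) b₀ b).precomp F ∘L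
    ((trivializationAt F V b₀).continuousLinearMapAt ℝ b).postcomp (TangentSpace 𝓘(ℝ, EB) b) ∘L
    IsCovariantDerivativeOn.difference
      (D.isCovariantDerivativeOn (s := (trivializationAt F V b₀).baseSet))
      (isCovariantDerivativeOn_trivialConnection (EB := EB) (trivializationAt F V b₀)) b ∘L
    (trivializationAt F V b₀).symmL ℝ b).flip

lemma connectionForm_apply [FiniteDimensional ℝ F] (D : CovariantDerivative 𝓘(ℝ, EB) F V)
    {b₀ b : B} (hb : b ∈ (trivializationAt F V b₀).baseSet) {σ : ∀ b, V b}
    (hσ : MDifferentiableAt 𝓘(ℝ, EB) (𝓘(ℝ, EB).prod 𝓘(ℝ, F))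
      (fun b ↦ (⟨b, σ b⟩ : TotalSpace F V)) b) (u : EB) :
    (trivializationAt F V b₀).continuousLinearMapAt ℝ b
      (D σ b (RiemGeom.tangentCoordSymm 𝓘(ℝ, EB) b₀ b u)) =
    mvfderiv 𝓘(ℝ, EB) (fun b ↦ (trivializationAt F V b₀).continuousLinearMapAt ℝ b (σ b)) b
        (RiemGeom.tangentCoordSymm 𝓘(ℝ, EB) b₀ b u)
      + connectionForm D b₀ b u ((trivializationAt F V b₀).continuousLinearMapAt ℝ b (σ b)) := by
  have h1 : connectionForm D b₀ b u ((trivializationAt F V b₀).continuousLinearMapAt ℝ b (σ b)) =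
    (trivializationAt F V b₀).continuousLinearMapAt ℝ b (IsCovariantDerivativeOn.difference
      (D.isCovariantDerivativeOn (s := (trivializationAt F V b₀).baseSet))
      (isCovariantDerivativeOn_trivialConnection (EB := EB) (trivializationAt F V b₀)) b
      ((trivializationAt F V b₀).symmL ℝ b ((trivializationAt F V b₀).continuousLinearMapAt ℝ b
        (σ b))) (RiemGeom.tangentCoordSymm 𝓘(ℝ, EB) b₀ b u)) := rfl
  rw [h1, Trivialization.symmL_continuousLinearMapAt _ hb,
    IsCovariantDerivativeOn.difference_apply _ _ hb hσ, sub_apply, map_sub]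
  have h2 : (trivializationAt F V b₀).continuousLinearMapAt ℝ b
      (trivialConnection (trivializationAt F V b₀) σ b
        (RiemGeom.tangentCoordSymm 𝓘(ℝ, EB) b₀ b u)) = _ :=
    Trivialization.continuousLinearMapAt_symmL _ hb _
  have h3 : ∀ {a p q : F}, p = q → a = q + (a - p) := fun h ↦ by rw [h, add_sub_cancel]
  exact h3 h2

variable {b₀ : B}

omit [IsManifold 𝓘(ℝ, EB) ∞ B] [ContMDiffVectorBundle ∞ F V 𝓘(ℝ, EB)] in
lemma mvfderiv_symmL_const (t : Trivialization F (TotalSpace.proj : TotalSpace F V → B))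
    [MemTrivializationAtlas t] {b : B} (hb : b ∈ t.baseSet) (f : F) :
    mvfderiv 𝓘(ℝ, EB) (fun b ↦ t.continuousLinearMapAt ℝ b (t.symmL ℝ b f)) b = 0 := by
  have h1 : (fun b ↦ t.continuousLinearMapAt ℝ b (t.symmL ℝ b f)) =ᶠ[𝓝 b] fun _ ↦ f := by
    filter_upwards [t.open_baseSet.mem_nhds hb] with b' hb'
    exact t.continuousLinearMapAt_symmL hb' f
  have h2 := h1.mfderiv_eq (I := 𝓘(ℝ, EB)) (I' := 𝓘(ℝ, F))
  ext u
  exact congrArg (fun L : EB →L[ℝ] F ↦ L u) (h2.trans mfderiv_const)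

lemma contMDiffAt_connectionForm [FiniteDimensional ℝ EB] [T2Space B] [FiniteDimensional ℝ F]
    (D : CovariantDerivative 𝓘(ℝ, EB) F V) [D.ContMDiffCovariantDerivative ∞]
    {b : B} (hb : b ∈ (trivializationAt F V b₀).baseSet) (hb' : b ∈ (chartAt EB b₀).source)
    (u : EB) (f : F) :
    ContMDiffAt 𝓘(ℝ, EB) 𝓘(ℝ, F) ∞ (fun b ↦ connectionForm D b₀ b u f) b := by
  have hσ := contMDiffOn_symmL_const (EB := EB) (trivializationAt F V b₀) f
  obtain ⟨τ, hτ, he⟩ := exists_contMDiff_eventuallyEq (trivializationAt F V b₀).open_baseSet hσ hb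
  have h1 := (‹D.ContMDiffCovariantDerivative ∞›.contMDiff.contMDiff
    (σ := τ) hτ.contMDiffOn).contMDiffAt Filter.univ_mem (x := b)
  have h2 := (contMDiffOn_symmL_const (EB := EB)
    (trivializationAt EB (TangentSpace 𝓘(ℝ, EB)) b₀) u).contMDiffAt
      ((trivializationAt EB (TangentSpace 𝓘(ℝ, EB)) b₀).open_baseSet.mem_nhds hb')
  have h3 := ((trivializationAt F V b₀).contMDiffAt_section_iff hb).1 (h1.clm_bundle_apply h2)
  refine h3.congr_of_eventuallyEq ?_
  filter_upwards [(trivializationAt F V b₀).open_baseSet.mem_nhds hb, he.eventually_nhds] with b' hb1 hb2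
  have h4 := (hσ.contMDiffAt ((trivializationAt F V b₀).open_baseSet.mem_nhds hb1)).mdifferentiableAt (by simp)
  have h5 := (hτ b').mdifferentiableAt (by simp)
  have h6 := connectionForm_apply D hb1 h4 u
  have h7 := mvfderiv_symmL_const (EB := EB) (trivializationAt F V b₀) hb1 f
  have h8 := D.isCovariantDerivativeOnUniv.congr_of_eventuallyEq h4 h5 Filter.univ_mem
    (hb2.mono fun _ h ↦ h.symm)
  rw [h7, (trivializationAt F V b₀).continuousLinearMapAt_symmL hb1, zero_apply, zero_add, h8] at h6
  rw [← h6]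
  exact (trivializationAt F V b₀).continuousLinearMapAt_apply_of_mem ℝ hb1 _

end Forms

end BundleMetric

namespace BundleMetric

section Data

variable {EB : Type*} [NormedAddCommGroup EB] [NormedSpace ℝ EB] [FiniteDimensional ℝ EB]
  {B : Type*} [TopologicalSpace B] [T2Space B] [ChartedSpace EB B] [IsManifold 𝓘(ℝ, EB) ∞ B]
  {F : Type*} [NormedAddCommGroup F] [NormedSpace ℝ F] [FiniteDimensional ℝ F]
  {V : B → Type*} [TopologicalSpace (TotalSpace F V)]
  [∀ b, NormedAddCommGroup (V b)] [∀ b, InnerProductSpace ℝ (V b)]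
  [FiberBundle F V] [VectorBundle ℝ F V] [ContMDiffVectorBundle ∞ F V 𝓘(ℝ, EB)]
  {b₀ b : B}

omit [FiniteDimensional ℝ EB] [T2Space B] [IsManifold 𝓘(ℝ, EB) ∞ B] [FiniteDimensional ℝ F]
  [ContMDiffVectorBundle ∞ F V 𝓘(ℝ, EB)] in
lemma fibreForm_apply (a c : F) : fibreForm F V b₀ b a c =
    inner ℝ ((trivializationAt F V b₀).symmL ℝ b a) ((trivializationAt F V b₀).symmL ℝ b c) := rfl

omit [FiniteDimensional ℝ EB] [T2Space B] in
lemma baseForm_apply (gB : ContMDiffRiemannianMetric 𝓘(ℝ, EB) ∞ EB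
    (fun b : B ↦ TangentSpace 𝓘(ℝ, EB) b)) (u v : EB) : baseForm gB b₀ b u v =
    gB.inner b (RiemGeom.tangentCoordSymm 𝓘(ℝ, EB) b₀ b u)
      (RiemGeom.tangentCoordSymm 𝓘(ℝ, EB) b₀ b v) := rfl

omit [FiniteDimensional ℝ EB] [T2Space B] in
lemma contMDiffAt_baseForm (gB : ContMDiffRiemannianMetric 𝓘(ℝ, EB) ∞ EB
    (fun b : B ↦ TangentSpace 𝓘(ℝ, EB) b)) (hb : b ∈ (chartAt EB b₀).source) (u v : EB) :
    ContMDiffAt 𝓘(ℝ, EB) 𝓘(ℝ) ∞ (fun b ↦ baseForm gB b₀ b u v) b := by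
  have h2 := fun u ↦ (contMDiffOn_symmL_const (EB := EB)
    (trivializationAt EB (TangentSpace 𝓘(ℝ, EB)) b₀) u).contMDiffAt
      ((trivializationAt EB (TangentSpace 𝓘(ℝ, EB)) b₀).open_baseSet.mem_nhds hb)
  have h1 : ContMDiffAt 𝓘(ℝ, EB) (𝓘(ℝ, EB).prod 𝓘(ℝ)) ∞
      (fun b ↦ TotalSpace.mk' ℝ (E := Bundle.Trivial B ℝ) b
        (gB.inner b (RiemGeom.tangentCoordSymm 𝓘(ℝ, EB) b₀ b u)
          (RiemGeom.tangentCoordSymm 𝓘(ℝ, EB) b₀ b v))) b :=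
    ContMDiffAt.clm_bundle_apply₂ (F₁ := EB) (F₂ := EB) gB.contMDiff.contMDiffAt (h2 u) (h2 v)
  simp only [contMDiffAt_totalSpace] at h1
  exact h1.2

omit [FiniteDimensional ℝ EB] [T2Space B] [IsManifold 𝓘(ℝ, EB) ∞ B] [FiniteDimensional ℝ F] in
lemma contMDiffAt_fibreForm [IsContMDiffRiemannianBundle 𝓘(ℝ, EB) ∞ F V]
    (hb : b ∈ (trivializationAt F V b₀).baseSet) (a c : F) :
    ContMDiffAt 𝓘(ℝ, EB) 𝓘(ℝ) ∞ (fun b ↦ fibreForm F V b₀ b a c) b := by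
  have h2 := fun a ↦ (contMDiffOn_symmL_const (EB := EB) (trivializationAt F V b₀) a).contMDiffAt
    ((trivializationAt F V b₀).open_baseSet.mem_nhds hb)
  exact (h2 a).inner_bundle (h2 c)

variable (EB F V b₀) in
/-- The part of the chart at `b₀` over which the trivialization at `b₀` is defined. -/
def baseDomain : Set EB :=
  (extChartAt 𝓘(ℝ, EB) b₀).target ∩
    (extChartAt 𝓘(ℝ, EB) b₀).symm ⁻¹' (trivializationAt F V b₀).baseSet

omit [FiniteDimensional ℝ EB] [T2Space B] [IsManifold 𝓘(ℝ, EB) ∞ B] [FiniteDimensional ℝ F]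
  [∀ b, InnerProductSpace ℝ (V b)] [VectorBundle ℝ F V] [ContMDiffVectorBundle ∞ F V 𝓘(ℝ, EB)]
  [NormedSpace ℝ F] in
lemma isOpen_baseDomain : IsOpen (baseDomain EB F V b₀) :=
  (continuousOn_extChartAt_symm b₀).isOpen_inter_preimage (isOpen_extChartAt_target b₀)
    (trivializationAt F V b₀).open_baseSet

omit [FiniteDimensional ℝ EB] [T2Space B] [IsManifold 𝓘(ℝ, EB) ∞ B] [FiniteDimensional ℝ F]
  [∀ b, InnerProductSpace ℝ (V b)] [VectorBundle ℝ F V] [ContMDiffVectorBundle ∞ F V 𝓘(ℝ, EB)]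
  [NormedSpace ℝ F] in
lemma symm_mem_source {x : EB} (hx : x ∈ baseDomain EB F V b₀) :
    (extChartAt 𝓘(ℝ, EB) b₀).symm x ∈ (chartAt EB b₀).source := by
  rw [← extChartAt_source 𝓘(ℝ, EB)]
  exact (extChartAt 𝓘(ℝ, EB) b₀).map_target hx.1

omit [FiniteDimensional ℝ EB] [T2Space B] [FiniteDimensional ℝ F]
  [∀ b, InnerProductSpace ℝ (V b)] [VectorBundle ℝ F V] [ContMDiffVectorBundle ∞ F V 𝓘(ℝ, EB)]
  [NormedSpace ℝ F] in
lemma contDiffOn_comp_symm {F' : Type*} [NormedAddCommGroup F'] [NormedSpace ℝ F'] {f : B → F'}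
    (hf : ∀ b ∈ (trivializationAt F V b₀).baseSet, b ∈ (chartAt EB b₀).source →
      ContMDiffAt 𝓘(ℝ, EB) 𝓘(ℝ, F') ∞ f b) :
    ContDiffOn ℝ ∞ (fun x ↦ f ((extChartAt 𝓘(ℝ, EB) b₀).symm x)) (baseDomain EB F V b₀) := by
  intro x hx
  have h1 : ContMDiffAt 𝓘(ℝ, EB) 𝓘(ℝ, EB) ∞ (extChartAt 𝓘(ℝ, EB) b₀).symm x :=
    (contMDiffOn_extChartAt_symm b₀).contMDiffAt ((isOpen_extChartAt_target b₀).mem_nhds hx.1)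
  exact ((hf _ hx.2 (symm_mem_source hx)).comp x h1).contDiffAt.contDiffWithinAt

omit [FiniteDimensional ℝ EB] [T2Space B] in
lemma contDiffOn_fibreForm [IsContMDiffRiemannianBundle 𝓘(ℝ, EB) ∞ F V] :
    ContDiffOn ℝ ∞ (fun x ↦ fibreForm F V b₀ ((extChartAt 𝓘(ℝ, EB) b₀).symm x))
      (baseDomain EB F V b₀) := by
  rw [contDiffOn_clm_apply]
  intro a
  rw [contDiffOn_clm_apply]
  intro c
  exact contDiffOn_comp_symm fun b hb _ ↦ contMDiffAt_fibreForm hb a c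

/-- In the chart and the trivialization at `b₀`, a metric bundle with a compatible connection over
a Riemannian manifold is given by trivial bundle data. -/
lemma isTrivialBundleData [IsContMDiffRiemannianBundle 𝓘(ℝ, EB) ∞ F V]
    (gB : ContMDiffRiemannianMetric 𝓘(ℝ, EB) ∞ EB (fun b : B ↦ TangentSpace 𝓘(ℝ, EB) b))
    (D : CovariantDerivative 𝓘(ℝ, EB) F V) [D.ContMDiffCovariantDerivative ∞]
    (hD : D.IsMetricCompatible) (b₀ : B) :
    RiemGeom.IsTrivialBundleData
      (fun x ↦ baseForm gB b₀ ((extChartAt 𝓘(ℝ, EB) b₀).symm x))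
      (fun x ↦ fibreForm F V b₀ ((extChartAt 𝓘(ℝ, EB) b₀).symm x))
      (fun x ↦ connectionForm D b₀ ((extChartAt 𝓘(ℝ, EB) b₀).symm x))
      (baseDomain EB F V b₀) where
  base :=
    { isOpen := isOpen_baseDomain
      contDiffOn := by
        rw [contDiffOn_clm_apply]
        intro u
        rw [contDiffOn_clm_apply]
        intro v
        exact contDiffOn_comp_symm fun b _ hb' ↦ contMDiffAt_baseForm gB hb' u v
      symm := fun x hx u v ↦ gB.symm _ _ _
      pos := fun x hx u hu ↦ by
        refine gB.pos _ _ fun h0 ↦ hu ?_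
        have := RiemGeom.tangentCoord_symm (I := 𝓘(ℝ, EB)) (symm_mem_source hx) u
        exact this.symm.trans ((congrArg _ h0).trans (map_zero _)) }
  contDiffOn_fibre := contDiffOn_fibreForm
  fibre_symm x hx a c := real_inner_comm _ _
  fibre_pos x hx a ha := by
    rw [fibreForm_apply]
    refine real_inner_self_pos.2 fun h0 ↦ ha ?_
    have := (trivializationAt F V b₀).continuousLinearMapAt_symmL (R := ℝ) hx.2 a
    rw [← this, h0, map_zero]
  contDiffOn_form := by
    rw [contDiffOn_clm_apply]
    intro u
    rw [contDiffOn_clm_apply]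
    intro f
    exact contDiffOn_comp_symm fun b hb hb' ↦ contMDiffAt_connectionForm D hb hb' u f
  compatible x hx u a c := by
    have hb := symm_mem_source hx
    have hr : extChartAt 𝓘(ℝ, EB) b₀ ((extChartAt 𝓘(ℝ, EB) b₀).symm x) = x :=
      (extChartAt 𝓘(ℝ, EB) b₀).right_inv hx.1
    have hσ := fun a ↦ ((contMDiffOn_symmL_const (EB := EB) (trivializationAt F V b₀) a).contMDiffAt
      ((trivializationAt F V b₀).open_baseSet.mem_nhds hx.2)).mdifferentiableAt (by simp)
    have hA : ∀ a, D (fun b ↦ (trivializationAt F V b₀).symmL ℝ b a)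
        ((extChartAt 𝓘(ℝ, EB) b₀).symm x)
        (RiemGeom.tangentCoordSymm 𝓘(ℝ, EB) b₀ ((extChartAt 𝓘(ℝ, EB) b₀).symm x) u) =
        (trivializationAt F V b₀).symmL ℝ ((extChartAt 𝓘(ℝ, EB) b₀).symm x)
          (connectionForm D b₀ ((extChartAt 𝓘(ℝ, EB) b₀).symm x) u a) := by
      intro a
      have h1 := connectionForm_apply D hx.2 (hσ a) u
      rw [mvfderiv_symmL_const _ hx.2, Trivialization.continuousLinearMapAt_symmL _ hx.2, zero_apply,
        zero_add] at h1
      rw [← h1, Trivialization.symmL_continuousLinearMapAt _ hx.2]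
    have h2 := hD.mvfderiv_inner_eq
      (fun b ↦ RiemGeom.tangentCoordSymm 𝓘(ℝ, EB) b₀ b u) (hσ a) (hσ c)
    simp only [hA] at h2
    have h3 := (contMDiffAt_fibreForm (EB := EB) hx.2 a c).mdifferentiableAt (by simp)
    have h4 := RiemGeom.mvfderiv_eq_fderiv h3 hb
      (RiemGeom.tangentCoordSymm 𝓘(ℝ, EB) b₀ ((extChartAt 𝓘(ℝ, EB) b₀).symm x) u)
    rw [RiemGeom.tangentCoord_symm hb, hr] at h4
    have h5 := (RiemGeom.differentiableAt_of_contDiffOn isOpen_baseDomain contDiffOn_fibreForm hx)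
    have h6 := ((h5.hasFDerivAt.clm_apply (hasFDerivAt_const a x)).clm_apply (hasFDerivAt_const c x)).fderiv
    have h7 := congrArg (fun L : EB →L[ℝ] ℝ ↦ L u) h6
    simp only [ContinuousLinearMap.comp_zero, zero_add, ContinuousLinearMap.flip_apply] at h7
    exact h7.symm.trans (h4.symm.trans h2)

end Data

end BundleMetric

namespace RiemGeom

/-- The coordinates of the derivative of a map into a manifold. -/
lemma tangentCoord_mfderiv {E : Type*} [NormedAddCommGroup E] [NormedSpace ℝ E]
    {H : Type*} [TopologicalSpace H] {I : ModelWithCorners ℝ E H}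
    {M : Type*} [TopologicalSpace M] [ChartedSpace H M] [IsManifold I 1 M]
    {E' : Type*} [NormedAddCommGroup E'] [NormedSpace ℝ E']
    {H' : Type*} [TopologicalSpace H'] {I' : ModelWithCorners ℝ E' H'}
    {M' : Type*} [TopologicalSpace M'] [ChartedSpace H' M']
    {c : M' → M} {p : M'} {x₀ y : M} (hc : MDifferentiableAt I' I c p) (hy : c p = y)
    (hs : y ∈ (chartAt H x₀).source) (u : TangentSpace I' p) :
    tangentCoord I x₀ y (mfderiv I' I c p u) =
      mfderiv I' 𝓘(ℝ, E) (fun q ↦ extChartAt I x₀ (c q)) p u := by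
  subst hy
  have h := mfderiv_comp p (mdifferentiableAt_extChartAt hs) hc
  rw [tangentCoord_eq_mfderiv hs]
  exact (congrArg (fun L ↦ L u) h).symm

lemma mfderiv_clm_comp {E F : Type*} [NormedAddCommGroup E] [NormedSpace ℝ E]
    [NormedAddCommGroup F] [NormedSpace ℝ F]
    {E' : Type*} [NormedAddCommGroup E'] [NormedSpace ℝ E']
    {H' : Type*} [TopologicalSpace H'] {I' : ModelWithCorners ℝ E' H'}
    {M' : Type*} [TopologicalSpace M'] [ChartedSpace H' M'] (L : E →L[ℝ] F)
    {c : M' → E} {p : M'} (hc : MDifferentiableAt I' 𝓘(ℝ, E) c p) (u : TangentSpace I' p) :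
    mfderiv I' 𝓘(ℝ, F) (fun q ↦ L (c q)) p u = L (mfderiv I' 𝓘(ℝ, E) c p u) := by
  have h := (L.hasMFDerivAt.comp p hc.hasMFDerivAt).mfderiv
  exact congrArg (fun L ↦ L u) h

end RiemGeom

namespace BundleMetric

open RiemGeom

section TotalSpace

variable {EB : Type*} [NormedAddCommGroup EB] [NormedSpace ℝ EB]
  {B : Type*} [TopologicalSpace B] [ChartedSpace EB B] [IsManifold 𝓘(ℝ, EB) ∞ B]
  {F : Type*} [NormedAddCommGroup F] [NormedSpace ℝ F]
  {V : B → Type*} [TopologicalSpace (TotalSpace F V)]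
  [∀ b, NormedAddCommGroup (V b)] [∀ b, InnerProductSpace ℝ (V b)]
  [FiberBundle F V] [VectorBundle ℝ F V] [ContMDiffVectorBundle ∞ F V 𝓘(ℝ, EB)]
  {e₀ e : TotalSpace F V}

omit [NormedSpace ℝ EB] [IsManifold 𝓘(ℝ, EB) ∞ B] [NormedSpace ℝ F]
  [∀ b, InnerProductSpace ℝ (V b)] [VectorBundle ℝ F V] [ContMDiffVectorBundle ∞ F V 𝓘(ℝ, EB)] in
lemma mem_chartAt_source : e ∈ (chartAt (ModelProd EB F) e₀).source ↔
    e.proj ∈ (trivializationAt F V e₀.proj).baseSet ∧ e.proj ∈ (chartAt EB e₀.proj).source := by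
  rw [FiberBundle.chartedSpace_chartAt]
  simp only [mfld_simps, Trivialization.mem_source]
  constructor
  · rintro ⟨h1, h2⟩
    rw [Trivialization.coe_fst' _ h1] at h2
    exact ⟨h1, h2⟩
  · rintro ⟨h1, h2⟩
    rw [Trivialization.coe_fst' _ h1]
    exact ⟨h1, h2⟩

omit [IsManifold 𝓘(ℝ, EB) ∞ B] [ContMDiffVectorBundle ∞ F V 𝓘(ℝ, EB)] in
lemma extChartAt_totalSpace (he : e.proj ∈ (trivializationAt F V e₀.proj).baseSet) :
    extChartAt (𝓘(ℝ, EB).prod 𝓘(ℝ, F)) e₀ e =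
      (extChartAt 𝓘(ℝ, EB) e₀.proj e.proj,
        (trivializationAt F V e₀.proj).continuousLinearMapAt ℝ e.proj e.2) := by
  rw [FiberBundle.extChartAt, Trivialization.continuousLinearMapAt_apply_of_mem _ _ he]
  have h1 := Trivialization.coe_fst' _ he
  change (extChartAt 𝓘(ℝ, EB) e₀.proj (trivializationAt F V e₀.proj e).1,
    (trivializationAt F V e₀.proj e).2) = _
  rw [h1]

lemma tangentCoord_fst (he : e ∈ (chartAt (ModelProd EB F) e₀).source)
    (v : TangentSpace (𝓘(ℝ, EB).prod 𝓘(ℝ, F)) e) :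
    (tangentCoord (𝓘(ℝ, EB).prod 𝓘(ℝ, F)) e₀ e v).1 =
      tangentCoord 𝓘(ℝ, EB) e₀.proj e.proj (dproj e v) := by
  have hb := mem_chartAt_source.1 he
  have h1 := tangentCoord_mfderiv (I := 𝓘(ℝ, EB)) (x₀ := e₀.proj)
    (mdifferentiableAt_proj (IB := 𝓘(ℝ, EB)) (F := F) (E := V) (p := e)) rfl hb.2 v
  have h2 : (fun q : TotalSpace F V ↦ extChartAt 𝓘(ℝ, EB) e₀.proj q.proj) =ᶠ[𝓝 e] fun q ↦
      ContinuousLinearMap.fst ℝ EB F (extChartAt (𝓘(ℝ, EB).prod 𝓘(ℝ, F)) e₀ q) := by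
    filter_upwards [(chartAt (ModelProd EB F) e₀).open_source.mem_nhds he] with e' he'
    rw [extChartAt_totalSpace (mem_chartAt_source.1 he').1]
    rfl
  have h3 := mfderiv_clm_comp (ContinuousLinearMap.fst ℝ EB F)
    (mdifferentiableAt_extChartAt (I := 𝓘(ℝ, EB).prod 𝓘(ℝ, F)) he) v
  have h4 := h2.mfderiv_eq (I := 𝓘(ℝ, EB).prod 𝓘(ℝ, F)) (I' := 𝓘(ℝ, EB))
  refine Eq.trans ?_ h1.symm
  rw [tangentCoord_eq_mfderiv he]
  exact h3.symm.trans (congrArg (fun L : EB × F →L[ℝ] EB ↦ L v) h4).symm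

lemma tangentCoord_vertLift (he : e ∈ (chartAt (ModelProd EB F) e₀).source) (f : V e.proj) :
    tangentCoord (𝓘(ℝ, EB).prod 𝓘(ℝ, F)) e₀ e (vertLift e f) =
      (0, (trivializationAt F V e₀.proj).continuousLinearMapAt ℝ e.proj f) := by
  have hb := mem_chartAt_source.1 he
  have h0 : MDifferentiableAt 𝓘(ℝ, V e.proj) (𝓘(ℝ, EB).prod 𝓘(ℝ, F))
      (fun w : V e.proj ↦ (⟨e.proj, w⟩ : TotalSpace F V)) e.2 := by
    rw [mdifferentiableAt_totalSpace]
    refine ⟨mdifferentiableAt_const, ?_⟩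
    have h1 : ∀ w : V e.proj, (trivializationAt F V e.proj ⟨e.proj, w⟩).2 =
        (trivializationAt F V e.proj).continuousLinearMapAt ℝ e.proj w := fun w ↦
      ((trivializationAt F V e.proj).continuousLinearMapAt_apply_of_mem ℝ
        (FiberBundle.mem_baseSet_trivializationAt' _) w).symm
    simp only [h1]
    exact ((trivializationAt F V e.proj).continuousLinearMapAt ℝ
      e.proj).differentiableAt.mdifferentiableAt
  have h1 := tangentCoord_mfderiv (x₀ := e₀) h0 rfl he (f : TangentSpace 𝓘(ℝ, V e.proj) e.2)
  refine Eq.trans h1 ?_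
  have h2 : (fun w : V e.proj ↦ extChartAt (𝓘(ℝ, EB).prod 𝓘(ℝ, F)) e₀ ⟨e.proj, w⟩) = fun w ↦
      (extChartAt 𝓘(ℝ, EB) e₀.proj e.proj,
        (trivializationAt F V e₀.proj).continuousLinearMapAt ℝ e.proj w) := by
    funext w
    exact extChartAt_totalSpace (e := ⟨e.proj, w⟩) hb.1
  have h3 := ((hasFDerivAt_const (𝕜 := ℝ) (extChartAt 𝓘(ℝ, EB) e₀.proj e.proj) e.2).prodMk
    ((trivializationAt F V e₀.proj).continuousLinearMapAt ℝ e.proj).hasFDerivAt).fderiv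
  rw [h2, mfderiv_eq_fderiv]
  exact congrArg (fun L : V e.proj →L[ℝ] EB × F ↦ L f) h3

lemma tangentCoord_dsection (he : e ∈ (chartAt (ModelProd EB F) e₀).source)
    (u : TangentSpace 𝓘(ℝ, EB) e.proj) :
    tangentCoord (𝓘(ℝ, EB).prod 𝓘(ℝ, F)) e₀ e (dsection e u) =
      (tangentCoord 𝓘(ℝ, EB) e₀.proj e.proj u,
        mvfderiv 𝓘(ℝ, EB) (fun b ↦ (trivializationAt F V e₀.proj).continuousLinearMapAt ℝ b
          (FiberBundle.extend F e.2 b)) e.proj u) := by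
  have hb := mem_chartAt_source.1 he
  have hσ := FiberBundle.mdifferentiableAt_extend 𝓘(ℝ, EB) F e.2
  have h1 := tangentCoord_mfderiv (x₀ := e₀) hσ (y := e)
    (by rw [FiberBundle.extend_apply_self]) he u
  refine Eq.trans h1 ?_
  have hφ := mdifferentiableAt_extChartAt (I := 𝓘(ℝ, EB)) hb.2
  have ht := mdifferentiableAt_continuousLinearMapAt (EB := EB) _ hb.1 hσ
  have h2 : (fun b : B ↦ extChartAt (𝓘(ℝ, EB).prod 𝓘(ℝ, F)) e₀ ⟨b, FiberBundle.extend F e.2 b⟩)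
      =ᶠ[𝓝 e.proj] fun b ↦ (extChartAt 𝓘(ℝ, EB) e₀.proj b,
        (trivializationAt F V e₀.proj).continuousLinearMapAt ℝ b (FiberBundle.extend F e.2 b)) := by
    filter_upwards [(trivializationAt F V e₀.proj).open_baseSet.mem_nhds hb.1] with b hb'
    exact extChartAt_totalSpace (e := ⟨b, FiberBundle.extend F e.2 b⟩) hb'
  have h3 := h2.mfderiv_eq (I := 𝓘(ℝ, EB)) (I' := 𝓘(ℝ, EB × F))
  have h4 := hφ.prodMk_space ht
  have h5 := mfderiv_clm_comp (ContinuousLinearMap.fst ℝ EB F) h4 u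
  have h6 := mfderiv_clm_comp (ContinuousLinearMap.snd ℝ EB F) h4 u
  rw [tangentCoord_eq_mfderiv hb.2]
  refine (congrArg (fun L : EB →L[ℝ] EB × F ↦ L u) h3).trans ?_
  exact Prod.ext h5.symm h6.symm

variable [FiniteDimensional ℝ F]

lemma tangentCoord_horLift (D : CovariantDerivative 𝓘(ℝ, EB) F V)
    (he : e ∈ (chartAt (ModelProd EB F) e₀).source) (u : TangentSpace 𝓘(ℝ, EB) e.proj) :
    tangentCoord (𝓘(ℝ, EB).prod 𝓘(ℝ, F)) e₀ e (horLift D e u) =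
      (tangentCoord 𝓘(ℝ, EB) e₀.proj e.proj u,
        -connectionForm D e₀.proj e.proj (tangentCoord 𝓘(ℝ, EB) e₀.proj e.proj u)
          ((trivializationAt F V e₀.proj).continuousLinearMapAt ℝ e.proj e.2)) := by
  have hb := mem_chartAt_source.1 he
  have h1 := connectionForm_apply D hb.1 (FiberBundle.mdifferentiableAt_extend 𝓘(ℝ, EB) F e.2)
    (tangentCoord 𝓘(ℝ, EB) e₀.proj e.proj u)
  rw [tangentCoordSymm_coord hb.2, FiberBundle.extend_apply_self] at h1
  have h2 : tangentCoord (𝓘(ℝ, EB).prod 𝓘(ℝ, F)) e₀ e (horLift D e u) =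
      tangentCoord (𝓘(ℝ, EB).prod 𝓘(ℝ, F)) e₀ e (dsection e u) -
      tangentCoord (𝓘(ℝ, EB).prod 𝓘(ℝ, F)) e₀ e (vertLift e (D (FiberBundle.extend F e.2) e.proj u))
      := map_sub (tangentCoord (𝓘(ℝ, EB).prod 𝓘(ℝ, F)) e₀ e) _ _
  rw [h2, tangentCoord_dsection he, tangentCoord_vertLift he, h1, Prod.mk_sub_mk, sub_zero,
    sub_add_cancel_left]

lemma tangentCoord_splitting (D : CovariantDerivative 𝓘(ℝ, EB) F V)
    (he : e ∈ (chartAt (ModelProd EB F) e₀).source)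
    (p : TangentSpace 𝓘(ℝ, EB) e.proj × V e.proj) :
    tangentCoord (𝓘(ℝ, EB).prod 𝓘(ℝ, F)) e₀ e (splitting D e p) =
      (tangentCoord 𝓘(ℝ, EB) e₀.proj e.proj p.1,
        (trivializationAt F V e₀.proj).continuousLinearMapAt ℝ e.proj p.2
        - connectionForm D e₀.proj e.proj (tangentCoord 𝓘(ℝ, EB) e₀.proj e.proj p.1)
          ((trivializationAt F V e₀.proj).continuousLinearMapAt ℝ e.proj e.2)) := by
  have h2 : tangentCoord (𝓘(ℝ, EB).prod 𝓘(ℝ, F)) e₀ e (splitting D e p) =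
      tangentCoord (𝓘(ℝ, EB).prod 𝓘(ℝ, F)) e₀ e (horLift D e p.1) +
      tangentCoord (𝓘(ℝ, EB).prod 𝓘(ℝ, F)) e₀ e (vertLift e p.2) :=
    map_add (tangentCoord (𝓘(ℝ, EB).prod 𝓘(ℝ, F)) e₀ e) _ _
  rw [h2, tangentCoord_horLift D he, tangentCoord_vertLift he, Prod.mk_add_mk, add_zero,
    neg_add_eq_sub]

/-- The vertical part of a tangent vector in a trivialization. -/
lemma vertPart_eq (D : CovariantDerivative 𝓘(ℝ, EB) F V)
    (he : e ∈ (chartAt (ModelProd EB F) e₀).source)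
    (v : TangentSpace (𝓘(ℝ, EB).prod 𝓘(ℝ, F)) e) :
    vertPart D e v = (trivializationAt F V e₀.proj).symmL ℝ e.proj
      ((tangentCoord (𝓘(ℝ, EB).prod 𝓘(ℝ, F)) e₀ e v).2
        + connectionForm D e₀.proj e.proj (tangentCoord (𝓘(ℝ, EB).prod 𝓘(ℝ, F)) e₀ e v).1
          ((trivializationAt F V e₀.proj).continuousLinearMapAt ℝ e.proj e.2)) := by
  have hb := mem_chartAt_source.1 he
  let T : TangentSpace (𝓘(ℝ, EB).prod 𝓘(ℝ, F)) e →L[ℝ] EB × F :=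
    tangentCoord (𝓘(ℝ, EB).prod 𝓘(ℝ, F)) e₀ e
  let R : TangentSpace (𝓘(ℝ, EB).prod 𝓘(ℝ, F)) e →L[ℝ]
      TangentSpace 𝓘(ℝ, EB) e.proj × V e.proj :=
    (tangentCoordSymm 𝓘(ℝ, EB) e₀.proj e.proj ∘L ContinuousLinearMap.fst ℝ EB F ∘L T).prod
      ((trivializationAt F V e₀.proj).symmL ℝ e.proj ∘L
        (ContinuousLinearMap.snd ℝ EB F + (connectionForm D e₀.proj e.proj).flip
          ((trivializationAt F V e₀.proj).continuousLinearMapAt ℝ e.proj e.2) ∘L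
          ContinuousLinearMap.fst ℝ EB F) ∘L T)
  have hR : ∀ v, R v = (tangentCoordSymm 𝓘(ℝ, EB) e₀.proj e.proj (T v).1,
      (trivializationAt F V e₀.proj).symmL ℝ e.proj ((T v).2
        + connectionForm D e₀.proj e.proj (T v).1
          ((trivializationAt F V e₀.proj).continuousLinearMapAt ℝ e.proj e.2))) := fun v ↦ rfl
  have h1 : (splitting D e).inverse = R := by
    apply ContinuousLinearMap.inverse_eq
    · ext v
      apply tangentCoord_injective he
      refine (tangentCoord_splitting D he (R v)).trans ?_
      simp only [hR]
      rw [tangentCoord_symm hb.2, Trivialization.continuousLinearMapAt_symmL _ hb.1,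
        add_sub_cancel_right]
      rfl
    · refine ContinuousLinearMap.ext fun p ↦ ?_
      have h2 : T (splitting D e p) = _ := tangentCoord_splitting D he p
      rw [ContinuousLinearMap.comp_apply, hR, h2]
      simp only
      rw [tangentCoordSymm_coord hb.2, sub_add_cancel,
        Trivialization.symmL_continuousLinearMapAt _ hb.1]
      rfl
  rw [vertPart, h1]
  rfl

end TotalSpace

end BundleMetric

namespace BundleMetric

open RiemGeom

section Chart

variable {EB : Type*} [NormedAddCommGroup EB] [NormedSpace ℝ EB]
  {B : Type*} [TopologicalSpace B] [ChartedSpace EB B] [IsManifold 𝓘(ℝ, EB) ∞ B]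
  {F : Type*} [NormedAddCommGroup F] [NormedSpace ℝ F]
  {V : B → Type*} [TopologicalSpace (TotalSpace F V)]
  [∀ b, NormedAddCommGroup (V b)] [∀ b, InnerProductSpace ℝ (V b)]
  [FiberBundle F V] [VectorBundle ℝ F V] [ContMDiffVectorBundle ∞ F V 𝓘(ℝ, EB)]
  {e₀ e : TotalSpace F V}

variable (EB F V) in
/-- The fibre norm in the chart at `b₀`. -/
def chartNorm (b₀ : B) : EB × F → ℝ :=
  fibreNorm fun x ↦ fibreForm F V b₀ ((extChartAt 𝓘(ℝ, EB) b₀).symm x)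

omit [IsManifold 𝓘(ℝ, EB) ∞ B] [ContMDiffVectorBundle ∞ F V 𝓘(ℝ, EB)] in
lemma extChartAt_symm_fst (he : e ∈ (chartAt (ModelProd EB F) e₀).source) :
    (extChartAt 𝓘(ℝ, EB) e₀.proj).symm (extChartAt (𝓘(ℝ, EB).prod 𝓘(ℝ, F)) e₀ e).1 = e.proj := by
  have hb := mem_chartAt_source.1 he
  rw [extChartAt_totalSpace hb.1]
  exact (extChartAt 𝓘(ℝ, EB) e₀.proj).left_inv (by rw [extChartAt_source]; exact hb.2)

lemma chartNorm_extChartAt (he : e ∈ (chartAt (ModelProd EB F) e₀).source) :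
    chartNorm EB F V e₀.proj (extChartAt (𝓘(ℝ, EB).prod 𝓘(ℝ, F)) e₀ e) = ‖e.2‖ := by
  have hb := mem_chartAt_source.1 he
  rw [chartNorm, fibreNorm, extChartAt_symm_fst he, extChartAt_totalSpace hb.1, fibreForm_apply]
  simp only
  rw [Trivialization.symmL_continuousLinearMapAt _ hb.1, real_inner_self_eq_norm_sq,
    Real.sqrt_sq (norm_nonneg _)]

lemma extChartAt_mem_puncturedDomain (he : e ∈ (chartAt (ModelProd EB F) e₀).source) :
    extChartAt (𝓘(ℝ, EB).prod 𝓘(ℝ, F)) e₀ e ∈ puncturedDomain (baseDomain EB F V e₀.proj) ↔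
      e ∈ awayFromZero V := by
  have hb := mem_chartAt_source.1 he
  have h1 : (extChartAt (𝓘(ℝ, EB).prod 𝓘(ℝ, F)) e₀ e).1 ∈ baseDomain EB F V e₀.proj := by
    refine ⟨?_, ?_⟩
    · rw [extChartAt_totalSpace hb.1]
      exact (extChartAt 𝓘(ℝ, EB) e₀.proj).map_source (by rw [extChartAt_source]; exact hb.2)
    · rw [Set.mem_preimage, extChartAt_symm_fst he]
      exact hb.1
  have h2 : (extChartAt (𝓘(ℝ, EB).prod 𝓘(ℝ, F)) e₀ e).2 ≠ 0 ↔ e.2 ≠ 0 := by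
    rw [extChartAt_totalSpace hb.1]
    refine not_congr ⟨fun h0 ↦ ?_, fun h0 ↦ ?_⟩
    · have := (trivializationAt F V e₀.proj).symmL_continuousLinearMapAt (R := ℝ) hb.1 e.2
      rw [← this]
      exact (congrArg _ h0).trans (map_zero _)
    · exact (congrArg ((trivializationAt F V e₀.proj).continuousLinearMapAt ℝ e.proj) h0).trans
        (map_zero ((trivializationAt F V e₀.proj).continuousLinearMapAt ℝ e.proj))
  exact ⟨fun h ↦ h2.1 h.2, fun h ↦ ⟨h1, h2.2 h⟩⟩

omit [IsManifold 𝓘(ℝ, EB) ∞ B] [∀ b, InnerProductSpace ℝ (V b)] [VectorBundle ℝ F V]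
  [ContMDiffVectorBundle ∞ F V 𝓘(ℝ, EB)] in
lemma puncturedDomain_subset_target :
    (puncturedDomain (baseDomain EB F V e₀.proj) : Set (EB × F)) ⊆
      (extChartAt (𝓘(ℝ, EB).prod 𝓘(ℝ, F)) e₀).target := by
  rw [FiberBundle.extChartAt_target]
  exact fun z hz ↦ ⟨hz.1, Set.mem_univ _⟩

lemma symm_mem_chartAt_source {z : EB × F}
    (hz : z ∈ puncturedDomain (baseDomain EB F V e₀.proj)) :
    (extChartAt (𝓘(ℝ, EB).prod 𝓘(ℝ, F)) e₀).symm z ∈ (chartAt (ModelProd EB F) e₀).source := by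
  rw [← extChartAt_source (𝓘(ℝ, EB).prod 𝓘(ℝ, F))]
  exact (extChartAt _ e₀).map_target (puncturedDomain_subset_target hz)

lemma extChartAt_extChartAt_symm {z : EB × F}
    (hz : z ∈ puncturedDomain (baseDomain EB F V e₀.proj)) :
    extChartAt (𝓘(ℝ, EB).prod 𝓘(ℝ, F)) e₀ ((extChartAt (𝓘(ℝ, EB).prod 𝓘(ℝ, F)) e₀).symm z) = z :=
  (extChartAt _ e₀).right_inv (puncturedDomain_subset_target hz)

lemma symm_mem_awayFromZero {z : EB × F}
    (hz : z ∈ puncturedDomain (baseDomain EB F V e₀.proj)) :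
    (extChartAt (𝓘(ℝ, EB).prod 𝓘(ℝ, F)) e₀).symm z ∈ awayFromZero V := by
  rwa [← extChartAt_mem_puncturedDomain (symm_mem_chartAt_source hz),
    extChartAt_extChartAt_symm hz]

lemma norm_symm {z : EB × F} (hz : z ∈ puncturedDomain (baseDomain EB F V e₀.proj)) :
    ‖((extChartAt (𝓘(ℝ, EB).prod 𝓘(ℝ, F)) e₀).symm z).2‖ = chartNorm EB F V e₀.proj z := by
  rw [← chartNorm_extChartAt (symm_mem_chartAt_source hz), extChartAt_extChartAt_symm hz]

lemma tangentCoord_radialField (he : e ∈ (chartAt (ModelProd EB F) e₀).source) :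
    tangentCoord (𝓘(ℝ, EB).prod 𝓘(ℝ, F)) e₀ e (radialField e) =
      ‖e.2‖⁻¹ • eulerField (extChartAt (𝓘(ℝ, EB).prod 𝓘(ℝ, F)) e₀ e) := by
  rw [radialField, tangentCoord_vertLift he, map_smul,
    extChartAt_totalSpace (mem_chartAt_source.1 he).1, eulerField, Prod.smul_mk, smul_zero]

lemma fieldRep_radialField (s : ℝ → ℝ) {z : EB × F}
    (hz : z ∈ puncturedDomain (baseDomain EB F V e₀.proj)) :
    fieldRep (𝓘(ℝ, EB).prod 𝓘(ℝ, F)) e₀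
      (fun e : TotalSpace F V ↦ s ‖e.2‖ • (radialField e :
        TangentSpace (𝓘(ℝ, EB).prod 𝓘(ℝ, F)) e)) z =
      radField (chartNorm EB F V e₀.proj) eulerField s z := by
  rw [fieldRep, map_smul, tangentCoord_radialField (symm_mem_chartAt_source hz),
    extChartAt_extChartAt_symm hz, norm_symm hz, radField, smul_smul, div_eq_mul_inv]

variable [FiniteDimensional ℝ F]

/-- The metric of the total space in the chart at `e₀`. -/
def chartMetric (gB : ContMDiffRiemannianMetric 𝓘(ℝ, EB) ∞ EB
      (fun b : B ↦ TangentSpace 𝓘(ℝ, EB) b))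
    (D : CovariantDerivative 𝓘(ℝ, EB) F V) (h k : ℝ → ℝ) (b₀ : B) :
    EB × F → EB × F →L[ℝ] EB × F →L[ℝ] ℝ :=
  totalMetric (fun x ↦ baseForm gB b₀ ((extChartAt 𝓘(ℝ, EB) b₀).symm x))
    (fun x ↦ fibreForm F V b₀ ((extChartAt 𝓘(ℝ, EB) b₀).symm x))
    (fun x ↦ connectionForm D b₀ ((extChartAt 𝓘(ℝ, EB) b₀).symm x)) h k

lemma bundleMetric_eq (gB : ContMDiffRiemannianMetric 𝓘(ℝ, EB) ∞ EB
      (fun b : B ↦ TangentSpace 𝓘(ℝ, EB) b))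
    (D : CovariantDerivative 𝓘(ℝ, EB) F V) (h k : ℝ → ℝ)
    (he : e ∈ (chartAt (ModelProd EB F) e₀).source)
    (v w : TangentSpace (𝓘(ℝ, EB).prod 𝓘(ℝ, F)) e) :
    bundleMetric gB D h k e v w =
      chartMetric gB D h k e₀.proj (extChartAt (𝓘(ℝ, EB).prod 𝓘(ℝ, F)) e₀ e)
        (tangentCoord (𝓘(ℝ, EB).prod 𝓘(ℝ, F)) e₀ e v)
        (tangentCoord (𝓘(ℝ, EB).prod 𝓘(ℝ, F)) e₀ e w) := by
  have hb := mem_chartAt_source.1 he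
  have h1 := chartNorm_extChartAt he
  rw [chartNorm] at h1
  rw [bundleMetric, chartMetric, totalMetric_apply, h1, extChartAt_symm_fst he, baseForm_apply,
    fibreForm_apply, tangentCoord_fst he, tangentCoord_fst he, tangentCoordSymm_coord hb.2,
    tangentCoordSymm_coord hb.2, vertPart_eq D he, vertPart_eq D he, tangentCoord_fst he,
    tangentCoord_fst he, extChartAt_totalSpace hb.1]

variable [FiniteDimensional ℝ EB] [T2Space B] [IsContMDiffRiemannianBundle 𝓘(ℝ, EB) ∞ F V]
    {gB : ContMDiffRiemannianMetric 𝓘(ℝ, EB) ∞ EB (fun b : B ↦ TangentSpace 𝓘(ℝ, EB) b)}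
    {D : CovariantDerivative 𝓘(ℝ, EB) F V} [D.ContMDiffCovariantDerivative ∞]
    (hD : D.IsMetricCompatible) {h k : ℝ → ℝ}
    (hh : ContDiffOn ℝ ∞ h (Set.Ioi 0)) (hk : ContDiffOn ℝ ∞ k (Set.Ioi 0))
    (hh_pos : ∀ t, 0 < t → 0 < h t) (hk_pos : ∀ t, 0 < t → 0 < k t)

include hD hh hk hh_pos hk_pos in
lemma isRadial_chartMetric (b₀ : B) :
    IsRadial (chartMetric gB D h k b₀) (puncturedDomain (baseDomain EB F V b₀))
      (chartNorm EB F V b₀) eulerField h k (Module.finrank ℝ EB) (Module.finrank ℝ F) :=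
  (isTrivialBundleData gB D hD b₀).isRadial hh hk hh_pos hk_pos

include hD hh hk hh_pos hk_pos in
lemma isMetricChart (he₀ : e₀ ∈ awayFromZero V) :
    IsMetricChart (bundleMetric gB D h k) e₀ (chartMetric gB D h k e₀.proj)
      (puncturedDomain (baseDomain EB F V e₀.proj)) where
  toIsMetricOn := (isRadial_chartMetric hD hh hk hh_pos hk_pos e₀.proj).toIsMetricOn
  subset := puncturedDomain_subset_target
  mem := (extChartAt_mem_puncturedDomain (mem_chart_source _ e₀)).2 he₀
  eq _ he _ v w := bundleMetric_eq gB D h k he v w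

end Chart

end BundleMetric

namespace RiemGeom

variable {h k s : ℝ → ℝ}
  (hh : ContDiffOn ℝ ∞ h (Set.Ioi 0)) (hk : ContDiffOn ℝ ∞ k (Set.Ioi 0))
  (hs : ContDiffOn ℝ ∞ s (Set.Ioi 0))
  (hh_pos : ∀ t, 0 < t → 0 < h t) (hk_pos : ∀ t, 0 < t → 0 < k t) (n m : ℕ) {r : ℝ} (hr : 0 < r)

include hk hs hk_pos hr in
lemma radDiv_grad : radDiv h k n m (fun t ↦ deriv s t / k t ^ 2) r =
    1 / k r ^ 2 * deriv (deriv s) r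
      + ((m - 1) / (k r ^ 2 * r) + n * deriv h r / (h r * k r ^ 2)
        + (m - 2) * deriv k r / k r ^ 3) * deriv s r := by
  have hk0 := (hk_pos r hr).ne'
  have h1 := ((hasDerivAt_of_contDiffOn (contDiffOn_deriv hs) hr).fun_div
    ((hasDerivAt_of_contDiffOn hk hr).fun_pow 2) (pow_ne_zero 2 hk0)).deriv
  rw [radDiv, h1]
  push_cast
  field_simp
  ring

include hh hk hs hh_pos hk_pos hr in
lemma deriv_radDiv : deriv (radDiv h k n m s) r =
    deriv (deriv s) r + ((m - 1) / r + n * (deriv h r / h r) + m * (deriv k r / k r)) * deriv s r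
      + (-((m - 1) / r ^ 2) + n * (deriv (deriv h) r / h r - deriv h r ^ 2 / h r ^ 2)
        + m * (deriv (deriv k) r / k r - deriv k r ^ 2 / k r ^ 2)) * s r := by
  have hk0 := (hk_pos r hr).ne'
  have hh0 := (hh_pos r hr).ne'
  have h1 := (hasDerivAt_const r ((m : ℝ) - 1)).fun_div (hasDerivAt_id' r) hr.ne'
  have h2 := (hasDerivAt_of_contDiffOn (contDiffOn_deriv hh) hr).fun_div
    (hasDerivAt_of_contDiffOn hh hr) hh0
  have h3 := (hasDerivAt_of_contDiffOn (contDiffOn_deriv hk) hr).fun_div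
    (hasDerivAt_of_contDiffOn hk hr) hk0
  have h4 : HasDerivAt (radDiv h k n m s) _ r :=
    (hasDerivAt_of_contDiffOn (contDiffOn_deriv hs) hr).fun_add
      (((h1.fun_add (h2.const_mul (n : ℝ))).fun_add (h3.const_mul (m : ℝ))).fun_mul
        (hasDerivAt_of_contDiffOn hs hr))
  rw [h4.deriv]
  field_simp
  ring

include hk hs hk_pos hr in
lemma deriv_radial_eigenvalue : deriv (fun t ↦ deriv s t + s t * (deriv k t / k t)) r =
    deriv (deriv s) r + deriv s r * (deriv k r / k r)
      + s r * (deriv (deriv k) r / k r - deriv k r ^ 2 / k r ^ 2) := by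
  have hk0 := (hk_pos r hr).ne'
  have h3 := (hasDerivAt_of_contDiffOn (contDiffOn_deriv hk) hr).fun_div
    (hasDerivAt_of_contDiffOn hk hr) hk0
  rw [((hasDerivAt_of_contDiffOn (contDiffOn_deriv hs) hr).fun_add
    ((hasDerivAt_of_contDiffOn hs hr).fun_mul h3)).deriv]
  field_simp
  ring

end RiemGeom

end

theorem mainTheorem8
    {EB : Type*} [NormedAddCommGroup EB] [NormedSpace ℝ EB] [FiniteDimensional ℝ EB]
    {B : Type*} [TopologicalSpace B] [T2Space B] [ChartedSpace EB B] [IsManifold 𝓘(ℝ, EB) ∞ B]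
    {F : Type*} [NormedAddCommGroup F] [NormedSpace ℝ F] [FiniteDimensional ℝ F]
    {V : B → Type*} [TopologicalSpace (TotalSpace F V)]
    [∀ b, NormedAddCommGroup (V b)] [∀ b, InnerProductSpace ℝ (V b)]
    [FiberBundle F V] [VectorBundle ℝ F V] [ContMDiffVectorBundle ∞ F V 𝓘(ℝ, EB)]
    [IsContMDiffRiemannianBundle 𝓘(ℝ, EB) ∞ F V]
    (gB : ContMDiffRiemannianMetric 𝓘(ℝ, EB) ∞ EB (fun b : B ↦ TangentSpace 𝓘(ℝ, EB) b))
    (D : CovariantDerivative 𝓘(ℝ, EB) F V) [D.ContMDiffCovariantDerivative ∞]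
    (hD : D.IsMetricCompatible)
    (n m : ℕ) (hn : Module.finrank ℝ EB = n) (hm : Module.finrank ℝ F = m)
    (h k s : ℝ → ℝ)
    (hh : ContDiffOn ℝ ∞ h (Set.Ioi 0)) (hk : ContDiffOn ℝ ∞ k (Set.Ioi 0))
    (hs : ContDiffOn ℝ ∞ s (Set.Ioi 0))
    (hh_pos : ∀ r, 0 < r → 0 < h r) (hk_pos : ∀ r, 0 < r → 0 < k r) :
    let J := 𝓘(ℝ, EB).prod 𝓘(ℝ, F)
    let g : ∀ e : TotalSpace F V, TangentSpace J e → TangentSpace J e → ℝ :=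
      BundleMetric.bundleMetric gB D h k
    let U : Set (TotalSpace F V) := BundleMetric.awayFromZero V
    let X : ∀ e : TotalSpace F V, TangentSpace J e :=
      fun e ↦ s ‖e.2‖ • BundleMetric.radialField e
    (∀ e ∈ U, ∀ r, r = ‖e.2‖ →
      RiemGeom.laplacian J g U (fun e' ↦ s ‖e'.2‖) e =
        1 / k r ^ 2 * deriv (deriv s) r
          + ((m - 1) / (k r ^ 2 * r) + n * deriv h r / (h r * k r ^ 2)
              + (m - 2) * deriv k r / k r ^ 3) * deriv s r) ∧
    (RiemGeom.IsRicciFlatOn J g U → ∀ e ∈ U, ∀ r, r = ‖e.2‖ →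
      RiemGeom.vectorLaplacian J g U X e =
        (1 / k r ^ 2 * deriv (deriv s) r
          + ((m - 1) / (k r ^ 2 * r) + n * deriv h r / (h r * k r ^ 2)
              + m * deriv k r / k r ^ 3) * deriv s r
          + (-((m - 1) / (k r ^ 2 * r ^ 2)) + n * deriv (deriv h) r / (h r * k r ^ 2)
              - n * deriv h r ^ 2 / (h r ^ 2 * k r ^ 2) + m * deriv (deriv k) r / k r ^ 3
              - m * deriv k r ^ 2 / k r ^ 4) * s r) • BundleMetric.radialField e ∧
      RiemGeom.normSqNabla J g U X e =
        -((m - 1) * s r ^ 2 * deriv (deriv k) r / k r) + deriv s r ^ 2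
          + 2 * s r * deriv s r * deriv k r / k r
          + (2 * m - 1) * s r ^ 2 * deriv k r ^ 2 / k r ^ 2
          + (m - 1) * s r ^ 2 * deriv k r / (k r * r)
          + n * s r ^ 2 * deriv h r * deriv k r / (h r * k r)
          + (m - 1) * s r ^ 2 / r ^ 2
          - n * s r ^ 2 * deriv (deriv h) r / h r
          + n * s r ^ 2 * deriv h r ^ 2 / h r ^ 2) := by
  intro J g U X
  have hG : ∀ e ∈ U, RiemGeom.IsMetricChart g e (BundleMetric.chartMetric gB D h k e.proj)
      (RiemGeom.puncturedDomain (BundleMetric.baseDomain EB F V e.proj)) := fun e he ↦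
    BundleMetric.isMetricChart hD hh hk hh_pos hk_pos he
  have hU : ∀ e ∈ U, ∃ G N, RiemGeom.IsMetricChart g e G N := fun e he ↦ ⟨_, _, hG e he⟩
  have hN : ∀ e : TotalSpace F V,
      ∀ z ∈ RiemGeom.puncturedDomain (BundleMetric.baseDomain EB F V e.proj),
      (extChartAt J e).symm z ∈ U := fun e z hz ↦ BundleMetric.symm_mem_awayFromZero hz
  have hR := BundleMetric.isRadial_chartMetric (gB := gB) hD hh hk hh_pos hk_pos
  rw [hn, hm] at hR
  have hr : ∀ e : TotalSpace F V,
      BundleMetric.chartNorm EB F V e.proj (extChartAt J e e) = ‖e.2‖ := fun e ↦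
    BundleMetric.chartNorm_extChartAt (mem_chart_source _ e)
  have hX : ∀ e : TotalSpace F V,
      ∀ z ∈ RiemGeom.puncturedDomain (BundleMetric.baseDomain EB F V e.proj),
      RiemGeom.fieldRep J e X z =
        RiemGeom.radField (BundleMetric.chartNorm EB F V e.proj) RiemGeom.eulerField s z :=
    fun e z hz ↦ BundleMetric.fieldRep_radialField s hz
  refine ⟨fun e he r hre ↦ ?_, fun hric e he r hre ↦ ⟨?_, ?_⟩⟩
  · have hr0 : 0 < r := hre ▸ norm_pos_iff.2 he
    rw [RiemGeom.laplacian_radial hU (hG e he) (hN e) (hR e.proj) hk hs hk_pos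
      fun z hz ↦ by rw [BundleMetric.norm_symm hz], hr, ← hre]
    exact RiemGeom.radDiv_grad hk hs hk_pos n m hr0
  · have hr0 : 0 < r := hre ▸ norm_pos_iff.2 he
    have hk0 := (hk_pos r hr0).ne'
    have hh0 := (hh_pos r hr0).ne'
    apply RiemGeom.tangentCoord_injective (I := J) (mem_chart_source _ e)
    have h1 := RiemGeom.vectorLaplacian_radial hU (hG e he) (hN e) (hR e.proj) hh hk hs hh_pos
      hk_pos hric (hX e)
    rw [hr, ← hre] at h1
    rw [h1, map_smul, BundleMetric.tangentCoord_radialField (mem_chart_source _ e), ← hre,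
      RiemGeom.deriv_radDiv hh hk hs hh_pos hk_pos n m hr0]
    congr 1
    field_simp
    ring
  · have hr0 : 0 < r := hre ▸ norm_pos_iff.2 he
    have hk0 := (hk_pos r hr0).ne'
    have hh0 := (hh_pos r hr0).ne'
    rw [RiemGeom.normSqNabla_radial hU (hG e he) (hN e) (hR e.proj) hh hk hs hh_pos hk_pos hric
      (hX e) (hre.trans (hr e).symm), RiemGeom.deriv_radDiv hh hk hs hh_pos hk_pos n m hr0,
      RiemGeom.deriv_radial_eigenvalue hk hs hk_pos hr0, RiemGeom.radDiv]
    field_simp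
    ring
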